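/- Let $q<0$, $p>4$, and let either $\sigma=1$ and $0<\omega<\tfrac12q^2$ (defocusing case), or $\sigma=-1$ and $\omega>\tfrac12q^2$ (focusing case). Let \[ Q_\omega(x)=\begin{cases}\bigl[\tfrac{(p+2)\omega}{2}\bigr]^{1/p}\sinh^{-2/p}\bigl[p\sqrt{\tfrac{\omega}{2}}\,|x|+\operatorname{arctanh}\tfrac{\sqrt{2\omega}}{|q|}\bigr], & \sigma=1,\\[2pt] \bigl[\tfrac{(p+2)\omega}{2}\bigr]^{1/p}\cosh^{-2/p}\bigl[p\sqrt{\tfrac{\omega}{2}}\,|x|+\operatorname{arctanh}\tfrac{|q|}{\sqrt{2\omega}}\bigr], & \sigma=-1,\end{cases} \] let $H=-\tfrac12\partial_x^2$ on the domain $\{u\in H^1(\mathbb R)\cap H^2(\mathbb R\setminus\{0\}):\ u'(0+)-u'(0-)=2q\,u(0)\}$ in $L^2(\mathbb R)$ (that is, $H=-\tfrac12\partial_x^2+q\delta_0$), and let \[ \mathcal H=\begin{bmatrix}H+\omega&0\\0&-H-\omega\end{bmatrix}+\sigma Q_\omega^p\begin{bmatrix}\tfrac{p+2}{2}&\tfrac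 p2\\-\tfrac p2&-\tfrac{p+2}{2}\end{bmatrix} \] on $L^2(\mathbb R;\mathbb C^2)$. For $\lambda\in\mathbb R$, a solution of $\mathcal Hf=\lambda f$ is a continuous $f:\mathbb R\to\mathbb C^2$, not necessarily square integrable, that solves the differential equation on $\mathbb R\setminus\{0\}$ and satisfies $f'(0+)-f'(0-)=2qf(0)$. Call $\lambda$ a resonance of $\mathcal H$ if $\mathcal Hf=\lambda f$ has a solution in $(L^\infty\cap\dot H^1)\setminus L^2$. For $\mathbb C^2$-valued solutions put $W[f,g]={}^tf'g-{}^tfg'$, and for $2\times2$ matrix-valued solutions $\mathcal W[F,G]={}^tF'G-{}^tFG'$; for solutions with the same $\lambda$ these do not depend on $x\neq0$. For $\xi\in\mathbb R$ let $\mu=\sqrt{\xi^2+4\omega}$. Then there are solutions $f_1,f_2,f_3,\tilde f_4$ of $\mathcal Hf=(\tfrac12\xi^2+\omega)f$ such that, as $x\to+\infty$, \[ e^{-i\xi x}f_1\to\begin{bmatrix}1\\0\end{bmatrix},\quad e^{i\xi x}f_2\to\begin{bmatrix}1\\0\end{bmatrix},\quad e^{\mu x}f_3\to\begin{bmatrix}0\\1\end{bmatrix},\quad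 e^{-\mu x}\tilde f_4\to\begin{bmatrix}0\\1\end{bmatrix}, \] and the $x$-derivatives of the four functions on the left tend to $0$. Fix any such solutions. For $\xi\ne0$ let \[ f_4=\tilde f_4+\tfrac1{2i\xi}W[f_2,\tilde f_4]\,f_1-\tfrac1{2i\xi}W[f_1,\tilde f_4]\,f_2 . \] Let $g_j(x)=f_j(-x)$, $F_1=[f_1\ f_3]$, $G_1=[g_2\ g_4]$, $G_2=[g_1\ g_3]$, and $D(\xi)=\mathcal W[F_1,G_2]$. If $\xi\neq0$, there are matrices $A(\xi),B(\xi)\in\mathbb C^{2\times2}$ with $F_1=G_1A(\xi)+G_2B(\xi)$ on $\mathbb R$, and for any such matrices the following are equivalent: (i) $\det D(\xi)=0$; (ii) $\tfrac12\xi^2+\omega$ is an eigenvalue of $\mathcal H$; (iii) $\det A(\xi)=0$. For $\xi=0$ the following are equivalent: (i') $\det D(0)=0$; (ii') $\omega$ is a resonance or an eigenvalue of $\mathcal H$. -/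

import Mathlib

open MeasureTheory Filter Topology Matrix

namespace DeltaNLS

noncomputable section

/-- The profile `Q_ω` of the solitary wave: the `sinh` formula in the defocusing case `σ = 1`,
the `cosh` formula in the focusing case `σ = -1`. -/
def soliton (σ p q ω x : ℝ) : ℝ :=
  if σ = 1 then
    ((p + 2) * ω / 2) ^ (1 / p) *
      Real.sinh (p * √(ω / 2) * |x| + Real.artanh (√(2 * ω) / |q|)) ^ (-(2 / p))
  else
    ((p + 2) * ω / 2) ^ (1 / p) *
      Real.cosh (p * √(ω / 2) * |x| + Real.artanh (|q| / √(2 * ω))) ^ (-(2 / p))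

/-- The admissible frequencies: `(0, q² / 2)` in the defocusing case `σ = 1`, and `(q² / 2, ∞)` in
the focusing case `σ = -1`. -/
def AdmissibleFrequency (σ q ω : ℝ) : Prop :=
  (σ = 1 ∧ 0 < ω ∧ ω < q ^ 2 / 2) ∨ (σ = -1 ∧ q ^ 2 / 2 < ω)

/-- The third Pauli matrix. -/
def pauli3 : Matrix (Fin 2) (Fin 2) ℂ := !![1, 0; 0, -1]

/-- The matrix potential `𝒱 = σ Q_ω^p [(p+2)/2, p/2; -p/2, -(p+2)/2]`. -/
def potential (σ p q ω x : ℝ) : Matrix (Fin 2) (Fin 2) ℂ :=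
  ((σ * soliton σ p q ω x ^ p : ℝ) : ℂ) •
    !![((p : ℂ) + 2) / 2, (p : ℂ) / 2; -((p : ℂ) / 2), -(((p : ℂ) + 2) / 2)]

/-- The value at `x` of `ℋ u = σ₃ (-u'' / 2 + ω u) + 𝒱 u`, where `v` and `w` are the values of `u`
and of `u''` at `x`. The delta potential acts only through the jump condition at `0`. -/
def hamiltonian (σ p q ω x : ℝ) (v w : Fin 2 → ℂ) : Fin 2 → ℂ :=
  pauli3 *ᵥ (-(1 / 2 : ℂ) • w + (ω : ℂ) • v) + potential σ p q ω x *ᵥ v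

/-- `u` lies in the domain `{u ∈ H¹(ℝ) ∩ H²(ℝ ∖ {0}) : u'(0+) - u'(0-) = 2 q u(0)}` of
`H = -½ ∂² + q δ₀`, with first and second derivatives `u₁`, `u₂` away from `0`. Here `H¹` on the line
and `H²` on the half-lines are described by absolutely continuous representatives. -/
structure InDomain (q : ℝ) (u u₁ u₂ : ℝ → ℂ) : Prop where
  memLp : MemLp u 2
  memLp_fst : MemLp u₁ 2
  memLp_snd : MemLp u₂ 2
  eq_integral : ∀ x, u x = u 0 + ∫ t in (0 : ℝ)..x, u₁ t
  jump : ∃ a b : ℂ,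
    (∀ x > 0, u₁ x = a + ∫ t in (0 : ℝ)..x, u₂ t) ∧
    (∀ x < 0, u₁ x = b + ∫ t in (0 : ℝ)..x, u₂ t) ∧
    a - b = 2 * q * u 0

/-- `lam` is an eigenvalue of the operator `ℋ` on `L²(ℝ; ℂ²)`, whose domain consists of the `u` both
of whose components lie in the domain of `H`. -/
def IsEigenvalue (σ p q ω lam : ℝ) : Prop :=
  ∃ u u₁ u₂ : ℝ → Fin 2 → ℂ,
    (∀ i, InDomain q (fun x => u x i) (fun x => u₁ x i) (fun x => u₂ x i)) ∧
    ¬ (u =ᵐ[volume] 0) ∧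
    ∀ᵐ x : ℝ, hamiltonian σ p q ω x (u x) (u₂ x) = (lam : ℂ) • u x

/-- `f` solves the generalized eigenvalue problem `ℋ f = lam f`: it is continuous, solves the
differential equation away from `0`, and satisfies the jump condition at `0`. No integrability is
required. -/
structure IsSolution (σ p q ω lam : ℝ) (f : ℝ → Fin 2 → ℂ) : Prop where
  continuous : Continuous f
  differentiableAt : ∀ x ≠ 0, DifferentiableAt ℝ f x
  differentiableAt_deriv : ∀ x ≠ 0, DifferentiableAt ℝ (deriv f) x
  equation : ∀ x ≠ 0,
    hamiltonian σ p q ω x (f x) (deriv (deriv f) x) = (lam : ℂ) • f x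
  jump : ∃ a b : Fin 2 → ℂ,
    Tendsto (deriv f) (𝓝[>] 0) (𝓝 a) ∧ Tendsto (deriv f) (𝓝[<] 0) (𝓝 b) ∧
    a - b = (2 * q : ℂ) • f 0

/-- `lam` is a resonance of `ℋ`: the generalized eigenvalue problem has a solution in
`(L^∞ ∩ Ḣ¹) ∖ L²`. -/
def IsResonance (σ p q ω lam : ℝ) : Prop :=
  ∃ f : ℝ → Fin 2 → ℂ, IsSolution σ p q ω lam f ∧
    MemLp f ⊤ ∧ MemLp (deriv f) 2 ∧ ¬ MemLp f 2

/-- `W[f, g](x) = ᵗf'(x) g(x) - ᵗf(x) g'(x)`. -/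
def wronskianAt (f g : ℝ → Fin 2 → ℂ) (x : ℝ) : ℂ :=
  deriv f x ⬝ᵥ g x - f x ⬝ᵥ deriv g x

/-- The Wronskian of two solutions. It does not depend on the point `x ≠ 0` at which it is
evaluated, see `IsSolution.wronskianAt_eq`. -/
def wronskian (f g : ℝ → Fin 2 → ℂ) : ℂ := wronskianAt f g 1

/-- The entrywise derivative of a matrix-valued function. -/
def matrixDeriv (F : ℝ → Matrix (Fin 2) (Fin 2) ℂ) (x : ℝ) : Matrix (Fin 2) (Fin 2) ℂ :=
  Matrix.of fun i j => deriv (fun y => F y i j) x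

/-- `𝒲[F, G](x) = ᵗF'(x) G(x) - ᵗF(x) G'(x)`. -/
def matrixWronskianAt (F G : ℝ → Matrix (Fin 2) (Fin 2) ℂ) (x : ℝ) : Matrix (Fin 2) (Fin 2) ℂ :=
  (matrixDeriv F x)ᵀ * G x - (F x)ᵀ * matrixDeriv G x

/-- `μ = √(ξ² + 4 ω)`. -/
def decayRate (ω ξ : ℝ) : ℝ := √(ξ ^ 2 + 4 * ω)

/-- Solutions `f₁, f₂, f₃, f̃₄` of `ℋ f = (ξ² / 2 + ω) f` that, together with their first derivatives,
behave like `e^{iξx} (1, 0)`, `e^{-iξx} (1, 0)`, `e^{-μx} (0, 1)`, `e^{μx} (0, 1)` as `x → ∞`. -/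
structure JostSolutions (σ p q ω ξ : ℝ) where
  f₁ : ℝ → Fin 2 → ℂ
  f₂ : ℝ → Fin 2 → ℂ
  f₃ : ℝ → Fin 2 → ℂ
  fTilde₄ : ℝ → Fin 2 → ℂ
  sol₁ : IsSolution σ p q ω (ξ ^ 2 / 2 + ω) f₁
  sol₂ : IsSolution σ p q ω (ξ ^ 2 / 2 + ω) f₂
  sol₃ : IsSolution σ p q ω (ξ ^ 2 / 2 + ω) f₃
  solTilde₄ : IsSolution σ p q ω (ξ ^ 2 / 2 + ω) fTilde₄
  lim₁ : Tendsto (fun x : ℝ => Complex.exp (-(Complex.I * ξ * x)) • f₁ x) atTop (𝓝 ![1, 0])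
  lim₂ : Tendsto (fun x : ℝ => Complex.exp (Complex.I * ξ * x) • f₂ x) atTop (𝓝 ![1, 0])
  lim₃ : Tendsto (fun x : ℝ => Complex.exp (decayRate ω ξ * x) • f₃ x) atTop (𝓝 ![0, 1])
  limTilde₄ : Tendsto (fun x : ℝ => Complex.exp (-(decayRate ω ξ * x)) • fTilde₄ x) atTop (𝓝 ![0, 1])
  lim_deriv₁ : Tendsto (deriv fun x : ℝ => Complex.exp (-(Complex.I * ξ * x)) • f₁ x) atTop (𝓝 0)
  lim_deriv₂ : Tendsto (deriv fun x : ℝ => Complex.exp (Complex.I * ξ * x) • f₂ x) atTop (𝓝 0)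
  lim_deriv₃ : Tendsto (deriv fun x : ℝ => Complex.exp (decayRate ω ξ * x) • f₃ x) atTop (𝓝 0)
  lim_derivTilde₄ :
    Tendsto (deriv fun x : ℝ => Complex.exp (-(decayRate ω ξ * x)) • fTilde₄ x) atTop (𝓝 0)

namespace JostSolutions

variable {σ p q ω ξ : ℝ} (J : JostSolutions σ p q ω ξ)

def c₁ : ℂ := -(1 / (2 * Complex.I * ξ)) * wronskian J.f₂ J.fTilde₄

def c₂ : ℂ := 1 / (2 * Complex.I * ξ) * wronskian J.f₁ J.fTilde₄

/-- `f₄ = f̃₄ - c₁ f₁ - c₂ f₂`, used only for `ξ ≠ 0`. -/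
def f₄ (x : ℝ) : Fin 2 → ℂ := J.fTilde₄ x - J.c₁ • J.f₁ x - J.c₂ • J.f₂ x

/-- `g_j(x) = f_j(-x)`. -/
def g₁ (x : ℝ) : Fin 2 → ℂ := J.f₁ (-x)

def g₂ (x : ℝ) : Fin 2 → ℂ := J.f₂ (-x)

def g₃ (x : ℝ) : Fin 2 → ℂ := J.f₃ (-x)

def g₄ (x : ℝ) : Fin 2 → ℂ := J.f₄ (-x)

/-- The matrix with columns `f₁, f₃`. -/
def F₁ (x : ℝ) : Matrix (Fin 2) (Fin 2) ℂ := (Matrix.of ![J.f₁ x, J.f₃ x])ᵀ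

/-- The matrix with columns `g₂, g₄`. -/
def G₁ (x : ℝ) : Matrix (Fin 2) (Fin 2) ℂ := (Matrix.of ![J.g₂ x, J.g₄ x])ᵀ

/-- The matrix with columns `g₁, g₃`. -/
def G₂ (x : ℝ) : Matrix (Fin 2) (Fin 2) ℂ := (Matrix.of ![J.g₁ x, J.g₃ x])ᵀ

/-- `D(ξ) = 𝒲[F₁, G₂]`. It does not depend on the point `x ≠ 0` at which it is evaluated, see
`JostSolutions.matrixWronskianAt_eq`. -/
def D : Matrix (Fin 2) (Fin 2) ℂ := matrixWronskianAt J.F₁ J.G₂ 1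

/-- The matrices `A(ξ)`, `B(ξ)` satisfy `F₁ = G₁ A + G₂ B`. -/
def IsScatteringPair (A B : Matrix (Fin 2) (Fin 2) ℂ) : Prop :=
  ∀ x, J.F₁ x = J.G₁ x * A + J.G₂ x * B

end JostSolutions

/-! The Wronskian does not depend on the point. -/

theorem IsSolution.deriv_deriv_eq {σ p q ω lam : ℝ} {f : ℝ → Fin 2 → ℂ}
    (hf : IsSolution σ p q ω lam f) {x : ℝ} (hx : x ≠ 0) (i : Fin 2) :
    deriv (deriv f) x i =
      2 * (((σ * soliton σ p q ω x ^ p : ℝ) : ℂ) *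
        (((p : ℂ) + 2) / 2 * f x i + (p : ℂ) / 2 * f x (1 - i)) + ω * f x i -
        lam * pauli3 i i * f x i) := by
  have h := congrFun (hf.equation x hx) i
  fin_cases i <;>
    simp [hamiltonian, potential, pauli3, dotProduct, Fin.sum_univ_two] at h ⊢
  · linear_combination (-2 : ℂ) * h
  · linear_combination (2 : ℂ) * h

theorem IsSolution.hasDerivAt_wronskianAt {σ p q ω lam : ℝ} {f g : ℝ → Fin 2 → ℂ}
    (hf : IsSolution σ p q ω lam f) (hg : IsSolution σ p q ω lam g) {x : ℝ} (hx : x ≠ 0) :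
    HasDerivAt (wronskianAt f g) 0 x := by
  have f0 := fun i => hasDerivAt_pi.1 (hf.differentiableAt x hx).hasDerivAt i
  have g0 := fun i => hasDerivAt_pi.1 (hg.differentiableAt x hx).hasDerivAt i
  have f1 := fun i => hasDerivAt_pi.1 (hf.differentiableAt_deriv x hx).hasDerivAt i
  have g1 := fun i => hasDerivAt_pi.1 (hg.differentiableAt_deriv x hx).hasDerivAt i
  have key := ((((f1 0).mul (g0 0)).add ((f1 1).mul (g0 1))).sub
    (((f0 0).mul (g1 0)).add ((f0 1).mul (g1 1))))
  refine (key.congr_deriv ?_).congr_of_eventuallyEq (Eventually.of_forall fun y => ?_)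
  · have a0 := hf.deriv_deriv_eq hx 0
    have a1 := hf.deriv_deriv_eq hx 1
    have b0 := hg.deriv_deriv_eq hx 0
    have b1 := hg.deriv_deriv_eq hx 1
    simp only [sub_zero, sub_self] at a0 a1 b0 b1
    linear_combination (g x 0) * a0 + (g x 1) * a1 - (f x 0) * b0 - (f x 1) * b1
  · simp [wronskianAt, dotProduct, Fin.sum_univ_two]

theorem IsSolution.wronskianAt_eq {σ p q ω lam : ℝ} {f g : ℝ → Fin 2 → ℂ}
    (hf : IsSolution σ p q ω lam f) (hg : IsSolution σ p q ω lam g) {x : ℝ} (hx : x ≠ 0) :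
    wronskianAt f g x = wronskian f g := by
  have hd : ∀ y ≠ 0, HasDerivAt (wronskianAt f g) 0 y := fun y hy =>
    hf.hasDerivAt_wronskianAt hg hy
  have hpos : ∀ y > 0, wronskianAt f g y = wronskianAt f g 1 := fun y hy =>
    isOpen_Ioi.is_const_of_deriv_eq_zero isPreconnected_Ioi
      (fun z hz => (hd z (ne_of_gt hz)).differentiableAt.differentiableWithinAt)
      (fun z hz => (hd z (ne_of_gt hz)).deriv) hy (by simp : (1 : ℝ) ∈ Set.Ioi 0)
  have hneg : ∀ y < 0, wronskianAt f g y = wronskianAt f g (-1) := fun y hy =>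
    isOpen_Iio.is_const_of_deriv_eq_zero isPreconnected_Iio
      (fun z hz => (hd z (ne_of_lt hz)).differentiableAt.differentiableWithinAt)
      (fun z hz => (hd z (ne_of_lt hz)).deriv) hy (by simp : (-1 : ℝ) ∈ Set.Iio 0)
  obtain ⟨a, b, fa, fb, fab⟩ := hf.jump
  obtain ⟨c, d, gc, gd, gcd⟩ := hg.jump
  have lim : ∀ (l : Filter ℝ) (u v : Fin 2 → ℂ), l ≤ 𝓝 0 → Tendsto (deriv f) l (𝓝 u) →
      Tendsto (deriv g) l (𝓝 v) →
      Tendsto (wronskianAt f g) l (𝓝 (u ⬝ᵥ g 0 - f 0 ⬝ᵥ v)) := by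
    intro l u v hl hu hv
    have hfl : Tendsto f l (𝓝 (f 0)) := hf.continuous.continuousAt.mono_left hl
    have hgl : Tendsto g l (𝓝 (g 0)) := hg.continuous.continuousAt.mono_left hl
    have hd2 : ∀ {v w : ℝ → Fin 2 → ℂ} {v0 w0 : Fin 2 → ℂ}, Tendsto v l (𝓝 v0) →
        Tendsto w l (𝓝 w0) → Tendsto (fun y => v y ⬝ᵥ w y) l (𝓝 (v0 ⬝ᵥ w0)) := by
      intro v w v0 w0 hv hw
      simp only [dotProduct]
      exact tendsto_finsetSum _ fun i _ => (tendsto_pi_nhds.1 hv i).mul (tendsto_pi_nhds.1 hw i)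
    exact (hd2 hu hgl).sub (hd2 hfl hv)
  have l1 := lim (𝓝[>] 0) a c nhdsWithin_le_nhds fa gc
  have l2 := lim (𝓝[<] 0) b d nhdsWithin_le_nhds fb gd
  have e1 : wronskianAt f g 1 = a ⬝ᵥ g 0 - f 0 ⬝ᵥ c :=
    tendsto_nhds_unique (tendsto_const_nhds.congr' (by
      filter_upwards [self_mem_nhdsWithin] with y hy using (hpos y hy).symm)) l1
  have e2 : wronskianAt f g (-1) = b ⬝ᵥ g 0 - f 0 ⬝ᵥ d :=
    tendsto_nhds_unique (tendsto_const_nhds.congr' (by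
      filter_upwards [self_mem_nhdsWithin] with y hy using (hneg y hy).symm)) l2
  have ha : a = b + (2 * q : ℂ) • f 0 := by rw [← fab]; abel
  have hc : c = d + (2 * q : ℂ) • g 0 := by rw [← gcd]; abel
  have e3 : wronskianAt f g (-1) = wronskianAt f g 1 := by
    rw [e1, e2, ha, hc]
    simp only [add_dotProduct, dotProduct_add, smul_dotProduct, dotProduct_smul]
    ring
  rcases lt_or_gt_of_ne hx with h | h
  · rw [hneg x h, e3, wronskian]
  · rw [hpos x h, wronskian]

theorem soliton_neg (σ p q ω x : ℝ) : soliton σ p q ω (-x) = soliton σ p q ω x := by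
  simp [soliton]

theorem IsSolution.reflect {σ p q ω lam : ℝ} {f : ℝ → Fin 2 → ℂ}
    (hf : IsSolution σ p q ω lam f) : IsSolution σ p q ω lam fun x => f (-x) := by
  have h1 : deriv (fun x => f (-x)) = fun x => -deriv f (-x) := by
    funext x
    exact deriv_comp_neg f x
  have h2 : deriv (fun x => -deriv f (-x)) = fun x => deriv (deriv f) (-x) := by
    funext x
    rw [deriv.fun_neg, deriv_comp_neg (deriv f) x, neg_neg]
  have hneg : ∀ x : ℝ, HasDerivAt (fun y : ℝ => -y) (-1) x := fun x => hasDerivAt_neg x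
  refine ⟨hf.continuous.comp continuous_neg, fun x hx => ?_, fun x hx => ?_, fun x hx => ?_, ?_⟩
  · exact (hf.differentiableAt (-x) (neg_ne_zero.2 hx)).comp x (hneg x).differentiableAt
  · rw [h1]
    exact ((hf.differentiableAt_deriv (-x) (neg_ne_zero.2 hx)).comp x
      (hneg x).differentiableAt).neg
  · rw [h1, h2]
    have h := hf.equation (-x) (neg_ne_zero.2 hx)
    simpa only [hamiltonian, potential, soliton_neg] using h
  · obtain ⟨a, b, fa, fb, fab⟩ := hf.jump
    refine ⟨-b, -a, ?_, ?_, ?_⟩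
    · rw [h1]
      refine (fb.comp ?_).neg
      have := tendsto_neg_nhdsGT (a := (0 : ℝ))
      rwa [neg_zero] at this
    · rw [h1]
      refine (fa.comp ?_).neg
      have := tendsto_neg_nhdsLT (a := (0 : ℝ))
      rwa [neg_zero] at this
    · simp only [neg_zero]
      rw [← fab]
      abel

theorem matrixWronskianAt_columns {a b c d : ℝ → Fin 2 → ℂ} {x : ℝ}
    (ha : DifferentiableAt ℝ a x) (hb : DifferentiableAt ℝ b x)
    (hc : DifferentiableAt ℝ c x) (hd : DifferentiableAt ℝ d x) :
    matrixWronskianAt (fun y => (Matrix.of ![a y, b y])ᵀ) (fun y => (Matrix.of ![c y, d y])ᵀ) x =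
      !![wronskianAt a c x, wronskianAt a d x; wronskianAt b c x, wronskianAt b d x] := by
  have a' := fun i => (hasDerivAt_pi.1 ha.hasDerivAt i).deriv
  have b' := fun i => (hasDerivAt_pi.1 hb.hasDerivAt i).deriv
  have c' := fun i => (hasDerivAt_pi.1 hc.hasDerivAt i).deriv
  have d' := fun i => (hasDerivAt_pi.1 hd.hasDerivAt i).deriv
  ext i j
  fin_cases i <;> fin_cases j <;>
    simp [matrixWronskianAt, matrixDeriv, wronskianAt, Matrix.vecMul, Matrix.mul_apply, dotProduct,
      Fin.sum_univ_two, a', b', c', d']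

theorem JostSolutions.matrixWronskianAt_eq {σ p q ω ξ : ℝ} (J : JostSolutions σ p q ω ξ) {x : ℝ}
    (hx : x ≠ 0) : matrixWronskianAt J.F₁ J.G₂ x = J.D := by
  have h1 := J.sol₁
  have h3 := J.sol₃
  have k1 : IsSolution σ p q ω (ξ ^ 2 / 2 + ω) J.g₁ := h1.reflect
  have k3 : IsSolution σ p q ω (ξ ^ 2 / 2 + ω) J.g₃ := h3.reflect
  have key : ∀ y ≠ 0, matrixWronskianAt J.F₁ J.G₂ y =
      !![wronskian J.f₁ J.g₁, wronskian J.f₁ J.g₃; wronskian J.f₃ J.g₁, wronskian J.f₃ J.g₃] := by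
    intro y hy
    rw [← h1.wronskianAt_eq k1 hy, ← h1.wronskianAt_eq k3 hy, ← h3.wronskianAt_eq k1 hy,
      ← h3.wronskianAt_eq k3 hy]
    exact matrixWronskianAt_columns (h1.differentiableAt y hy) (h3.differentiableAt y hy)
      (k1.differentiableAt y hy) (k3.differentiableAt y hy)
  rw [key x hx, D, key 1 one_ne_zero]

end

end DeltaNLS

/-! Solving `ℋ f = lam f` for `f''` gives `f'' = M f` with `M` real and symmetric, because the sign
in the second row of `ℋ` cancels. Hence `W` is constant along solutions, also across the delta, and
the complex conjugate of a solution is a solution. The solutions form a four-dimensional symplectic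
space under `W`, identified with Cauchy data at `x = 1`.

Since `f₃` decays, `W[f₁, f₃] = 0`. So `f₁, f₃` span a Lagrangian plane, and a solution orthogonal
to both lies in their span (`JostSolutions.exists_eq_add_smul`). The same holds for `g₁, g₃`. As `D`
is the matrix of the pairing of these two planes, `det D = 0` means precisely that they share a
nonzero solution `u`.

If `ξ ≠ 0`, such a `u` behaves like `a e^{iξx}` at `+∞` and like `c e^{-iξx}` at `-∞` in its first
component. The constant flux `W[u, ū]` equals `2iξ|a|²` at one end and `-2iξ|c|²` at the other, so
`a = c = 0`. Then `u` decays exponentially and is an eigenfunction. If `ξ = 0` there is no flux; `u`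
is bounded, an energy estimate gives `u' ∈ L²`, and `u` is an eigenfunction or a resonance function
according to whether it lies in `L²`.

Conversely, for an eigenfunction or a resonance function the Wronskians with `f₁, f₃, g₁, g₃` become
small along a sequence of points, so they vanish, and `u` lies in both planes. The relation with `A`
is linear algebra: `f₄` is corrected so that pairing `F₁ = G₁ A + G₂ B` with `g₁, g₃` isolates the
rows of `A`, whence `det D = -4iξμ det A` (`JostSolutions.det_D_eq`).

The Jost solutions themselves come from asymptotic integration
(`exists_solution_asymptotic_to_orbit`): the potential decays exponentially, so the first-order
system is an integrable perturbation of an explicit constant-coefficient flow. The hypotheses there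
allow linear growth, which covers the threshold `ξ = 0` together with all other `ξ`. -/

namespace DeltaNLS

noncomputable section

/-! ### Global existence and uniqueness for bounded linear systems. -/

section LinearODE

variable {E : Type*} [NormedAddCommGroup E] [NormedSpace ℝ E]

theorem norm_integral_exp_smul_le {L C : ℝ} (hL : 0 < L) (hC : 0 ≤ C) {h : ℝ → E}
    (hb : ∀ t, ‖h t‖ ≤ C) (x : ℝ) :
    ‖∫ t in (0 : ℝ)..x, Real.exp (L * |t|) • h t‖ ≤ C / L * Real.exp (L * |x|) := by
  have key : ∀ (g : ℝ → E), (∀ t, ‖g t‖ ≤ C) → ∀ y, 0 ≤ y →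
      ‖∫ t in (0 : ℝ)..y, Real.exp (L * |t|) • g t‖ ≤ C / L * Real.exp (L * |y|) := by
    intro g hg y hy
    have h1 : ‖∫ t in (0 : ℝ)..y, Real.exp (L * |t|) • g t‖ ≤
        ∫ t in (0 : ℝ)..y, C * Real.exp (L * t) := by
      refine intervalIntegral.norm_integral_le_of_norm_le hy ?_ ?_
      · refine Eventually.of_forall fun t ht => ?_
        rw [norm_smul, Real.norm_eq_abs, Real.abs_exp, abs_of_pos ht.1, mul_comm]
        gcongr
        exact hg t
      · exact (by fun_prop : Continuous fun t => C * Real.exp (L * t)).intervalIntegrable _ _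
    have h2 : ∫ t in (0 : ℝ)..y, C * Real.exp (L * t) =
        C / L * Real.exp (L * y) - C / L * Real.exp (L * 0) := by
      refine intervalIntegral.integral_eq_sub_of_hasDerivAt (f := fun t => C / L * Real.exp (L * t))
        (fun t _ => ?_)
        ((by fun_prop : Continuous fun t => C * Real.exp (L * t)).intervalIntegrable _ _)
      have := (((hasDerivAt_id t).const_mul L).exp).const_mul (C / L)
      convert! this using 1
      simp; field_simp
    rw [h2] at h1
    rw [abs_of_nonneg hy]
    have : 0 ≤ C / L * Real.exp (L * 0) := by positivity
    linarith
  rcases le_total 0 x with hx | hx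
  · exact key h hb x hx
  · have h1 := key (fun t => h (-t)) (fun t => hb _) (-x) (by linarith)
    have h2 := intervalIntegral.integral_comp_neg (a := 0) (b := -x)
      (fun t => Real.exp (L * |t|) • h t)
    simp only [abs_neg, neg_neg, neg_zero] at h1 h2
    rwa [h2, intervalIntegral.integral_symm, norm_neg] at h1

/-- Picard iteration on the whole line at once: solutions grow at most like `e^{K|x|}`, so the
unknown is `z = e^{-L|x|} y` with `L > K`, which is bounded. The weight makes the integral operator
a contraction without any restriction to short intervals. -/
theorem exists_linear_ivp_zero [CompleteSpace E] {A : ℝ → E →L[ℝ] E} (hA : Continuous A) {K : ℝ}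
    (hK : ∀ x, ‖A x‖ ≤ K) (y₀ : E) :
    ∃ y : ℝ → E, y 0 = y₀ ∧ ∀ x, HasDerivAt y (A x (y x)) x := by
  have hK0 : 0 ≤ K := (norm_nonneg _).trans (hK 0)
  -- The contraction constant will be `K / L`, so this choice keeps it at most `1 / 2`; the summand
  -- `1` covers `K = 0`.
  set L : ℝ := 2 * K + 1 with hLdef
  have hL : 0 < L := by positivity
  let S : BoundedContinuousFunction ℝ E → ℝ → E := fun z x =>
    y₀ + ∫ t in (0 : ℝ)..x, Real.exp (L * |t|) • A t (z t)
  have hcont : ∀ z : BoundedContinuousFunction ℝ E,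
      Continuous fun t => Real.exp (L * |t|) • A t (z t) := fun z =>
    (by fun_prop : Continuous fun t : ℝ => Real.exp (L * |t|)).smul (hA.clm_apply z.continuous)
  have hS : ∀ z x, HasDerivAt (S z) (Real.exp (L * |x|) • A x (z x)) x := fun z x =>
    (intervalIntegral.integral_hasDerivAt_right ((hcont z).intervalIntegrable _ _)
      ((hcont z).stronglyMeasurableAtFilter _ _) (hcont z).continuousAt).const_add y₀
  have hScont : ∀ z, Continuous (S z) := fun z =>
    continuous_iff_continuousAt.2 fun x => (hS z x).continuousAt
  have hexp : ∀ x : ℝ, 0 < Real.exp (-(L * |x|)) := fun x => Real.exp_pos _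
  have hexp1 : ∀ x : ℝ, Real.exp (-(L * |x|)) ≤ 1 := fun x =>
    Real.exp_le_one_iff.2 (by have := abs_nonneg x; nlinarith)
  let T : BoundedContinuousFunction ℝ E → BoundedContinuousFunction ℝ E := fun z =>
    BoundedContinuousFunction.ofNormedAddCommGroup (fun x => Real.exp (-(L * |x|)) • S z x)
      ((by fun_prop : Continuous fun x : ℝ => Real.exp (-(L * |x|))).smul (hScont z))
      (‖y₀‖ + K * ‖z‖ / L) (fun x => by
        have h1 := norm_integral_exp_smul_le hL (by positivity : 0 ≤ K * ‖z‖)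
          (h := fun t => A t (z t)) (fun t => ((A t).le_opNorm _).trans
            (mul_le_mul (hK t) (z.norm_coe_le_norm t) (norm_nonneg _) hK0)) x
        rw [norm_smul, Real.norm_of_nonneg (hexp x).le]
        calc _ ≤ Real.exp (-(L * |x|)) * (‖y₀‖ + K * ‖z‖ / L * Real.exp (L * |x|)) :=
              mul_le_mul_of_nonneg_left ((norm_add_le _ _).trans (by gcongr)) (hexp x).le
          _ = Real.exp (-(L * |x|)) * ‖y₀‖ +
              K * ‖z‖ / L * (Real.exp (-(L * |x|)) * Real.exp (L * |x|)) := by ring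
          _ ≤ _ := by
              rw [← Real.exp_add, neg_add_cancel, Real.exp_zero, mul_one]
              gcongr
              exact mul_le_of_le_one_left (norm_nonneg _) (hexp1 x))
  have hT : ContractingWith (1 / 2) T := by
    refine ⟨by norm_num, LipschitzWith.of_dist_le_mul fun z w => ?_⟩
    rw [BoundedContinuousFunction.dist_le (by positivity)]
    intro x
    have h1 := norm_integral_exp_smul_le hL (by positivity : 0 ≤ K * dist z w)
          (h := fun t => A t (z t - w t)) (fun t => ((A t).le_opNorm _).trans
            (mul_le_mul (hK t)
              (by rw [← dist_eq_norm]; exact BoundedContinuousFunction.dist_coe_le_dist t)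
              (norm_nonneg _) hK0)) x
    have h2 : T z x - T w x = Real.exp (-(L * |x|)) •
        ∫ t in (0 : ℝ)..x, Real.exp (L * |t|) • A t (z t - w t) := by
      change Real.exp (-(L * |x|)) • S z x - Real.exp (-(L * |x|)) • S w x = _
      rw [← smul_sub]
      congr 1
      simp only [S, add_sub_add_left_eq_sub, map_sub, smul_sub]
      rw [intervalIntegral.integral_sub ((hcont z).intervalIntegrable _ _)
        ((hcont w).intervalIntegrable _ _)]
    rw [dist_eq_norm, h2, norm_smul, Real.norm_of_nonneg (hexp x).le]
    calc _ ≤ Real.exp (-(L * |x|)) * (K * dist z w / L * Real.exp (L * |x|)) := by gcongr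
      _ = K * dist z w / L * (Real.exp (-(L * |x|)) * Real.exp (L * |x|)) := by ring
      _ = K / L * dist z w := by
          rw [← Real.exp_add, neg_add_cancel, Real.exp_zero, mul_one]; ring
      _ ≤ _ := by
          refine mul_le_mul_of_nonneg_right ?_ dist_nonneg
          rw [div_le_iff₀ hL]
          push_cast
          linarith
  obtain ⟨z, hz⟩ : ∃ z, T z = z := ⟨_, hT.fixedPoint_isFixedPt⟩
  have hzx : ∀ x, Real.exp (L * |x|) • z x = S z x := fun x => by
    have : z x = Real.exp (-(L * |x|)) • S z x := (DFunLike.congr_fun hz x).symm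
    rw [this, smul_smul, ← Real.exp_add, add_neg_cancel, Real.exp_zero, one_smul]
  refine ⟨S z, by simp [S], fun x => ?_⟩
  have := hS z x
  rwa [← map_smul, hzx] at this

theorem exists_linear_ivp [CompleteSpace E] {A : ℝ → E →L[ℝ] E} (hA : Continuous A) {K : ℝ}
    (hK : ∀ x, ‖A x‖ ≤ K) (x₀ : ℝ) (y₀ : E) :
    ∃ y : ℝ → E, y x₀ = y₀ ∧ ∀ x, HasDerivAt y (A x (y x)) x := by
  obtain ⟨y, h0, hy⟩ := exists_linear_ivp_zero (A := fun x => A (x + x₀)) (by fun_prop)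
    (fun x => hK _) y₀
  refine ⟨fun x => y (x - x₀), by simpa using h0, fun x => ?_⟩
  have := (hy (x - x₀)).comp_sub_const x x₀
  simpa using this

theorem linear_ode_unique_right {A : ℝ → E →L[ℝ] E} {K : ℝ} (hK : ∀ x, ‖A x‖ ≤ K) {x₀ : ℝ}
    {y z : ℝ → E} (hy : ∀ x, x₀ ≤ x → HasDerivAt y (A x (y x)) x)
    (hz : ∀ x, x₀ ≤ x → HasDerivAt z (A x (z x)) x) (h0 : y x₀ = z x₀) :
    ∀ x, x₀ ≤ x → y x = z x := by
  intro x hx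
  have hd : ∀ x, x₀ ≤ x → HasDerivAt (fun t => y t - z t) (A x (y x - z x)) x := fun t ht => by
    rw [map_sub]
    exact (hy t ht).sub (hz t ht)
  have := eq_zero_of_abs_deriv_le_mul_abs_self_of_eq_zero_right (K := K) (a := x₀) (b := x)
    (f := fun t => y t - z t) (f' := fun t => A t (y t - z t))
    (fun t ht => (hd t ht.1).continuousAt.continuousWithinAt)
    (fun t ht => (hd t ht.1).hasDerivWithinAt) (sub_eq_zero.2 h0)
    (fun t _ => ((A t).le_opNorm _).trans (by gcongr; exact hK t)) x ⟨hx, le_rfl⟩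
  exact sub_eq_zero.1 this

end LinearODE

/-! ### Asymptotic integration of integrably perturbed flows. -/

section Asymptotic

variable {E : Type*} [NormedAddCommGroup E] [NormedSpace ℝ E]

theorem exists_integral_Ioi_le_half {h : ℝ → ℝ} (h_int : IntegrableOn h (Set.Ioi 0)) :
    ∃ x₀, 0 ≤ x₀ ∧ ∫ y in Set.Ioi x₀, h y ≤ 1 / 2 := by
  have h1 := intervalIntegral_tendsto_integral_Ioi 0 h_int tendsto_id
  have h2 : ∀ᶠ x in atTop, (∫ y in Set.Ioi 0, h y) - 1 / 2 < ∫ y in (0 : ℝ)..x, h y :=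
    h1.eventually (lt_mem_nhds (by linarith))
  obtain ⟨x₀, hx, hx0⟩ := (h2.and (eventually_ge_atTop 0)).exists
  refine ⟨x₀, hx0, ?_⟩
  have := intervalIntegral.integral_Ioi_sub_Ioi h_int hx0
  linarith

/-- **Asymptotic integration.** Let `U` be a one-parameter group with generator `N`, split by `P` into
a part that is bounded and decays forward in time and a part that grows at most linearly backward in
time. Then an integrable perturbation `R` of `N` has a solution asymptotic to each bounded
orbit of `U`. -/
theorem exists_solution_asymptotic_to_orbit [CompleteSpace E] {U : ℝ → E →L[ℝ] E}
    {N P : E →L[ℝ] E} {R : ℝ → E →L[ℝ] E} {B C : ℝ} {ρ : ℝ → ℝ} {v : E}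
    (hU : ∀ t, HasDerivAt U (N * U t) t) (hU0 : U 0 = 1) (hadd : ∀ s t, U (s + t) = U s * U t)
    (hR : Continuous R) (hρ : ∀ x, 0 ≤ x → ‖R x‖ ≤ ρ x)
    (h_int : IntegrableOn (fun x => (1 + x) * ρ x) (Set.Ioi 0))
    (hminus : ∀ t, 0 ≤ t → ‖U t * P‖ ≤ C) (hlim : Tendsto (fun t => U t * P) atTop (𝓝 0))
    (hplus : ∀ t, 0 ≤ t → ‖U (-t) * (1 - P)‖ ≤ C * (1 + t)) (hv : ∀ x, 0 ≤ x → ‖U x v‖ ≤ B) :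
    ∃ x₀, 0 ≤ x₀ ∧ ∃ y : ℝ → E, (∀ x, x₀ < x → HasDerivAt y (N (y x) + R x (y x)) x) ∧
      Tendsto (fun x => y x - U x v) atTop (𝓝 0) := by
  have hC : 0 ≤ C := (norm_nonneg _).trans (hminus 0 le_rfl)
  -- `h` will dominate the Green kernel uniformly in `x`. Starting at an `x₀` beyond which its
  -- integral is at most `1 / 2` yields the contraction.
  set h : ℝ → ℝ := fun y => C * ((1 + y) * ρ y) with hh
  have h_int' : IntegrableOn h (Set.Ioi 0) := h_int.const_mul C
  obtain ⟨x₀, hx₀, hhalf⟩ := exists_integral_Ioi_le_half h_int'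
  have hsub : Set.Ioi x₀ ⊆ Set.Ioi 0 := Set.Ioi_subset_Ioi hx₀
  have hinth : IntegrableOn h (Set.Ioi x₀) := h_int'.mono_set hsub
  have hUc : Continuous U := continuous_iff_continuousAt.2 fun t => (hU t).continuousAt
  have hUx : ∀ x y, U x * U (-y) = U (x - y) := fun x y => by rw [sub_eq_add_neg, hadd]
  -- Green kernel of the dichotomy: the `P` part is integrated forward from `x₀`, the complementary
  -- part backward from infinity, so that neither meets its growing direction.
  let G : ℝ → ℝ → E →L[ℝ] E := fun x y =>
    if y ≤ x then U (x - y) * P * R y else -(U (x - y) * (1 - P) * R y)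
  have hGb : ∀ x y, x₀ ≤ x → x₀ < y → ‖G x y‖ ≤ h y := by
    intro x y hx hy
    have hy0 : 0 ≤ y := (hx₀.trans_lt hy).le
    have hρ0 : 0 ≤ ρ y := (norm_nonneg _).trans (hρ y hy0)
    simp only [G]
    split_ifs with hyx
    · calc _ ≤ ‖U (x - y) * P‖ * ‖R y‖ := norm_mul_le _ _
        _ ≤ C * ρ y := mul_le_mul (hminus _ (by linarith)) (hρ y hy0) (norm_nonneg _) hC
        _ ≤ C * ((1 + y) * ρ y) := by gcongr; nlinarith
    · rw [norm_neg]
      have e : x - y = -(y - x) := by ring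
      calc _ ≤ ‖U (x - y) * (1 - P)‖ * ‖R y‖ := norm_mul_le _ _
        _ ≤ C * (1 + (y - x)) * ρ y := by
            rw [e]
            have : 0 ≤ y - x := by linarith
            exact mul_le_mul (hplus _ this) (hρ y hy0) (norm_nonneg _) (by positivity)
        _ ≤ C * ((1 + y) * ρ y) := by
            rw [mul_assoc]; gcongr; linarith
  have hc1 : ∀ (x : ℝ) (z : BoundedContinuousFunction ℝ E),
      Continuous fun y => (U (x - y) * P * R y) (z y) := fun x z =>
    (((hUc.comp (continuous_const.sub continuous_id)).mul continuous_const).mul hR).clm_apply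
      z.continuous
  have hc2 : ∀ (x : ℝ) (z : BoundedContinuousFunction ℝ E),
      Continuous fun y => (U (x - y) * (1 - P) * R y) (z y) := fun x z =>
    (((hUc.comp (continuous_const.sub continuous_id)).mul continuous_const).mul hR).clm_apply
      z.continuous
  have hGm : ∀ x (z : BoundedContinuousFunction ℝ E),
      StronglyMeasurable fun y => G x y (z y) := by
    intro x z
    have : (fun y => G x y (z y)) = fun y => if y ≤ x then (U (x - y) * P * R y) (z y)
        else -(U (x - y) * (1 - P) * R y) (z y) := by
      funext y
      simp only [G]
      split_ifs <;> simp
    rw [this]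
    exact StronglyMeasurable.ite measurableSet_Iic (hc1 x z).stronglyMeasurable
      (hc2 x z).neg.stronglyMeasurable
  have hGz : ∀ x y (z : BoundedContinuousFunction ℝ E), x₀ ≤ x → x₀ < y →
      ‖G x y (z y)‖ ≤ h y * ‖z‖ := fun x y z hx hy =>
    ((G x y).le_opNorm _).trans (mul_le_mul (hGb x y hx hy) (z.norm_coe_le_norm y)
      (norm_nonneg _) ((norm_nonneg _).trans (hGb x y hx hy)))
  have hGi : ∀ x (z : BoundedContinuousFunction ℝ E), x₀ ≤ x →
      IntegrableOn (fun y => G x y (z y)) (Set.Ioi x₀) := fun x z hx =>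
    Integrable.mono' (hinth.mul_const ‖z‖) (hGm x z).aestronglyMeasurable
      ((ae_restrict_iff' measurableSet_Ioi).2 (Eventually.of_forall fun y hy => hGz x y z hx hy))
  -- The same integral operator in variation-of-constants form, which is differentiable at every
  -- `x`. The integral over `(x₀, ∞)` shifts the initial value so that the two forms agree for `x ≥
  -- x₀`.
  let Y : BoundedContinuousFunction ℝ E → ℝ → E := fun z x =>
    U x (v - (∫ y in Set.Ioi x₀, (U (0 - y) * (1 - P) * R y) (z y)) +
      ∫ y in x₀..x, (U (0 - y) * R y) (z y))
  have hc3 : ∀ (z : BoundedContinuousFunction ℝ E),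
      Continuous fun y => (U (0 - y) * R y) (z y) := fun z =>
    ((hUc.comp (continuous_const.sub continuous_id)).mul hR).clm_apply z.continuous
  have hY : ∀ z x, HasDerivAt (Y z) (N (Y z x) + R x (z x)) x := by
    intro z x
    have h1 := (intervalIntegral.integral_hasDerivAt_right ((hc3 z).intervalIntegrable x₀ x)
      ((hc3 z).stronglyMeasurableAtFilter _ _) (hc3 z).continuousAt).const_add
      (v - (∫ y in Set.Ioi x₀, (U (0 - y) * (1 - P) * R y) (z y)))
    have h2 := (hU x).clm_apply h1
    refine h2.congr_deriv ?_
    have h3 : U x * (U (0 - x) * R x) = R x := by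
      rw [← mul_assoc, zero_sub, hUx, sub_self, hU0, one_mul]
    have h4 := congrArg (fun M : E →L[ℝ] E => M (z x)) h3
    simp only [mul_apply_eq_comp] at h4 ⊢
    rw [h4]
    rfl
  have hYc : ∀ z, Continuous (Y z) := fun z =>
    continuous_iff_continuousAt.2 fun x => (hY z x).continuousAt
  have hP2 : ∀ z : BoundedContinuousFunction ℝ E,
      IntegrableOn (fun y => (U (0 - y) * (1 - P) * R y) (z y)) (Set.Ioi x₀) := by
    intro z
    refine Integrable.mono' (hinth.mul_const ‖z‖) (hc2 0 z).aestronglyMeasurable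
      ((ae_restrict_iff' measurableSet_Ioi).2 (Eventually.of_forall fun y hy => ?_))
    have hy0 : 0 ≤ y := hx₀.trans (le_of_lt hy)
    have hρ0 : 0 ≤ ρ y := (norm_nonneg _).trans (hρ y hy0)
    refine ((ContinuousLinearMap.le_opNorm _ _).trans (mul_le_mul ?_ (z.norm_coe_le_norm y)
      (norm_nonneg _) (by positivity)))
    calc _ ≤ ‖U (0 - y) * (1 - P)‖ * ‖R y‖ := norm_mul_le _ _
      _ ≤ C * (1 + y) * ρ y := by
          rw [zero_sub]
          exact mul_le_mul (hplus _ hy0) (hρ y hy0) (norm_nonneg _) (by positivity)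
      _ = h y := by rw [mul_assoc]
  have hrep : ∀ z x, x₀ ≤ x → Y z x = U x v + ∫ y in Set.Ioi x₀, G x y (z y) := by
    intro z x hx
    have e1 : ∫ y in Set.Ioi x₀, (U (0 - y) * (1 - P) * R y) (z y) =
        (∫ y in x₀..x, (U (0 - y) * (1 - P) * R y) (z y)) +
          ∫ y in Set.Ioi x, (U (0 - y) * (1 - P) * R y) (z y) := by
      rw [← intervalIntegral.integral_Ioi_sub_Ioi (hP2 z) hx, sub_add_cancel]
    have e2 : (∫ y in x₀..x, (U (0 - y) * R y) (z y)) =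
        (∫ y in x₀..x, (U (0 - y) * P * R y) (z y)) +
          ∫ y in x₀..x, (U (0 - y) * (1 - P) * R y) (z y) := by
      rw [← intervalIntegral.integral_add ((hc1 0 z).intervalIntegrable _ _)
        ((hc2 0 z).intervalIntegrable _ _)]
      congr 1
      funext y
      rw [← _root_.add_apply, ← add_mul, ← mul_add, add_sub_cancel, mul_one]
    have e3 : ∫ y in Set.Ioi x₀, G x y (z y) =
        (∫ y in x₀..x, G x y (z y)) + ∫ y in Set.Ioi x, G x y (z y) := by
      rw [← intervalIntegral.integral_Ioi_sub_Ioi (hGi x z hx) hx, sub_add_cancel]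
    have e4 : ∫ y in x₀..x, G x y (z y) = U x (∫ y in x₀..x, (U (0 - y) * P * R y) (z y)) := by
      rw [← ContinuousLinearMap.intervalIntegral_comp_comm _ ((hc1 0 z).intervalIntegrable _ _)]
      refine intervalIntegral.integral_congr fun y hy => ?_
      rw [Set.uIcc_of_le hx] at hy
      simp only [G, if_pos hy.2]
      rw [← mul_apply_eq_comp (U x), ← mul_assoc, ← mul_assoc, zero_sub, hUx]
    have e5 : ∫ y in Set.Ioi x, G x y (z y) =
        -U x (∫ y in Set.Ioi x, (U (0 - y) * (1 - P) * R y) (z y)) := by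
      rw [← ContinuousLinearMap.integral_comp_comm _ ((hP2 z).mono_set (Set.Ioi_subset_Ioi hx)),
        ← integral_neg]
      refine setIntegral_congr_fun measurableSet_Ioi fun y hy => ?_
      simp only [G, if_neg (not_le.2 (show x < y from hy))]
      rw [← mul_apply_eq_comp (U x), ← mul_assoc, ← mul_assoc, zero_sub, hUx]
      rfl
    rw [e3, e4, e5]
    simp only [Y]
    rw [e1, e2, ← map_neg, ← map_add, ← map_add]
    congr 1
    abel
  have hbound : ∀ x (z : BoundedContinuousFunction ℝ E), x₀ ≤ x →
      ‖∫ y in Set.Ioi x₀, G x y (z y)‖ ≤ 1 / 2 * ‖z‖ := by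
    intro x z hx
    calc _ ≤ ∫ y in Set.Ioi x₀, h y * ‖z‖ :=
          norm_integral_le_of_norm_le (hinth.mul_const ‖z‖)
            ((ae_restrict_iff' measurableSet_Ioi).2
              (Eventually.of_forall fun y hy => hGz x y z hx hy))
      _ = (∫ y in Set.Ioi x₀, h y) * ‖z‖ := integral_mul_const _ _
      _ ≤ _ := by gcongr
  -- Freezing the value to the left of `x₀` makes this a self-map of the bounded continuous
  -- functions on the whole line.
  let T : BoundedContinuousFunction ℝ E → BoundedContinuousFunction ℝ E := fun z =>
    BoundedContinuousFunction.ofNormedAddCommGroup (fun x => Y z (max x x₀))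
      ((hYc z).comp (continuous_id.max continuous_const)) (B + 1 / 2 * ‖z‖) (fun x => by
        rw [hrep z _ (le_max_right _ _)]
        exact (norm_add_le _ _).trans (add_le_add (hv _ (hx₀.trans (le_max_right _ _)))
          (hbound _ z (le_max_right _ _))))
  have hT : ContractingWith (1 / 2) T := by
    refine ⟨by norm_num, LipschitzWith.of_dist_le_mul fun z w => ?_⟩
    rw [BoundedContinuousFunction.dist_le (by positivity)]
    intro x
    have hm : x₀ ≤ max x x₀ := le_max_right _ _
    have h2 : T z x - T w x = ∫ y in Set.Ioi x₀, G (max x x₀) y ((z - w) y) := by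
      change Y z (max x x₀) - Y w (max x x₀) = _
      rw [hrep z _ hm, hrep w _ hm, add_sub_add_left_eq_sub,
        ← integral_sub (hGi _ z hm) (hGi _ w hm)]
      simp
    rw [dist_eq_norm, h2, dist_eq_norm]
    simpa using hbound _ (z - w) hm
  obtain ⟨z, hz⟩ : ∃ z, T z = z := ⟨_, hT.fixedPoint_isFixedPt⟩
  have hzx : ∀ x, x₀ ≤ x → z x = Y z x := fun x hx => by
    have : z x = Y z (max x x₀) := (DFunLike.congr_fun hz x).symm
    rwa [max_eq_left hx] at this
  refine ⟨x₀, hx₀, Y z, fun x hx => ?_, ?_⟩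
  · have := hY z x
    rwa [hzx x hx.le] at this
  -- Dominated convergence: for fixed `y`, eventually `y ≤ x`, and then only the decaying factor `U
  -- (x - y) * P` is present.
  · have hlim0 : Tendsto (fun x => ∫ y in Set.Ioi x₀, G x y (z y)) atTop
        (𝓝 (∫ y in Set.Ioi x₀, (0 : E))) := by
      refine tendsto_integral_filter_of_dominated_convergence (fun y => h y * ‖z‖)
        (Eventually.of_forall fun x => (hGm x z).aestronglyMeasurable)
        ?_ (hinth.mul_const ‖z‖) (Eventually.of_forall fun y => ?_)
      · filter_upwards [eventually_ge_atTop x₀] with x hx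
        exact (ae_restrict_iff' measurableSet_Ioi).2
          (Eventually.of_forall fun y hy => hGz x y z hx hy)
      · have h1 : Tendsto (fun x => U (x - y) * P) atTop (𝓝 0) :=
          hlim.comp (tendsto_atTop_add_const_right _ (-y) tendsto_id)
        have h2 : Tendsto (fun x => (U (x - y) * P * R y) (z y)) atTop
            (𝓝 ((0 * R y : E →L[ℝ] E) (z y))) :=
          ((ContinuousLinearMap.apply ℝ E (z y)).continuous.tendsto _).comp (h1.mul_const (R y))
        simp only [zero_mul, _root_.zero_apply] at h2
        refine h2.congr' ?_
        filter_upwards [eventually_ge_atTop y] with x hx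
        simp only [G, if_pos hx]
    rw [integral_zero] at hlim0
    refine hlim0.congr' ?_
    filter_upwards [eventually_ge_atTop x₀] with x hx
    rw [hrep z x hx, add_sub_cancel_left]

end Asymptotic

/-! ### Continuity and exponential decay of the potential. -/

/-- The scalar factor `σ Q_ω^p` of the matrix potential. -/
def scalarPotential (σ p q ω x : ℝ) : ℝ := σ * soliton σ p q ω x ^ p

/-- Treats both signs at once. For `sinh` the shift `b` is positive because `√(2ω) < |q|`, so the
singularity is avoided and `sinh (t + b) ≥ sinh b · e^t`; for `cosh` one has `cosh (t + b) ≥ e^t /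
2`. After this only `S` matters, and `Q^p` is a multiple of `S^{-2}`. -/
theorem exists_soliton_eq_rpow {σ p q ω : ℝ} (hq : q < 0) (hp : 4 < p)
    (hω : AdmissibleFrequency σ q ω) :
    0 < ω ∧ ∃ (c m k : ℝ) (S : ℝ → ℝ), 0 < c ∧ 0 < m ∧ 0 < k ∧ Continuous S ∧
      (∀ x, m * Real.exp (k * |x|) ≤ S x) ∧
      ∀ x, soliton σ p q ω x = c * S x ^ (-(2 / p)) := by
  have hω0 : 0 < ω := by
    rcases hω with ⟨_, h, _⟩ | ⟨_, h⟩
    · exact h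
    · nlinarith [sq_nonneg q]
  have hc : 0 < ((p + 2) * ω / 2) ^ (1 / p) := Real.rpow_pos_of_pos (by positivity) _
  have hk : 0 < p * √(ω / 2) := by positivity
  refine ⟨hω0, ?_⟩
  rcases hω with ⟨rfl, _, h⟩ | ⟨rfl, h⟩
  · set b := Real.artanh (√(2 * ω) / |q|) with hb
    have hb0 : 0 < b := by
      refine Real.artanh_pos ⟨div_pos (by positivity) (abs_pos.2 hq.ne), ?_⟩
      rw [div_lt_one (abs_pos.2 hq.ne), ← Real.sqrt_sq_eq_abs]
      exact Real.sqrt_lt_sqrt (by positivity) (by linarith)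
    refine ⟨_, Real.sinh b, _, fun x => Real.sinh (p * √(ω / 2) * |x| + b), hc,
      Real.sinh_pos_iff.2 hb0, hk, by fun_prop, fun x => ?_, fun x => by simp [soliton, hb]⟩
    have ht : 0 ≤ p * √(ω / 2) * |x| := by positivity
    simp only [Real.sinh_eq]
    rw [Real.exp_add, neg_add, Real.exp_add]
    have h1 : Real.exp (-(p * √(ω / 2) * |x|)) ≤ Real.exp (p * √(ω / 2) * |x|) :=
      Real.exp_le_exp.2 (by linarith)
    have h2 := Real.exp_pos (-b)
    nlinarith
  · set b := Real.artanh (|q| / √(2 * ω)) with hb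
    have hb0 : 0 ≤ b := Real.artanh_nonneg (by positivity)
    refine ⟨_, 1 / 2, _, fun x => Real.cosh (p * √(ω / 2) * |x| + b), hc,
      by norm_num, hk, by fun_prop, fun x => ?_,
      fun x => by simp [soliton, hb, show ¬ ((-1 : ℝ) = 1) by norm_num]⟩
    simp only [Real.cosh_eq]
    have h1 : Real.exp (p * √(ω / 2) * |x|) ≤ Real.exp (p * √(ω / 2) * |x| + b) :=
      Real.exp_le_exp.2 (by linarith)
    have h2 := Real.exp_pos (-(p * √(ω / 2) * |x| + b))
    linarith

theorem continuous_scalarPotential {σ p q ω : ℝ} (hq : q < 0) (hp : 4 < p)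
    (hω : AdmissibleFrequency σ q ω) : Continuous (scalarPotential σ p q ω) := by
  obtain ⟨-, c, m, k, S, hc, hm, hk, hS, hSm, hQ⟩ := exists_soliton_eq_rpow hq hp hω
  have hS0 : ∀ x, 0 < S x := fun x => lt_of_lt_of_le (by positivity) (hSm x)
  unfold scalarPotential
  simp only [hQ]
  refine continuous_const.mul (Continuous.rpow_const (continuous_const.mul
    (hS.rpow_const fun x => Or.inl (hS0 x).ne')) fun x => Or.inr (by linarith))

theorem exists_scalarPotential_le {σ p q ω : ℝ} (hq : q < 0) (hp : 4 < p)
    (hω : AdmissibleFrequency σ q ω) :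
    ∃ C k : ℝ, 0 < k ∧ ∀ x, |scalarPotential σ p q ω x| ≤ C * Real.exp (-(k * |x|)) := by
  obtain ⟨-, c, m, k, S, hc, hm, hk, hS, hSm, hQ⟩ := exists_soliton_eq_rpow hq hp hω
  have hS0 : ∀ x, 0 < S x := fun x => lt_of_lt_of_le (by positivity) (hSm x)
  refine ⟨|σ| * (c ^ p * m ^ (-2 : ℝ)), 2 * k, by positivity, fun x => ?_⟩
  have hpp : -(2 / p) * p = -2 := by field_simp
  have h1 : soliton σ p q ω x ^ p = c ^ p * S x ^ (-2 : ℝ) := by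
    rw [hQ, Real.mul_rpow hc.le (Real.rpow_nonneg (hS0 x).le _), ← Real.rpow_mul (hS0 x).le, hpp]
  have h2 : S x ^ (-2 : ℝ) ≤ m ^ (-2 : ℝ) * Real.exp (-(2 * k * |x|)) := by
    calc _ ≤ (m * Real.exp (k * |x|)) ^ (-2 : ℝ) :=
          Real.rpow_le_rpow_of_nonpos (by positivity) (hSm x) (by norm_num)
      _ = _ := by
          rw [Real.mul_rpow hm.le (Real.exp_pos _).le, ← Real.exp_mul]
          congr 2
          ring
  have h3 : 0 ≤ c ^ p * S x ^ (-2 : ℝ) := by have := hS0 x; positivity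
  rw [scalarPotential, abs_mul, h1, abs_of_nonneg h3, mul_assoc, mul_assoc]
  gcongr

theorem exists_scalarPotential_bound {σ p q ω : ℝ} (hq : q < 0) (hp : 4 < p)
    (hω : AdmissibleFrequency σ q ω) : ∃ C : ℝ, 0 ≤ C ∧ ∀ x, |scalarPotential σ p q ω x| ≤ C := by
  obtain ⟨C, k, hk, hC⟩ := exists_scalarPotential_le hq hp hω
  have h0 : 0 ≤ C := by simpa using (abs_nonneg _).trans (hC 0)
  refine ⟨C, h0, fun x => (hC x).trans (mul_le_of_le_one_right h0 ?_)⟩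
  exact Real.exp_le_one_iff.2 (by have := abs_nonneg x; nlinarith)

/-- The right-hand side of `f'' = M f` when `ℋ f = lam f` is solved for `f''`. -/
def secondDeriv (σ p q ω lam x : ℝ) (v : Fin 2 → ℂ) (i : Fin 2) : ℂ :=
  2 * ((scalarPotential σ p q ω x : ℂ) *
        (((p : ℂ) + 2) / 2 * v i + (p : ℂ) / 2 * v (1 - i)) + ω * v i - lam * pauli3 i i * v i)

theorem hamiltonian_eq_smul_iff {σ p q ω lam x : ℝ} {v w : Fin 2 → ℂ} :
    hamiltonian σ p q ω x v w = (lam : ℂ) • v ↔ w = secondDeriv σ p q ω lam x v := by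
  constructor
  · intro h
    funext i
    have h := congrFun h i
    fin_cases i <;>
      simp [hamiltonian, potential, pauli3, dotProduct, Fin.sum_univ_two, secondDeriv,
        scalarPotential] at h ⊢
    · linear_combination (-2 : ℂ) * h
    · linear_combination (2 : ℂ) * h
  · rintro rfl
    funext i
    fin_cases i <;>
      simp [hamiltonian, potential, pauli3, dotProduct, Fin.sum_univ_two, secondDeriv,
        scalarPotential] <;> ring

theorem IsSolution.deriv_deriv {σ p q ω lam : ℝ} {f : ℝ → Fin 2 → ℂ}
    (hf : IsSolution σ p q ω lam f) {x : ℝ} (hx : x ≠ 0) :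
    deriv (deriv f) x = secondDeriv σ p q ω lam x (f x) :=
  hamiltonian_eq_smul_iff.1 (hf.equation x hx)

/-! ### The equivalent first-order system. -/

/-- The phase space of pairs `(f, f')`. -/
def Phase : Type := (Fin 2 → ℂ) × (Fin 2 → ℂ)

namespace Phase

instance : NormedAddCommGroup Phase :=
  inferInstanceAs (NormedAddCommGroup ((Fin 2 → ℂ) × (Fin 2 → ℂ)))

instance : NormedSpace ℝ Phase := inferInstanceAs (NormedSpace ℝ ((Fin 2 → ℂ) × (Fin 2 → ℂ)))

instance : FiniteDimensional ℝ Phase :=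
  inferInstanceAs (FiniteDimensional ℝ ((Fin 2 → ℂ) × (Fin 2 → ℂ)))

instance : CompleteSpace Phase := FiniteDimensional.complete ℝ Phase

@[ext]
theorem ext {y z : Phase} (h₁ : ∀ i, y.1 i = z.1 i) (h₂ : ∀ i, y.2 i = z.2 i) : y = z :=
  Prod.ext (funext h₁) (funext h₂)

/-- The phase space point `(u, v)`. -/
def mk (u v : Fin 2 → ℂ) : Phase := (u, v)

@[simp] theorem mk_fst (u v : Fin 2 → ℂ) : (mk u v).1 = u := rfl

@[simp] theorem mk_snd (u v : Fin 2 → ℂ) : (mk u v).2 = v := rfl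

@[simp] theorem add_fst (y z : Phase) (i : Fin 2) : (y + z).1 i = y.1 i + z.1 i := rfl

@[simp] theorem add_snd (y z : Phase) (i : Fin 2) : (y + z).2 i = y.2 i + z.2 i := rfl

@[simp] theorem sub_fst (y z : Phase) (i : Fin 2) : (y - z).1 i = y.1 i - z.1 i := rfl

@[simp] theorem sub_snd (y z : Phase) (i : Fin 2) : (y - z).2 i = y.2 i - z.2 i := rfl

@[simp] theorem neg_fst (y : Phase) (i : Fin 2) : (-y).1 i = -y.1 i := rfl

@[simp] theorem neg_snd (y : Phase) (i : Fin 2) : (-y).2 i = -y.2 i := rfl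

@[simp] theorem zero_fst (i : Fin 2) : (0 : Phase).1 i = 0 := rfl

@[simp] theorem zero_snd (i : Fin 2) : (0 : Phase).2 i = 0 := rfl

@[simp] theorem smul_fst (t : ℝ) (y : Phase) (i : Fin 2) : (t • y).1 i = t * y.1 i := rfl

@[simp] theorem smul_snd (t : ℝ) (y : Phase) (i : Fin 2) : (t • y).2 i = t * y.2 i := rfl

theorem norm_fst_le (y : Phase) : ‖y.1‖ ≤ ‖y‖ := 
  _root_.norm_fst_le (E := Fin 2 → ℂ) (F := Fin 2 → ℂ) y

theorem norm_snd_le (y : Phase) : ‖y.2‖ ≤ ‖y‖ := 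
  _root_.norm_snd_le (E := Fin 2 → ℂ) (F := Fin 2 → ℂ) y

theorem norm_mk_zero (v : Fin 2 → ℂ) : ‖mk v 0‖ = ‖v‖ := by
  change max ‖v‖ ‖(0 : Fin 2 → ℂ)‖ = ‖v‖
  rw [norm_zero, max_eq_left (norm_nonneg v)]

theorem _root_.HasDerivAt.phase_fst {Y : ℝ → Phase} {y : Phase} {x : ℝ} (h : HasDerivAt Y y x) :
    HasDerivAt (fun t => (Y t).1) y.1 x :=
  (hasFDerivAt_fst (𝕜 := ℝ) (E := Fin 2 → ℂ) (F := Fin 2 → ℂ)).comp_hasDerivAt x h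

theorem _root_.HasDerivAt.phase_snd {Y : ℝ → Phase} {y : Phase} {x : ℝ} (h : HasDerivAt Y y x) :
    HasDerivAt (fun t => (Y t).2) y.2 x :=
  (hasFDerivAt_snd (𝕜 := ℝ) (E := Fin 2 → ℂ) (F := Fin 2 → ℂ)).comp_hasDerivAt x h

end Phase

/-- The map `(u, v) ↦ (a u + b v, c u + d v)`, with componentwise products. -/
def diagBlock (a b c d : Fin 2 → ℝ) : Phase →L[ℝ] Phase :=
  LinearMap.toContinuousLinearMap
    { toFun := fun y =>
        Phase.mk (fun i => a i * y.1 i + b i * y.2 i) (fun i => c i * y.1 i + d i * y.2 i)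
      map_add' := fun y z => by ext i <;> simp <;> ring
      map_smul' := fun t y => by ext i <;> simp <;> ring }

@[simp]
theorem diagBlock_apply_fst (a b c d : Fin 2 → ℝ) (y : Phase) (i : Fin 2) :
    (diagBlock a b c d y).1 i = a i * y.1 i + b i * y.2 i := rfl

@[simp]
theorem diagBlock_apply_snd (a b c d : Fin 2 → ℝ) (y : Phase) (i : Fin 2) :
    (diagBlock a b c d y).2 i = c i * y.1 i + d i * y.2 i := rfl

/-- The coupling `(u, v) ↦ (0, K u)` with `K = [p+2, p; p, p+2]`. -/
def coupling (p : ℝ) : Phase →L[ℝ] Phase :=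
  LinearMap.toContinuousLinearMap
    { toFun := fun y => Phase.mk 0 (fun i => ((p : ℂ) + 2) * y.1 i + p * y.1 (1 - i))
      map_add' := fun y z => by ext i <;> simp; ring
      map_smul' := fun t y => by ext i <;> simp; ring }

@[simp]
theorem coupling_apply_fst (p : ℝ) (y : Phase) (i : Fin 2) : (coupling p y).1 i = 0 := rfl

@[simp]
theorem coupling_apply_snd (p : ℝ) (y : Phase) (i : Fin 2) :
    (coupling p y).2 i = ((p : ℂ) + 2) * y.1 i + p * y.1 (1 - i) := rfl

/-- The generator `(u, v) ↦ (v, D u)` of the free evolution, `D = diag(2(ω - lam), 2(ω + lam))`. -/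
def freeGenerator (ω lam : ℝ) : Phase →L[ℝ] Phase :=
  diagBlock 0 1 ![2 * (ω - lam), 2 * (ω + lam)] 0

/-- The generator of the first-order system equivalent to `ℋ f = lam f` away from `0`. -/
def generator (σ p q ω lam x : ℝ) : Phase →L[ℝ] Phase :=
  freeGenerator ω lam + scalarPotential σ p q ω x • coupling p

theorem generator_apply (σ p q ω lam x : ℝ) (y : Phase) :
    generator σ p q ω lam x y = Phase.mk y.2 (secondDeriv σ p q ω lam x y.1) := by
  ext i
  · simp [generator, freeGenerator]
  · fin_cases i <;> simp [generator, freeGenerator, secondDeriv, pauli3] <;> ring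

theorem continuous_generator {σ p q ω : ℝ} (hq : q < 0) (hp : 4 < p)
    (hω : AdmissibleFrequency σ q ω) (lam : ℝ) : Continuous (generator σ p q ω lam) :=
  continuous_const.add ((continuous_scalarPotential hq hp hω).smul continuous_const)

theorem exists_norm_generator_le {σ p q ω : ℝ} (hq : q < 0) (hp : 4 < p)
    (hω : AdmissibleFrequency σ q ω) (lam : ℝ) : ∃ K, ∀ x, ‖generator σ p q ω lam x‖ ≤ K := by
  obtain ⟨C, hC0, hC⟩ := exists_scalarPotential_bound hq hp hω
  refine ⟨‖freeGenerator ω lam‖ + C * ‖coupling p‖, fun x => (norm_add_le _ _).trans ?_⟩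
  rw [norm_smul]
  gcongr
  exact hC x

/-- The initial value problem for `ℋ f = lam f` at a point of the right half-line. -/
theorem exists_isSolution_of_pos {σ p q ω : ℝ} (hq : q < 0) (hp : 4 < p)
    (hω : AdmissibleFrequency σ q ω) (lam : ℝ) (x₁ : ℝ) (y₀ : Phase) :
    ∃ (f : ℝ → Fin 2 → ℂ) (Y : ℝ → Phase), IsSolution σ p q ω lam f ∧ Y x₁ = y₀ ∧
      (∀ x, HasDerivAt Y (generator σ p q ω lam x (Y x)) x) ∧
      ∀ x, 0 < x → f x = (Y x).1 ∧ deriv f x = (Y x).2 := by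
  have hcont := continuous_generator hq hp hω lam
  obtain ⟨K, hK⟩ := exists_norm_generator_le hq hp hω lam
  obtain ⟨Y, hY0, hY⟩ := exists_linear_ivp hcont hK x₁ y₀
  -- The delta enters here: the left half uses a second solution of the smooth system, whose initial
  -- slope at `0` is lowered by `2 q f(0)`. The two halves are then glued.
  obtain ⟨Z, hZ0, hZ⟩ := exists_linear_ivp hcont hK 0
    (Phase.mk (Y 0).1 ((Y 0).2 - (2 * q : ℂ) • (Y 0).1))
  simp only [generator_apply] at hY hZ
  have hY1 : Continuous fun x => (Y x).1 :=
    continuous_iff_continuousAt.2 fun x => (hY x).phase_fst.continuousAt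
  have hY2 : Continuous fun x => (Y x).2 :=
    continuous_iff_continuousAt.2 fun x => (hY x).phase_snd.continuousAt
  have hZ1 : Continuous fun x => (Z x).1 :=
    continuous_iff_continuousAt.2 fun x => (hZ x).phase_fst.continuousAt
  have hZ2 : Continuous fun x => (Z x).2 :=
    continuous_iff_continuousAt.2 fun x => (hZ x).phase_snd.continuousAt
  let f : ℝ → Fin 2 → ℂ := fun x => if 0 ≤ x then (Y x).1 else (Z x).1
  have fpos : ∀ x, 0 < x → f =ᶠ[𝓝 x] fun t => (Y t).1 := fun x hx => by
    filter_upwards [lt_mem_nhds hx] with t ht using if_pos ht.le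
  have fneg : ∀ x, x < 0 → f =ᶠ[𝓝 x] fun t => (Z t).1 := fun x hx => by
    filter_upwards [gt_mem_nhds hx] with t ht using if_neg (not_le.2 ht)
  have dpos : ∀ x, 0 < x → HasDerivAt f (Y x).2 x := fun x hx =>
    (hY x).phase_fst.congr_of_eventuallyEq (fpos x hx)
  have dneg : ∀ x, x < 0 → HasDerivAt f (Z x).2 x := fun x hx =>
    (hZ x).phase_fst.congr_of_eventuallyEq (fneg x hx)
  have ddpos : ∀ x, 0 < x → HasDerivAt (deriv f) (secondDeriv σ p q ω lam x (f x)) x :=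
    fun x hx => by
      rw [(fpos x hx).eq_of_nhds]
      refine (hY x).phase_snd.congr_of_eventuallyEq ?_
      filter_upwards [lt_mem_nhds hx] with t ht using (dpos t ht).deriv
  have ddneg : ∀ x, x < 0 → HasDerivAt (deriv f) (secondDeriv σ p q ω lam x (f x)) x :=
    fun x hx => by
      rw [(fneg x hx).eq_of_nhds]
      refine (hZ x).phase_snd.congr_of_eventuallyEq ?_
      filter_upwards [gt_mem_nhds hx] with t ht using (dneg t ht).deriv
  refine ⟨f, Y, ⟨?_, fun x hx => ?_, fun x hx => ?_, fun x hx => ?_, ?_⟩, hY0, ?_, fun x hx =>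
    ⟨if_pos hx.le, (dpos x hx).deriv⟩⟩
  · refine Continuous.if_le hY1 hZ1 continuous_const continuous_id fun x hx => ?_
    subst hx
    rw [hZ0, Phase.mk_fst]
  · rcases lt_or_gt_of_ne hx with h | h
    exacts [(dneg x h).differentiableAt, (dpos x h).differentiableAt]
  · rcases lt_or_gt_of_ne hx with h | h
    exacts [(ddneg x h).differentiableAt, (ddpos x h).differentiableAt]
  · rw [hamiltonian_eq_smul_iff]
    rcases lt_or_gt_of_ne hx with h | h
    exacts [(ddneg x h).deriv, (ddpos x h).deriv]
  · refine ⟨(Y 0).2, (Z 0).2, ?_, ?_, ?_⟩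
    · refine Tendsto.congr' ?_ (hY2.continuousAt.mono_left nhdsWithin_le_nhds)
      filter_upwards [self_mem_nhdsWithin] with t ht using (dpos t ht).deriv.symm
    · refine Tendsto.congr' ?_ (hZ2.continuousAt.mono_left nhdsWithin_le_nhds)
      filter_upwards [self_mem_nhdsWithin] with t ht using (dneg t ht).deriv.symm
    · simp [hZ0, f]
  · simpa only [generator_apply] using hY

/-! ### The free evolution and its spectral decomposition. -/

/-- The solution `sin (ξ t) / ξ` of `s'' = -ξ² s`, `s 0 = 0`, `s' 0 = 1`. -/
def sinOver (ξ t : ℝ) : ℝ := if ξ = 0 then t else Real.sin (ξ * t) / ξ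

theorem hasDerivAt_sinOver (ξ t : ℝ) : HasDerivAt (sinOver ξ) (Real.cos (ξ * t)) t := by
  unfold sinOver
  by_cases h : ξ = 0
  · simpa [h] using hasDerivAt_id' t
  · simp only [h, if_false]
    have := (((hasDerivAt_id t).const_mul ξ).sin).div_const ξ
    convert! this using 1
    simp
    field_simp

theorem sinOver_add (ξ s t : ℝ) :
    sinOver ξ (s + t) = sinOver ξ s * Real.cos (ξ * t) + Real.cos (ξ * s) * sinOver ξ t := by
  unfold sinOver
  split_ifs with h
  · simp [h]
  · rw [mul_add, Real.sin_add]; ring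

theorem mul_sinOver (ξ t : ℝ) : ξ * sinOver ξ t = Real.sin (ξ * t) := by
  unfold sinOver
  split_ifs with h
  · simp [h]
  · field_simp

theorem cos_mul_add (ξ s t : ℝ) : Real.cos (ξ * (s + t)) =
    Real.cos (ξ * s) * Real.cos (ξ * t) - ξ ^ 2 * (sinOver ξ s * sinOver ξ t) := by
  rw [mul_add, Real.cos_add, ← mul_sinOver, ← mul_sinOver]; ring

theorem sinOver_neg (ξ t : ℝ) : sinOver ξ (-t) = -sinOver ξ t := by
  unfold sinOver
  split_ifs with h
  · rfl
  · rw [mul_neg, Real.sin_neg, neg_div]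

theorem abs_sinOver_le (ξ t : ℝ) : |sinOver ξ t| ≤ |t| := by
  unfold sinOver
  split_ifs with h
  · rfl
  · rw [abs_div, div_le_iff₀ (abs_pos.2 h), mul_comm, ← abs_mul]
    exact Real.abs_sin_le_abs

/-- The projection of the phase space to the first component. -/
def oscProj : Phase →L[ℝ] Phase := diagBlock ![1, 0] 0 0 ![1, 0]

/-- The generator of the oscillation of the first component. -/
def oscGen (ξ : ℝ) : Phase →L[ℝ] Phase := diagBlock 0 ![1, 0] ![-ξ ^ 2, 0] 0

/-- The projection to the data `(0, 1; 0, -μ)`, which decay like `e^{-μ t}`. -/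
def stableProj (μ : ℝ) : Phase →L[ℝ] Phase :=
  diagBlock ![0, 1 / 2] ![0, -(1 / (2 * μ))] ![0, -(μ / 2)] ![0, 1 / 2]

/-- The projection to the data `(0, 1; 0, μ)`, which grow like `e^{μ t}`. -/
def unstableProj (μ : ℝ) : Phase →L[ℝ] Phase :=
  diagBlock ![0, 1 / 2] ![0, 1 / (2 * μ)] ![0, μ / 2] ![0, 1 / 2]

section Algebra

variable {ξ μ : ℝ}

theorem oscProj_mul_self : oscProj * oscProj = oscProj := by
  ext y i <;> fin_cases i <;> simp [oscProj]

theorem oscProj_mul_oscGen : oscProj * oscGen ξ = oscGen ξ := by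
  ext y i <;> fin_cases i <;> simp [oscProj, oscGen]

theorem oscGen_mul_oscProj : oscGen ξ * oscProj = oscGen ξ := by
  ext y i <;> fin_cases i <;> simp [oscProj, oscGen]

theorem oscGen_mul_self : oscGen ξ * oscGen ξ = -ξ ^ 2 • oscProj := by
  ext y i <;> fin_cases i <;> simp [oscProj, oscGen]

theorem stableProj_mul_self (hμ : μ ≠ 0) : stableProj μ * stableProj μ = stableProj μ := by
  have hμ' : (μ : ℂ) ≠ 0 := by exact_mod_cast hμ
  ext y i <;> fin_cases i <;> simp [stableProj] <;> field_simp <;> ring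

theorem unstableProj_mul_self (hμ : μ ≠ 0) : unstableProj μ * unstableProj μ = unstableProj μ := by
  have hμ' : (μ : ℂ) ≠ 0 := by exact_mod_cast hμ
  ext y i <;> fin_cases i <;> simp [unstableProj] <;> field_simp <;> ring

theorem stableProj_mul_unstableProj (hμ : μ ≠ 0) : stableProj μ * unstableProj μ = 0 := by
  have hμ' : (μ : ℂ) ≠ 0 := by exact_mod_cast hμ
  ext y i <;> fin_cases i <;> simp [stableProj, unstableProj] <;> field_simp <;> ring

theorem unstableProj_mul_stableProj (hμ : μ ≠ 0) : unstableProj μ * stableProj μ = 0 := by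
  have hμ' : (μ : ℂ) ≠ 0 := by exact_mod_cast hμ
  ext y i <;> fin_cases i <;> simp [stableProj, unstableProj] <;> field_simp <;> ring

theorem osc_mul_hyp : oscProj * stableProj μ = 0 ∧ oscProj * unstableProj μ = 0 ∧
    oscGen ξ * stableProj μ = 0 ∧ oscGen ξ * unstableProj μ = 0 := by
  refine ⟨?_, ?_, ?_, ?_⟩ <;> ext y i <;> fin_cases i <;>
    simp [oscProj, oscGen, stableProj, unstableProj]

theorem hyp_mul_osc : stableProj μ * oscProj = 0 ∧ unstableProj μ * oscProj = 0 ∧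
    stableProj μ * oscGen ξ = 0 ∧ unstableProj μ * oscGen ξ = 0 := by
  refine ⟨?_, ?_, ?_, ?_⟩ <;> ext y i <;> fin_cases i <;>
    simp [oscProj, oscGen, stableProj, unstableProj]

theorem oscProj_add_add : oscProj + stableProj μ + unstableProj μ = 1 := by
  ext y i <;> fin_cases i <;> simp [oscProj, stableProj, unstableProj] <;> ring

/-- At `lam = ξ²/2 + ω` the diagonal entries are `-ξ²` and `ξ² + 4ω = μ²`: an oscillator in the
first component, real exponents `±μ` in the second. -/
theorem freeGenerator_eq {ω : ℝ} (hμ : μ ≠ 0) (h : μ ^ 2 = ξ ^ 2 + 4 * ω) :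
    freeGenerator ω (ξ ^ 2 / 2 + ω) = oscGen ξ + μ • (unstableProj μ - stableProj μ) := by
  have hμ' : (μ : ℂ) ≠ 0 := by exact_mod_cast hμ
  have h' : (μ : ℂ) ^ 2 = ξ ^ 2 + 4 * ω := by exact_mod_cast h
  ext y i <;> fin_cases i <;> simp [freeGenerator, oscGen, stableProj, unstableProj]
  · field_simp; ring
  · left; ring
  · linear_combination (-y.1 1) * h'

end Algebra

/-- The free evolution, rescaled by `e^{-ν t}`. -/
def freeGroup (ξ μ ν t : ℝ) : Phase →L[ℝ] Phase :=
  Real.exp (-(ν * t)) • (Real.cos (ξ * t) • oscProj + sinOver ξ t • oscGen ξ +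
    Real.exp (-(μ * t)) • stableProj μ + Real.exp (μ * t) • unstableProj μ)

section FreeGroup

variable {ξ μ : ℝ} (ν : ℝ)

theorem freeGroup_zero : freeGroup ξ μ ν 0 = 1 := by
  simp [freeGroup, sinOver, oscProj_add_add]

theorem freeGroup_add (hμ : μ ≠ 0) (s t : ℝ) :
    freeGroup ξ μ ν (s + t) = freeGroup ξ μ ν s * freeGroup ξ μ ν t := by
  obtain ⟨h1, h2, h3, h4⟩ := osc_mul_hyp (ξ := ξ) (μ := μ)
  obtain ⟨k1, k2, k3, k4⟩ := hyp_mul_osc (ξ := ξ) (μ := μ)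
  simp only [freeGroup, smul_mul_smul_comm, mul_add, add_mul, h1, h2, h3, h4, k1, k2, k3, k4,
    oscProj_mul_self, oscProj_mul_oscGen, oscGen_mul_oscProj, oscGen_mul_self,
    stableProj_mul_self hμ, unstableProj_mul_self hμ, stableProj_mul_unstableProj hμ,
    unstableProj_mul_stableProj hμ, smul_zero, add_zero, zero_add, sinOver_add, neg_add,
    Real.exp_add]
  rw [← mul_add ξ, cos_mul_add]
  match_scalars <;> ring

theorem hasDerivAt_freeGroup (hμ : μ ≠ 0) {ω : ℝ} (h : μ ^ 2 = ξ ^ 2 + 4 * ω) (t : ℝ) :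
    HasDerivAt (freeGroup ξ μ ν)
      ((freeGenerator ω (ξ ^ 2 / 2 + ω) - ν • 1) * freeGroup ξ μ ν t) t := by
  obtain ⟨h1, h2, h3, h4⟩ := osc_mul_hyp (ξ := ξ) (μ := μ)
  obtain ⟨k1, k2, k3, k4⟩ := hyp_mul_osc (ξ := ξ) (μ := μ)
  have e : ∀ a : ℝ, HasDerivAt (fun t => Real.exp (a * t)) (a * Real.exp (a * t)) t := fun a => by
    simpa [mul_comm] using ((hasDerivAt_id t).const_mul a).exp
  have c : HasDerivAt (fun t => Real.cos (ξ * t)) (-ξ ^ 2 * sinOver ξ t) t := by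
    have := ((hasDerivAt_id t).const_mul ξ).cos
    convert! this using 1
    simp only [id, mul_one, ← mul_sinOver]
    ring
  have key := (e (-ν)).smul ((((c.smul_const oscProj).add
    ((hasDerivAt_sinOver ξ t).smul_const (oscGen ξ))).add
    ((e (-μ)).smul_const (stableProj μ))).add ((e μ).smul_const (unstableProj μ)))
  have hfun : freeGroup ξ μ ν = fun t => Real.exp (-ν * t) • (Real.cos (ξ * t) • oscProj +
      sinOver ξ t • oscGen ξ + Real.exp (-μ * t) • stableProj μ +
      Real.exp (μ * t) • unstableProj μ) := by
    funext t
    simp only [freeGroup, neg_mul]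
  rw [freeGenerator_eq hμ h, hfun]
  refine key.congr_deriv ?_
  simp only [Pi.add_apply, sub_mul, add_mul, mul_add, smul_mul_assoc, mul_smul_comm, one_mul, h3,
    h4, k1, k2, k3, k4, oscGen_mul_oscProj, oscGen_mul_self,
    stableProj_mul_self hμ, unstableProj_mul_self hμ, stableProj_mul_unstableProj hμ,
    unstableProj_mul_stableProj hμ, smul_zero, add_zero, zero_add, zero_sub, sub_zero]
  match_scalars <;> ring

theorem freeGroup_mul (hμ : μ ≠ 0) (a b c t : ℝ) :
    freeGroup ξ μ ν t * (a • oscProj + b • stableProj μ + c • unstableProj μ) =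
      (Real.exp (-(ν * t)) * Real.cos (ξ * t) * a) • oscProj +
      (Real.exp (-(ν * t)) * sinOver ξ t * a) • oscGen ξ +
      (Real.exp (-(ν * t)) * Real.exp (-(μ * t)) * b) • stableProj μ +
      (Real.exp (-(ν * t)) * Real.exp (μ * t) * c) • unstableProj μ := by
  obtain ⟨h1, h2, h3, h4⟩ := osc_mul_hyp (ξ := ξ) (μ := μ)
  obtain ⟨k1, k2, -, -⟩ := hyp_mul_osc (ξ := ξ) (μ := μ)
  simp only [freeGroup, smul_mul_assoc, mul_smul_comm, mul_add, add_mul, h1, h2, h3, h4, k1, k2,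
    oscProj_mul_self, oscGen_mul_oscProj, stableProj_mul_self hμ, unstableProj_mul_self hμ,
    stableProj_mul_unstableProj hμ, unstableProj_mul_stableProj hμ, smul_zero, add_zero, zero_add]
  module

/-- A bound for the operators that occur in `freeGroup`. -/
def modeBound (ξ μ : ℝ) : ℝ := ‖oscProj‖ + ‖oscGen ξ‖ + ‖stableProj μ‖ + ‖unstableProj μ‖

/-- Every dichotomy estimate reduces to four scalar bounds, one per mode, since the spectral
projections used later are all of the form `a • oscProj + b • stableProj μ + c • unstableProj μ`. -/
theorem norm_freeGroup_mul_le (hμ : μ ≠ 0) (a b c t : ℝ) {M : ℝ}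
    (h₁ : |Real.exp (-(ν * t)) * Real.cos (ξ * t) * a| ≤ M)
    (h₂ : |Real.exp (-(ν * t)) * sinOver ξ t * a| ≤ M)
    (h₃ : |Real.exp (-(ν * t)) * Real.exp (-(μ * t)) * b| ≤ M)
    (h₄ : |Real.exp (-(ν * t)) * Real.exp (μ * t) * c| ≤ M) :
    ‖freeGroup ξ μ ν t * (a • oscProj + b • stableProj μ + c • unstableProj μ)‖ ≤
      modeBound ξ μ * M := by
  rw [freeGroup_mul ν hμ]
  refine (norm_add₄_le).trans ?_
  simp only [norm_smul, Real.norm_eq_abs, modeBound]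
  calc _ ≤ M * ‖oscProj‖ + M * ‖oscGen ξ‖ + M * ‖stableProj μ‖ + M * ‖unstableProj μ‖ := by gcongr
    _ = _ := by ring

end FreeGroup

/-! ### Existence of the Jost solutions. -/

theorem one_add_le_mul_exp {k x : ℝ} (hk : 0 < k) (hx : 0 ≤ x) :
    1 + x ≤ (1 + 2 / k) * Real.exp (k / 2 * x) := by
  have e1 : k / 2 * x ≤ Real.exp (k / 2 * x) := by
    linarith [Real.add_one_le_exp (k / 2 * x)]
  have e2 : 1 ≤ Real.exp (k / 2 * x) := Real.one_le_exp (by positivity)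
  have e3 : x = 2 / k * (k / 2 * x) := by field_simp
  have e4 : 2 / k * (k / 2 * x) ≤ 2 / k * Real.exp (k / 2 * x) := by gcongr
  linarith

theorem one_add_mul_exp_neg_le {k x : ℝ} (hk : 0 < k) (hx : 0 ≤ x) :
    (1 + x) * Real.exp (-(k * x)) ≤ (1 + 2 / k) * Real.exp (-(k / 2) * x) := by
  calc _ ≤ (1 + 2 / k) * Real.exp (k / 2 * x) * Real.exp (-(k * x)) := by
        gcongr
        exact one_add_le_mul_exp hk hx
    _ = _ := by rw [mul_assoc, ← Real.exp_add]; congr 2; ring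

theorem integrableOn_one_add_mul_exp_neg {k : ℝ} (hk : 0 < k) (C : ℝ) :
    IntegrableOn (fun x => (1 + x) * (C * Real.exp (-(k * x)))) (Set.Ioi 0) := by
  have h : IntegrableOn (fun x => |C| * ((1 + 2 / k) * Real.exp (-(k / 2) * x))) (Set.Ioi 0) :=
    ((exp_neg_integrableOn_Ioi 0 (by positivity)).const_mul _).const_mul _
  refine Integrable.mono' h (by fun_prop)
    ((ae_restrict_iff' measurableSet_Ioi).2 (Eventually.of_forall fun x hx => ?_))
  have hx0 : (0 : ℝ) < x := hx
  rw [norm_mul, norm_mul, Real.norm_eq_abs, Real.norm_eq_abs, Real.norm_eq_abs, Real.abs_exp,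
    abs_of_pos (by linarith : 0 < 1 + x), mul_left_comm]
  exact mul_le_mul_of_nonneg_left (one_add_mul_exp_neg_le hk hx0.le) (abs_nonneg C)

theorem decayRate_pos {ω : ℝ} (hω : 0 < ω) (ξ : ℝ) : 0 < decayRate ω ξ :=
  Real.sqrt_pos.2 (by positivity)

theorem decayRate_sq {ω : ℝ} (hω : 0 < ω) (ξ : ℝ) : decayRate ω ξ ^ 2 = ξ ^ 2 + 4 * ω :=
  Real.sq_sqrt (by positivity)

/-- Rescaling by `e^{-νx}` turns an orbit of exponential rate `ν` into a bounded one, so asymptotic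
integration applies to oscillating, decaying and growing solutions alike. -/
theorem exists_isSolution_asymptotic {σ p q ω : ℝ} (hq : q < 0) (hp : 4 < p)
    (hω : AdmissibleFrequency σ q ω) (ξ ν : ℝ) {P : Phase →L[ℝ] Phase} {B C : ℝ} {v : Phase}
    (hminus : ∀ t, 0 ≤ t → ‖freeGroup ξ (decayRate ω ξ) ν t * P‖ ≤ C)
    (hlim : Tendsto (fun t => freeGroup ξ (decayRate ω ξ) ν t * P) atTop (𝓝 0))
    (hplus : ∀ t, 0 ≤ t → ‖freeGroup ξ (decayRate ω ξ) ν (-t) * (1 - P)‖ ≤ C * (1 + t))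
    (hv : ∀ x, 0 ≤ x → ‖freeGroup ξ (decayRate ω ξ) ν x v‖ ≤ B) :
    ∃ f : ℝ → Fin 2 → ℂ, IsSolution σ p q ω (ξ ^ 2 / 2 + ω) f ∧
      Tendsto (fun x => Real.exp (-(ν * x)) • Phase.mk (f x) (deriv f x) -
        freeGroup ξ (decayRate ω ξ) ν x v) atTop (𝓝 0) := by
  have hω0 := (exists_soliton_eq_rpow hq hp hω).1
  have hμ := (decayRate_pos hω0 ξ).ne'
  obtain ⟨Cv, k, hk, hC⟩ := exists_scalarPotential_le hq hp hω
  obtain ⟨x₀, hx₀, z, hz, hzlim⟩ := exists_solution_asymptotic_to_orbit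
    (R := fun x => scalarPotential σ p q ω x • coupling p)
    (ρ := fun x => (Cv * ‖coupling p‖) * Real.exp (-(k * x)))
    (hasDerivAt_freeGroup ν hμ (decayRate_sq hω0 ξ)) (freeGroup_zero ν) (freeGroup_add ν hμ)
    ((continuous_scalarPotential hq hp hω).smul continuous_const)
    (fun x hx => by
      rw [norm_smul, mul_right_comm]
      gcongr
      simpa [abs_of_nonneg hx] using hC x)
    (integrableOn_one_add_mul_exp_neg hk _) hminus hlim hplus hv
  obtain ⟨K, hK⟩ := exists_norm_generator_le hq hp hω (ξ ^ 2 / 2 + ω)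
  -- Asymptotic integration solves the system only beyond `x₀`. A global solution with the same data
  -- at `x₀ + 1` agrees with it from there on, by uniqueness.
  obtain ⟨f, Y, hf, hY0, hY, hfY⟩ := exists_isSolution_of_pos hq hp hω (ξ ^ 2 / 2 + ω) (x₀ + 1)
    (Real.exp (ν * (x₀ + 1)) • z (x₀ + 1))
  have hw : ∀ x, x₀ < x → HasDerivAt (fun x => Real.exp (ν * x) • z x)
      (generator σ p q ω (ξ ^ 2 / 2 + ω) x (Real.exp (ν * x) • z x)) x := by
    intro x hx
    have h1 : HasDerivAt (fun x => Real.exp (ν * x)) (ν * Real.exp (ν * x)) x := by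
      simpa [mul_comm] using ((hasDerivAt_id x).const_mul ν).exp
    refine (h1.smul (hz x hx)).congr_deriv ?_
    simp only [generator, _root_.add_apply, _root_.sub_apply, _root_.smul_apply, map_smul,
      one_apply_eq_self]
    module
  have hYw := linear_ode_unique_right hK (x₀ := x₀ + 1) (fun x _ => hY x)
    (fun x hx => hw x (by linarith)) hY0
  refine ⟨f, hf, hzlim.congr' ?_⟩
  filter_upwards [eventually_ge_atTop (x₀ + 1)] with x hx
  obtain ⟨e1, e2⟩ := hfY x (by linarith)
  rw [e1, e2]
  have e3 : Phase.mk (Y x).1 (Y x).2 = Y x := rfl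
  rw [e3, hYw x hx, smul_smul, ← Real.exp_add, neg_add_cancel, Real.exp_zero, one_smul]

/-- `f` and `f'` behave like `e^{c x} a` and its derivative as `x → ∞`. -/
structure IsAsymptoticTo (c : ℂ) (a : Fin 2 → ℂ) (f : ℝ → Fin 2 → ℂ) : Prop where
  tendsto : Tendsto (fun x : ℝ => Complex.exp (-(c * x)) • f x) atTop (𝓝 a)
  tendsto_deriv : Tendsto (fun x : ℝ => Complex.exp (-(c * x)) • deriv f x) atTop (𝓝 (c • a))

theorem deriv_exp_smul {f : ℝ → Fin 2 → ℂ} (c : ℂ) {x : ℝ} (hf : DifferentiableAt ℝ f x) :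
    deriv (fun x : ℝ => Complex.exp (-(c * x)) • f x) x =
      Complex.exp (-(c * x)) • deriv f x - c • Complex.exp (-(c * x)) • f x := by
  have h1 : HasDerivAt (fun x : ℝ => Complex.exp (-(c * x))) (Complex.exp (-(c * x)) * -c) x := by
    have := ((Complex.ofRealCLM.hasDerivAt (x := x)).const_mul c).neg.cexp
    simpa using this
  refine (HasDerivAt.congr_deriv (h1.smul hf.hasDerivAt) ?_).deriv
  module

/-- From `(e^{-cx} f)' = e^{-cx} f' - c e^{-cx} f`: the normalization by derivatives in
`JostSolutions` amounts to asymptotics of the Cauchy data, which is what Wronskians require. -/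
theorem IsSolution.isAsymptoticTo {σ p q ω lam : ℝ} {f : ℝ → Fin 2 → ℂ}
    (hf : IsSolution σ p q ω lam f) {c : ℂ} {a : Fin 2 → ℂ}
    (h : Tendsto (fun x : ℝ => Complex.exp (-(c * x)) • f x) atTop (𝓝 a))
    (h' : Tendsto (deriv fun x : ℝ => Complex.exp (-(c * x)) • f x) atTop (𝓝 0)) :
    IsAsymptoticTo c a f := by
  refine ⟨h, ?_⟩
  have := h'.add (h.const_smul c)
  rw [zero_add] at this
  refine this.congr' ?_
  filter_upwards [eventually_gt_atTop 0] with x hx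
  rw [deriv_exp_smul c (hf.differentiableAt x hx.ne'), sub_add_cancel]

theorem IsAsymptoticTo.tendsto_deriv_exp_smul {σ p q ω lam : ℝ} {f : ℝ → Fin 2 → ℂ} {c : ℂ}
    {a : Fin 2 → ℂ} (h : IsAsymptoticTo c a f) (hf : IsSolution σ p q ω lam f) :
    Tendsto (deriv fun x : ℝ => Complex.exp (-(c * x)) • f x) atTop (𝓝 0) := by
  have := h.tendsto_deriv.sub (h.tendsto.const_smul c)
  rw [sub_self] at this
  refine this.congr' ?_
  filter_upwards [eventually_gt_atTop 0] with x hx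
  rw [deriv_exp_smul c (hf.differentiableAt x hx.ne')]

theorem norm_exp_imaginary_mul (c : ℂ) (x : ℝ) : ‖Complex.exp ((c - c.re) * x)‖ = 1 := by
  rw [Complex.norm_exp]
  simp

/-- The factor `e^{-cx}` differs from the real rescaling `e^{-(Re c) x}` only by a unimodular
factor, which leaves the norm of the error unchanged. -/
theorem isAsymptoticTo_of_phase {f : ℝ → Fin 2 → ℂ} {c : ℂ} {a : Fin 2 → ℂ} {y : ℝ → Phase}
    (hy₁ : ∀ x i, (y x).1 i = Complex.exp ((c - c.re) * x) * a i)
    (hy₂ : ∀ x i, (y x).2 i = Complex.exp ((c - c.re) * x) * (c * a i))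
    (h : Tendsto (fun x => Real.exp (-(c.re * x)) • Phase.mk (f x) (deriv f x) - y x)
      atTop (𝓝 0)) :
    IsAsymptoticTo c a f := by
  have hnorm : ∀ x : ℝ, ‖Complex.exp (-((c - c.re) * x))‖ = 1 := fun x => by
    rw [Complex.norm_exp]
    simp
  have hsplit : ∀ x : ℝ, Complex.exp (-(c * x)) =
      Complex.exp (-((c - c.re) * x)) * Real.exp (-(c.re * x)) := fun x => by
    push_cast
    rw [← Complex.exp_add]
    congr 1
    ring
  have hinv : ∀ x : ℝ, Complex.exp (-((c - c.re) * x)) * Complex.exp ((c - c.re) * x) = 1 :=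
    fun x => by rw [← Complex.exp_add, neg_add_cancel, Complex.exp_zero]
  have h0 := tendsto_zero_iff_norm_tendsto_zero.1 h
  constructor
  · refine tendsto_pi_nhds.2 fun i => ?_
    rw [tendsto_iff_norm_sub_tendsto_zero]
    refine squeeze_zero (fun _ => norm_nonneg _) (fun x => ?_) h0
    have e : (Complex.exp (-(c * x)) • f x) i - a i = Complex.exp (-((c - c.re) * x)) *
        (Real.exp (-(c.re * x)) • Phase.mk (f x) (deriv f x) - y x).1 i := by
      rw [Phase.sub_fst, Phase.smul_fst, hy₁, Phase.mk_fst, mul_sub, ← mul_assoc, ← mul_assoc,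
        hinv, ← hsplit]
      simp
    rw [e, norm_mul, hnorm, one_mul]
    exact (norm_le_pi_norm _ i).trans (Phase.norm_fst_le _)
  · refine tendsto_pi_nhds.2 fun i => ?_
    rw [tendsto_iff_norm_sub_tendsto_zero]
    refine squeeze_zero (fun _ => norm_nonneg _) (fun x => ?_) h0
    have e : (Complex.exp (-(c * x)) • deriv f x) i - (c • a) i =
        Complex.exp (-((c - c.re) * x)) *
        (Real.exp (-(c.re * x)) • Phase.mk (f x) (deriv f x) - y x).2 i := by
      rw [Phase.sub_snd, Phase.smul_snd, hy₂, Phase.mk_snd, mul_sub, ← mul_assoc, ← mul_assoc,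
        hinv, ← hsplit]
      simp
    rw [e, norm_mul, hnorm, one_mul]
    exact (norm_le_pi_norm _ i).trans (Phase.norm_snd_le _)

theorem tendsto_exp_neg_mul_atTop {a : ℝ} (ha : 0 < a) :
    Tendsto (fun t => Real.exp (-(a * t))) atTop (𝓝 0) :=
  Real.tendsto_exp_neg_atTop_nhds_zero.comp (tendsto_id.const_mul_atTop ha)

/-- If the free evolution of `v` is `e^{c x} (a, c a)`, then there is a solution asymptotic to it. -/
theorem exists_isSolution_isAsymptoticTo {σ p q ω : ℝ} (hq : q < 0) (hp : 4 < p)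
    (hω : AdmissibleFrequency σ q ω) (ξ : ℝ) {c : ℂ} {a : Fin 2 → ℂ} {P : Phase →L[ℝ] Phase}
    {C : ℝ} {v : Phase}
    (hminus : ∀ t, 0 ≤ t → ‖freeGroup ξ (decayRate ω ξ) c.re t * P‖ ≤ C)
    (hlim : Tendsto (fun t => freeGroup ξ (decayRate ω ξ) c.re t * P) atTop (𝓝 0))
    (hplus : ∀ t, 0 ≤ t → ‖freeGroup ξ (decayRate ω ξ) c.re (-t) * (1 - P)‖ ≤ C * (1 + t))
    (hv₁ : ∀ x i, (freeGroup ξ (decayRate ω ξ) c.re x v).1 i =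
      Complex.exp ((c - c.re) * x) * a i)
    (hv₂ : ∀ x i, (freeGroup ξ (decayRate ω ξ) c.re x v).2 i =
      Complex.exp ((c - c.re) * x) * (c * a i)) :
    ∃ f : ℝ → Fin 2 → ℂ, IsSolution σ p q ω (ξ ^ 2 / 2 + ω) f ∧ IsAsymptoticTo c a f := by
  obtain ⟨f, hf, h⟩ := exists_isSolution_asymptotic hq hp hω ξ c.re (B := max ‖a‖ ‖c • a‖)
    hminus hlim hplus (fun x _ => by
      refine max_le_max ((pi_norm_le_iff_of_nonneg (norm_nonneg _)).2 fun i => ?_)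
        ((pi_norm_le_iff_of_nonneg (norm_nonneg _)).2 fun i => ?_)
      · rw [hv₁, norm_mul, norm_exp_imaginary_mul, one_mul]
        exact norm_le_pi_norm a i
      · rw [hv₂, norm_mul, norm_exp_imaginary_mul, one_mul]
        exact norm_le_pi_norm (c • a) i)
  exact ⟨f, hf, isAsymptoticTo_of_phase hv₁ hv₂ h⟩

theorem exists_oscillating_solution {σ p q ω : ℝ} (hq : q < 0) (hp : 4 < p)
    (hω : AdmissibleFrequency σ q ω) (ξ : ℝ) :
    ∃ f : ℝ → Fin 2 → ℂ, IsSolution σ p q ω (ξ ^ 2 / 2 + ω) f ∧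
      IsAsymptoticTo (Complex.I * ξ) ![1, 0] f := by
  have hμ := decayRate_pos (exists_soliton_eq_rpow hq hp hω).1 ξ
  have hexp : ∀ x : ℝ, Complex.exp (Complex.I * ξ * x) =
      Real.cos (ξ * x) + Complex.I * (ξ * sinOver ξ x) := fun x => by
    have : (ξ : ℂ) * sinOver ξ x = (Real.sin (ξ * x) : ℝ) := by
      rw [← mul_sinOver]; push_cast; rfl
    rw [this, show Complex.I * ξ * x = ((ξ * x : ℝ) : ℂ) * Complex.I by push_cast; ring,
      Complex.exp_mul_I]
    push_cast
    ring
  have hre : (Complex.I * ξ : ℂ).re = 0 := by simp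
  -- Only the mode `e^{-μt}` decays forward. The oscillation belongs to the complementary part,
  -- where linear growth is permitted; it occurs at `ξ = 0`, where `sinOver` is `t`.
  have eP : stableProj (decayRate ω ξ) = (0 : ℝ) • oscProj + (1 : ℝ) • stableProj (decayRate ω ξ) +
      (0 : ℝ) • unstableProj (decayRate ω ξ) := by simp
  have eQ : 1 - stableProj (decayRate ω ξ) = (1 : ℝ) • oscProj +
      (0 : ℝ) • stableProj (decayRate ω ξ) + (1 : ℝ) • unstableProj (decayRate ω ξ) := by
    rw [← oscProj_add_add (μ := decayRate ω ξ)]; module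
  have hb : ∀ t : ℝ, ‖freeGroup ξ (decayRate ω ξ) 0 t * stableProj (decayRate ω ξ)‖ ≤
      modeBound ξ (decayRate ω ξ) * Real.exp (-(decayRate ω ξ * t)) := fun t => by
    rw [eP]
    apply norm_freeGroup_mul_le 0 hμ.ne' <;> simp [Real.exp_nonneg]
  have hm : 0 ≤ modeBound ξ (decayRate ω ξ) := by unfold modeBound; positivity
  refine exists_isSolution_isAsymptoticTo hq hp hω ξ (P := stableProj (decayRate ω ξ))
    (C := modeBound ξ (decayRate ω ξ)) (v := Phase.mk ![1, 0] ((Complex.I * ξ) • ![1, 0]))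
    (fun t ht => ?_) ?_ (fun t ht => ?_) (fun x i => ?_) (fun x i => ?_)
  · rw [hre]
    refine (hb t).trans (mul_le_of_le_one_right hm (Real.exp_le_one_iff.2 ?_))
    nlinarith
  · rw [hre]
    refine squeeze_zero_norm hb ?_
    simpa using (tendsto_exp_neg_mul_atTop hμ).const_mul (modeBound ξ (decayRate ω ξ))
  · rw [hre, eQ]
    have h1 : Real.exp (-(decayRate ω ξ * t)) ≤ 1 := Real.exp_le_one_iff.2 (by nlinarith)
    have h2 := abs_sinOver_le ξ t
    rw [abs_of_nonneg ht] at h2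
    apply norm_freeGroup_mul_le 0 hμ.ne'
    · simpa using (Real.abs_cos_le_one _).trans (by linarith : 1 ≤ 1 + t)
    · simp only [zero_mul, neg_zero, Real.exp_zero, one_mul, mul_one, sinOver_neg, abs_neg]
      linarith
    · simp; linarith
    · simp; linarith
  · rw [hre, Complex.ofReal_zero, sub_zero, hexp]
    fin_cases i <;> simp [freeGroup, oscProj, oscGen, stableProj, unstableProj]
    ring
  · rw [hre, Complex.ofReal_zero, sub_zero, hexp]
    fin_cases i <;> simp [freeGroup, oscProj, oscGen, stableProj, unstableProj]
    linear_combination (-(ξ : ℂ) ^ 2 * sinOver ξ x) * Complex.I_sq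

theorem exists_decaying_solution {σ p q ω : ℝ} (hq : q < 0) (hp : 4 < p)
    (hω : AdmissibleFrequency σ q ω) (ξ : ℝ) :
    ∃ f : ℝ → Fin 2 → ℂ, IsSolution σ p q ω (ξ ^ 2 / 2 + ω) f ∧
      IsAsymptoticTo (-(decayRate ω ξ : ℂ)) ![0, 1] f := by
  have hμ := decayRate_pos (exists_soliton_eq_rpow hq hp hω).1 ξ
  have hμ' : (decayRate ω ξ : ℂ) ≠ 0 := by exact_mod_cast hμ.ne'
  have hre : (-(decayRate ω ξ : ℂ)).re = -decayRate ω ξ := by simp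
  have eQ : (1 : Phase →L[ℝ] Phase) - 0 = (1 : ℝ) • oscProj +
      (1 : ℝ) • stableProj (decayRate ω ξ) + (1 : ℝ) • unstableProj (decayRate ω ξ) := by
    rw [← oscProj_add_add (μ := decayRate ω ξ)]; module
  have hm : 0 ≤ modeBound ξ (decayRate ω ξ) := by unfold modeBound; positivity
  have hee : ∀ x : ℝ, Complex.exp (decayRate ω ξ * x) * Complex.exp (-(decayRate ω ξ * x)) = 1 :=
    fun x => by rw [← Complex.exp_add, add_neg_cancel, Complex.exp_zero]
  -- After rescaling with `ν = -μ` the modes have rates `μ`, `0`, `2μ`. None decays forward, so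
  -- everything is integrated from infinity.
  refine exists_isSolution_isAsymptoticTo hq hp hω ξ (P := 0)
    (C := modeBound ξ (decayRate ω ξ)) (v := Phase.mk ![0, 1] ((-(decayRate ω ξ : ℂ)) • ![0, 1]))
    (fun t ht => by simpa using hm) (by simp) (fun t ht => ?_) (fun x i => ?_) (fun x i => ?_)
  · rw [hre, eQ]
    have h1 : Real.exp (-(decayRate ω ξ * t)) ≤ 1 := Real.exp_le_one_iff.2 (by nlinarith)
    have h2 := abs_sinOver_le ξ t
    rw [abs_of_nonneg ht] at h2
    have h3 : Real.exp (-(decayRate ω ξ * t)) * Real.exp (decayRate ω ξ * t) = 1 := by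
      rw [← Real.exp_add, neg_add_cancel, Real.exp_zero]
    have h4 := Real.exp_pos (-(decayRate ω ξ * t))
    apply norm_freeGroup_mul_le _ hμ.ne'
    · simp only [neg_mul, mul_neg, neg_neg, mul_one, abs_mul, Real.abs_exp]
      have := mul_le_one₀ h1 (abs_nonneg _) (Real.abs_cos_le_one (-(ξ * t)))
      linarith
    · simp only [neg_mul, mul_neg, neg_neg, mul_one, abs_mul, Real.abs_exp, sinOver_neg, abs_neg]
      have := mul_le_mul h1 h2 (abs_nonneg _) zero_le_one
      linarith
    · simp only [neg_mul, mul_neg, neg_neg, mul_one, h3, abs_one]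
      linarith
    · simp only [neg_mul, mul_neg, neg_neg, mul_one, abs_mul, Real.abs_exp]
      have := mul_le_one₀ h1 h4.le h1
      linarith
  · rw [hre]
    fin_cases i <;> simp [freeGroup, oscProj, oscGen, stableProj, unstableProj]
    field_simp
    linear_combination 2 * hee x
  · rw [hre]
    fin_cases i <;> simp [freeGroup, oscProj, oscGen, stableProj, unstableProj]
    field_simp
    linear_combination (-2) * hee x

theorem exists_growing_solution {σ p q ω : ℝ} (hq : q < 0) (hp : 4 < p)
    (hω : AdmissibleFrequency σ q ω) (ξ : ℝ) :
    ∃ f : ℝ → Fin 2 → ℂ, IsSolution σ p q ω (ξ ^ 2 / 2 + ω) f ∧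
      IsAsymptoticTo (decayRate ω ξ : ℂ) ![0, 1] f := by
  have hμ := decayRate_pos (exists_soliton_eq_rpow hq hp hω).1 ξ
  have hμ' : (decayRate ω ξ : ℂ) ≠ 0 := by exact_mod_cast hμ.ne'
  have hre : (decayRate ω ξ : ℂ).re = decayRate ω ξ := by simp
  -- After rescaling with `ν = μ` the unstable mode is constant, and the other modes decay forward,
  -- the oscillation at worst like `(1 + t) e^{-μt}`.
  have eP : oscProj + stableProj (decayRate ω ξ) = (1 : ℝ) • oscProj +
      (1 : ℝ) • stableProj (decayRate ω ξ) + (0 : ℝ) • unstableProj (decayRate ω ξ) := by simp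
  have eQ : 1 - (oscProj + stableProj (decayRate ω ξ)) = (0 : ℝ) • oscProj +
      (0 : ℝ) • stableProj (decayRate ω ξ) + (1 : ℝ) • unstableProj (decayRate ω ξ) := by
    rw [← oscProj_add_add (μ := decayRate ω ξ)]; module
  have hm : 0 ≤ modeBound ξ (decayRate ω ξ) := by unfold modeBound; positivity
  have hee : ∀ x : ℝ, Complex.exp (decayRate ω ξ * x) * Complex.exp (-(decayRate ω ξ * x)) = 1 :=
    fun x => by rw [← Complex.exp_add, add_neg_cancel, Complex.exp_zero]
  have hb : ∀ t : ℝ, 0 ≤ t →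
      ‖freeGroup ξ (decayRate ω ξ) (decayRate ω ξ) t * (oscProj + stableProj (decayRate ω ξ))‖ ≤
      modeBound ξ (decayRate ω ξ) *
        ((1 + 2 / decayRate ω ξ) * Real.exp (-(decayRate ω ξ / 2) * t)) := fun t ht => by
    rw [eP]
    have h1 : Real.exp (-(decayRate ω ξ * t)) ≤ 1 := Real.exp_le_one_iff.2 (by nlinarith)
    have h2 := abs_sinOver_le ξ t
    rw [abs_of_nonneg ht] at h2
    have h4 := Real.exp_pos (-(decayRate ω ξ * t))
    refine (norm_freeGroup_mul_le _ hμ.ne' _ _ _ _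
      (M := (1 + t) * Real.exp (-(decayRate ω ξ * t))) ?_ ?_ ?_ ?_).trans
      (mul_le_mul_of_nonneg_left (one_add_mul_exp_neg_le hμ ht) hm)
    · rw [mul_one, abs_mul, Real.abs_exp, mul_comm]
      gcongr
      exact (Real.abs_cos_le_one _).trans (by linarith)
    · rw [mul_one, abs_mul, Real.abs_exp, mul_comm]
      gcongr
      linarith
    · rw [mul_one, abs_mul, Real.abs_exp]
      gcongr
      linarith
    · rw [mul_zero, abs_zero]
      positivity
  refine exists_isSolution_isAsymptoticTo hq hp hω ξ (P := oscProj + stableProj (decayRate ω ξ))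
    (C := modeBound ξ (decayRate ω ξ) * (1 + 2 / decayRate ω ξ))
    (v := Phase.mk ![0, 1] ((decayRate ω ξ : ℂ) • ![0, 1]))
    (fun t ht => ?_) ?_ (fun t ht => ?_) (fun x i => ?_) (fun x i => ?_)
  · rw [hre]
    refine (hb t ht).trans ?_
    gcongr
    refine mul_le_of_le_one_right (by positivity) (Real.exp_le_one_iff.2 ?_)
    nlinarith
  · rw [hre]
    refine squeeze_zero_norm' ((eventually_ge_atTop 0).mono hb) ?_
    simpa using ((tendsto_exp_neg_mul_atTop (half_pos hμ)).const_mul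
      (1 + 2 / decayRate ω ξ)).const_mul (modeBound ξ (decayRate ω ξ))
  · rw [hre, eQ]
    have h3 : Real.exp (decayRate ω ξ * t) * Real.exp (-(decayRate ω ξ * t)) = 1 := by
      rw [← Real.exp_add, add_neg_cancel, Real.exp_zero]
    rw [mul_assoc]
    have h5 : (1 : ℝ) ≤ (1 + 2 / decayRate ω ξ) * (1 + t) := by
      have : 0 ≤ 2 / decayRate ω ξ := by positivity
      nlinarith
    apply norm_freeGroup_mul_le _ hμ.ne'
    · simp; linarith
    · simp; linarith
    · simp; linarith
    · simp only [mul_neg, neg_neg, mul_one, h3, abs_one]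
      exact h5
  · rw [hre]
    fin_cases i <;> simp [freeGroup, oscProj, oscGen, stableProj, unstableProj]
    field_simp
    linear_combination 2 * hee x
  · rw [hre]
    fin_cases i <;> simp [freeGroup, oscProj, oscGen, stableProj, unstableProj]
    field_simp
    linear_combination 2 * hee x

theorem nonempty_jostSolutions {σ p q ω : ℝ} (hq : q < 0) (hp : 4 < p)
    (hω : AdmissibleFrequency σ q ω) (ξ : ℝ) : Nonempty (JostSolutions σ p q ω ξ) := by
  obtain ⟨f₁, s₁, h₁⟩ := exists_oscillating_solution hq hp hω ξ
  -- The spectral parameter depends only on `ξ²`, so `f₂` is the first Jost solution for `-ξ`.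
  obtain ⟨f₂, s₂, h₂⟩ := exists_oscillating_solution hq hp hω (-ξ)
  obtain ⟨f₃, s₃, h₃⟩ := exists_decaying_solution hq hp hω ξ
  obtain ⟨f₄, s₄, h₄⟩ := exists_growing_solution hq hp hω ξ
  rw [neg_sq] at s₂
  have d₁ := h₁.tendsto_deriv_exp_smul s₁
  have d₂ := h₂.tendsto_deriv_exp_smul s₂
  have d₃ := h₃.tendsto_deriv_exp_smul s₃
  have d₄ := h₄.tendsto_deriv_exp_smul s₄
  have l₂ := h₂.tendsto
  have l₃ := h₃.tendsto
  simp only [Complex.ofReal_neg, mul_neg, neg_mul, neg_neg] at d₂ l₂ d₃ l₃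
  exact ⟨⟨f₁, f₂, f₃, f₄, s₁, s₂, s₃, s₄, h₁.tendsto, l₂, l₃, h₄.tendsto, d₁, d₂, d₃, d₄⟩⟩

/-! ### Linear structure, Wronskians and unique continuation. -/

section Solutions

variable {σ p q ω lam : ℝ} {f g h u : ℝ → Fin 2 → ℂ}

theorem secondDeriv_add_smul (σ p q ω lam x : ℝ) (a b : ℂ) (v w : Fin 2 → ℂ) :
    secondDeriv σ p q ω lam x (a • v + b • w) =
      a • secondDeriv σ p q ω lam x v + b • secondDeriv σ p q ω lam x w := by
  funext i
  simp only [secondDeriv, Pi.add_apply, Pi.smul_apply, smul_eq_mul]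
  ring

theorem IsSolution.deriv_add_smul (hf : IsSolution σ p q ω lam f) (hg : IsSolution σ p q ω lam g)
    (a b : ℂ) {x : ℝ} (hx : x ≠ 0) :
    HasDerivAt (fun t => a • f t + b • g t) (a • deriv f x + b • deriv g x) x :=
  ((hf.differentiableAt x hx).hasDerivAt.const_smul a).add
    ((hg.differentiableAt x hx).hasDerivAt.const_smul b)

theorem IsSolution.add_smul (hf : IsSolution σ p q ω lam f) (hg : IsSolution σ p q ω lam g)
    (a b : ℂ) : IsSolution σ p q ω lam fun x => a • f x + b • g x := by
  have e : ∀ x ≠ 0, deriv (fun t => a • f t + b • g t) =ᶠ[𝓝 x]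
      fun t => a • deriv f t + b • deriv g t := fun x hx => by
    filter_upwards [isOpen_ne.mem_nhds hx] with t ht
    exact (hf.deriv_add_smul hg a b ht).deriv
  have dd : ∀ x ≠ 0, HasDerivAt (deriv fun t => a • f t + b • g t)
      (a • deriv (deriv f) x + b • deriv (deriv g) x) x := fun x hx =>
    (((hf.differentiableAt_deriv x hx).hasDerivAt.const_smul a).add
      ((hg.differentiableAt_deriv x hx).hasDerivAt.const_smul b)).congr_of_eventuallyEq (e x hx)
  refine ⟨(hf.continuous.const_smul a).add (hg.continuous.const_smul b),
    fun x hx => (hf.deriv_add_smul hg a b hx).differentiableAt,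
    fun x hx => (dd x hx).differentiableAt, fun x hx => ?_, ?_⟩
  · rw [hamiltonian_eq_smul_iff, (dd x hx).deriv, secondDeriv_add_smul, hf.deriv_deriv hx,
      hg.deriv_deriv hx]
  · obtain ⟨r, s, fr, fs, frs⟩ := hf.jump
    obtain ⟨r', s', gr, gs, grs⟩ := hg.jump
    refine ⟨a • r + b • r', a • s + b • s', ?_, ?_, ?_⟩
    · refine ((fr.const_smul a).add (gr.const_smul b)).congr' ?_
      filter_upwards [self_mem_nhdsWithin] with t ht
      exact (hf.deriv_add_smul hg a b (ne_of_gt ht)).deriv.symm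
    · refine ((fs.const_smul a).add (gs.const_smul b)).congr' ?_
      filter_upwards [self_mem_nhdsWithin] with t ht
      exact (hf.deriv_add_smul hg a b (ne_of_lt ht)).deriv.symm
    · rw [smul_add, smul_comm (2 * q : ℂ) a, smul_comm (2 * q : ℂ) b, ← frs, ← grs]
      module

theorem wronskian_comm (f g : ℝ → Fin 2 → ℂ) : wronskian f g = -wronskian g f := by
  simp only [wronskian, wronskianAt, dotProduct, Fin.sum_univ_two]
  ring

theorem wronskian_self (f : ℝ → Fin 2 → ℂ) : wronskian f f = 0 := by
  simp only [wronskian, wronskianAt, dotProduct, Fin.sum_univ_two]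
  ring

theorem wronskian_add_smul_right (hf : IsSolution σ p q ω lam f) (hg : IsSolution σ p q ω lam g)
    (h : ℝ → Fin 2 → ℂ) (a b : ℂ) :
    wronskian h (fun x => a • f x + b • g x) = a * wronskian h f + b * wronskian h g := by
  simp only [wronskian, wronskianAt, (hf.deriv_add_smul hg a b one_ne_zero).deriv]
  simp only [dotProduct, Fin.sum_univ_two, Pi.add_apply, Pi.smul_apply, smul_eq_mul]
  ring

theorem wronskian_reflect (hf : IsSolution σ p q ω lam f) (hg : IsSolution σ p q ω lam g) :
    wronskian (fun x => f (-x)) (fun x => g (-x)) = -wronskian f g := by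
  rw [← hf.wronskianAt_eq hg (neg_ne_zero.2 one_ne_zero)]
  simp only [wronskian, wronskianAt, deriv_comp_neg, neg_dotProduct, dotProduct_neg]
  ring

/-- A solution with vanishing Cauchy data at some point is zero. -/
theorem IsSolution.eq_zero (hq : q < 0) (hp : 4 < p) (hω : AdmissibleFrequency σ q ω)
    (hu : IsSolution σ p q ω lam u) {x₀ : ℝ} (hx₀ : x₀ ≠ 0) (h0 : u x₀ = 0)
    (h1 : deriv u x₀ = 0) : u = 0 := by
  have hW : ∀ g, IsSolution σ p q ω lam g → ∀ x ≠ 0, wronskianAt u g x = 0 := fun g hg x hx => by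
    rw [hu.wronskianAt_eq hg hx, ← hu.wronskianAt_eq hg hx₀, wronskianAt, h0, h1]
    simp
  have key : ∀ x ≠ 0, u x = 0 := by
    intro x hx
    funext i
    -- Test against the solution with data `(0, eᵢ)`: there the vanishing Wronskian reads off `-u x
    -- i`. Since the Wronskian is the same on both sides of `0`, this continues `u = 0` across the
    -- delta; for `x < 0` the test solution is reflected.
    obtain ⟨g, Y, hg, hY0, -, hgY⟩ := exists_isSolution_of_pos hq hp hω lam |x|
      (Phase.mk 0 (Pi.single i 1))
    obtain ⟨e1, e2⟩ := hgY |x| (abs_pos.2 hx)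
    rw [hY0, Phase.mk_fst] at e1
    rw [hY0, Phase.mk_snd] at e2
    rcases lt_or_gt_of_ne hx with hneg | hpos
    · have := hW _ hg.reflect x hx
      rw [abs_of_neg hneg] at e1 e2
      simpa [wronskianAt, deriv_comp_neg, e1, e2] using this
    · have := hW _ hg x hx
      rw [abs_of_pos hpos] at e1 e2
      simpa [wronskianAt, e1, e2] using this
  exact hu.continuous.ext_on (dense_compl_singleton (0 : ℝ)) continuous_const fun x hx => key x hx

end Solutions

/-! ### Lagrangian planes of Cauchy data. -/

/-- The symplectic form `(u, u'), (v, v') ↦ u' · v - u · v'`. -/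
def symplecticForm : LinearMap.BilinForm ℂ ((Fin 2 → ℂ) × (Fin 2 → ℂ)) :=
  LinearMap.mk₂ ℂ (fun y z => y.2 ⬝ᵥ z.1 - y.1 ⬝ᵥ z.2)
    (fun _ _ _ => by simp only [Prod.fst_add, Prod.snd_add, add_dotProduct]; ring)
    (fun _ _ _ => by simp only [Prod.smul_fst, Prod.smul_snd, smul_dotProduct, smul_sub])
    (fun _ _ _ => by simp only [Prod.fst_add, Prod.snd_add, dotProduct_add]; ring)
    (fun _ _ _ => by simp only [Prod.smul_fst, Prod.smul_snd, dotProduct_smul, smul_sub])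

theorem symplecticForm_apply (y z : (Fin 2 → ℂ) × (Fin 2 → ℂ)) :
    symplecticForm y z = y.2 ⬝ᵥ z.1 - y.1 ⬝ᵥ z.2 := rfl

theorem symplecticForm_nondegenerate : symplecticForm.Nondegenerate := by
  constructor
  · intro y hy
    refine Prod.ext (funext fun i => ?_) (funext fun i => ?_)
    · simpa [symplecticForm_apply] using hy (0, Pi.single i 1)
    · simpa [symplecticForm_apply] using hy (Pi.single i 1, 0)
  · intro y hy
    refine Prod.ext (funext fun i => ?_) (funext fun i => ?_)
    · simpa [symplecticForm_apply] using hy (0, Pi.single i 1)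
    · simpa [symplecticForm_apply] using hy (Pi.single i 1, 0)

/-- A Lagrangian plane of the four-dimensional symplectic space is its own orthogonal. -/
theorem exists_eq_add_smul_of_symplecticForm_eq_zero {y z w : (Fin 2 → ℂ) × (Fin 2 → ℂ)}
    (hli : LinearIndependent ℂ ![y, z]) (hyz : symplecticForm y z = 0)
    (hy : symplecticForm y w = 0) (hz : symplecticForm z w = 0) : ∃ a b : ℂ, a • y + b • z = w := by
  set W := Submodule.span ℂ (Set.range ![y, z]) with hW
  have hdim : Module.finrank ℂ W = 2 := by
    simpa using finrank_span_eq_card hli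
  -- Dimension count: the orthogonal of a plane in dimension four has dimension `4 - 2 = 2`, so an
  -- isotropic plane, being contained in its orthogonal, equals it.
  have horth : Module.finrank ℂ (symplecticForm.orthogonal W) = 2 := by
    rw [LinearMap.BilinForm.finrank_orthogonal symplecticForm_nondegenerate, hdim]
    simp
  have hmem : ∀ v, symplecticForm y v = 0 → symplecticForm z v = 0 →
      v ∈ symplecticForm.orthogonal W := by
    intro v h1 h2 n hn
    rw [hW, Matrix.range_cons, Matrix.range_cons, Matrix.range_empty, Set.union_empty,
      Set.singleton_union, Submodule.mem_span_pair] at hn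
    obtain ⟨a, b, rfl⟩ := hn
    simp [h1, h2]
  have hself : ∀ v, symplecticForm v v = 0 := fun v => by
    simp only [symplecticForm_apply, dotProduct_comm, sub_self]
  have hanti : symplecticForm z y = 0 := by
    rw [symplecticForm_apply] at hyz ⊢
    rw [dotProduct_comm z.2, dotProduct_comm z.1]
    linear_combination -hyz
  have hle : W ≤ symplecticForm.orthogonal W := by
    rw [Submodule.span_le]
    rintro _ ⟨i, rfl⟩
    fin_cases i
    · exact hmem _ (hself _) hanti
    · exact hmem _ hyz (hself _)
  have heq : W = symplecticForm.orthogonal W :=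
    Submodule.eq_of_le_of_finrank_eq hle (by rw [hdim, horth])
  have := hmem w hy hz
  rw [← heq, hW, Matrix.range_cons, Matrix.range_cons, Matrix.range_empty, Set.union_empty,
      Set.singleton_union, Submodule.mem_span_pair] at this
  exact this

section Lagrangian

variable {σ p q ω lam : ℝ} {f g u : ℝ → Fin 2 → ℂ}

/-- Carries the Lagrangian argument from Cauchy data at `x = 1` to solutions; unique continuation
makes linear relations at that point valid on the whole line. -/
theorem IsSolution.exists_eq_add_smul (hq : q < 0) (hp : 4 < p) (hω : AdmissibleFrequency σ q ω)
    (hf : IsSolution σ p q ω lam f) (hg : IsSolution σ p q ω lam g)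
    (hu : IsSolution σ p q ω lam u)
    (hli : ∀ a b : ℂ, (∀ x, a • f x + b • g x = 0) → a = 0 ∧ b = 0)
    (hfg : wronskian f g = 0) (hfu : wronskian f u = 0) (hgu : wronskian g u = 0) :
    ∃ a b : ℂ, ∀ x, u x = a • f x + b • g x := by
  have hz : ∀ a b : ℂ, ∀ {v : ℝ → Fin 2 → ℂ}, IsSolution σ p q ω lam v →
      a • f 1 + b • g 1 = v 1 → a • deriv f 1 + b • deriv g 1 = deriv v 1 →
      ∀ x, v x = a • f x + b • g x := by
    intro a b v hv h0 h1 x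
    have hs := (hf.add_smul hg a b).add_smul hv 1 (-1)
    have := hs.eq_zero hq hp hω one_ne_zero (by rw [h0]; module) (by
      rw [((hf.add_smul hg a b).deriv_add_smul hv 1 (-1) one_ne_zero).deriv,
        (hf.deriv_add_smul hg a b one_ne_zero).deriv, h1]; module)
    have := congrFun this x
    simp only [Pi.zero_apply, one_smul, neg_smul] at this
    exact (add_neg_eq_zero.1 this).symm
  have hsol0 : IsSolution σ p q ω lam fun _ => 0 := by
    simpa using hf.add_smul hg 0 0
  obtain ⟨a, b, hab⟩ := exists_eq_add_smul_of_symplecticForm_eq_zero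
    (y := (f 1, deriv f 1)) (z := (g 1, deriv g 1)) (w := (u 1, deriv u 1))
    (LinearIndependent.pair_iff.2 fun a b hab => hli a b fun x =>
      (hz a b hsol0 (congrArg Prod.fst hab)
        ((congrArg Prod.snd hab).trans (by simp)) x).symm) hfg hfu hgu
  exact ⟨a, b, hz a b hu (congrArg Prod.fst hab) (congrArg Prod.snd hab)⟩

end Lagrangian

/-! ### Wronskians computed from asymptotics. -/

namespace IsAsymptoticTo

variable {σ p q ω lam : ℝ} {c d : ℂ} {a b : Fin 2 → ℂ} {f g : ℝ → Fin 2 → ℂ}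

/-- Lets `f₃` count as a solution of exponent `±iξ` with amplitude `0`, so that its Wronskians with
`f₁` and `f₂` fall under the case of opposite exponents. -/
theorem of_re_lt (hf : IsAsymptoticTo c a f) (hcd : c.re < d.re) : IsAsymptoticTo d 0 f := by
  have h0 : Tendsto (fun x : ℝ => Complex.exp (-((d - c) * x))) atTop (𝓝 0) := by
    rw [tendsto_zero_iff_norm_tendsto_zero]
    have : ∀ x : ℝ, ‖Complex.exp (-((d - c) * x))‖ = Real.exp (-((d.re - c.re) * x)) := fun x => by
      rw [Complex.norm_exp]; simp
    simp only [this]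
    exact tendsto_exp_neg_mul_atTop (sub_pos.2 hcd)
  have hs : ∀ x : ℝ, Complex.exp (-(d * x)) =
      Complex.exp (-((d - c) * x)) * Complex.exp (-(c * x)) := fun x => by
    rw [← Complex.exp_add]; congr 1; ring
  refine ⟨?_, ?_⟩
  · simpa only [hs, mul_smul, zero_smul] using h0.smul hf.tendsto
  · simpa only [hs, mul_smul, zero_smul, smul_zero] using h0.smul hf.tendsto_deriv

theorem add_smul (hf : IsAsymptoticTo c a f) (hg : IsAsymptoticTo c b g)
    (sf : IsSolution σ p q ω lam f) (sg : IsSolution σ p q ω lam g) (r s : ℂ) :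
    IsAsymptoticTo c (r • a + s • b) fun x => r • f x + s • g x := by
  refine ⟨?_, ?_⟩
  · refine ((hf.tendsto.const_smul r).add (hg.tendsto.const_smul s)).congr fun x => ?_
    module
  · have := (hf.tendsto_deriv.const_smul r).add (hg.tendsto_deriv.const_smul s)
    rw [show r • c • a + s • c • b = c • (r • a + s • b) by module] at this
    refine this.congr' ?_
    filter_upwards [eventually_gt_atTop 0] with x hx
    rw [(sf.deriv_add_smul sg r s hx.ne').deriv]
    module

theorem tendsto_dotProduct {l : Filter ℝ} {v w : ℝ → Fin 2 → ℂ} {v₀ w₀ : Fin 2 → ℂ}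
    (hv : Tendsto v l (𝓝 v₀)) (hw : Tendsto w l (𝓝 w₀)) :
    Tendsto (fun x => v x ⬝ᵥ w x) l (𝓝 (v₀ ⬝ᵥ w₀)) := by
  simp only [dotProduct]
  exact tendsto_finsetSum _ fun i _ => (tendsto_pi_nhds.1 hv i).mul (tendsto_pi_nhds.1 hw i)

/-- The two exponentials cancel, and the constant Wronskian equals its limit `(c a) · b - a · (-c
b)`. -/
theorem wronskian_eq (hf : IsAsymptoticTo c a f) (hg : IsAsymptoticTo (-c) b g)
    (sf : IsSolution σ p q ω lam f) (sg : IsSolution σ p q ω lam g) :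
    wronskian f g = 2 * c * (a ⬝ᵥ b) := by
  have h := (tendsto_dotProduct hf.tendsto_deriv hg.tendsto).sub
    (tendsto_dotProduct hf.tendsto hg.tendsto_deriv)
  have e : ∀ x : ℝ, Complex.exp (-(c * x)) * Complex.exp (-(-c * x)) = 1 := fun x => by
    rw [← Complex.exp_add, neg_mul, add_neg_cancel, Complex.exp_zero]
  have h2 : Tendsto (fun _ : ℝ => wronskian f g) atTop (𝓝 ((c • a) ⬝ᵥ b - a ⬝ᵥ (-c • b))) := by
    refine h.congr' ?_
    filter_upwards [eventually_gt_atTop 0] with x hx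
    rw [← sf.wronskianAt_eq sg hx.ne', wronskianAt]
    simp only [smul_dotProduct, dotProduct_smul, smul_eq_mul]
    linear_combination (deriv f x ⬝ᵥ g x - f x ⬝ᵥ deriv g x) * e x
  rw [tendsto_nhds_unique tendsto_const_nhds h2]
  simp only [smul_dotProduct, dotProduct_smul, smul_eq_mul]
  ring

theorem eq_zero (hf : IsAsymptoticTo c a f) (h : ∀ x, f x = 0) : a = 0 := by
  refine tendsto_nhds_unique hf.tendsto ?_
  simp [h]

end IsAsymptoticTo

/-! ### Square integrability and vanishing of Wronskians. -/

section SquareIntegrable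

/-- Otherwise `g ≥ ε` on a half-line of infinite measure. This supplies points where square
integrable data are small, without pointwise decay. -/
theorem frequently_lt_of_integrable {g : ℝ → ℝ} (hg : Integrable g) {ε : ℝ} (hε : 0 < ε) :
    ∃ᶠ x in atTop, g x < ε := by
  intro h
  obtain ⟨X, hX⟩ := eventually_atTop.1 h
  have h1 : IntegrableOn (fun _ : ℝ => ε) (Set.Ioi X) :=
    Integrable.mono' hg.integrableOn aestronglyMeasurable_const
      ((ae_restrict_iff' measurableSet_Ioi).2 (Eventually.of_forall fun x hx => by
        rw [Real.norm_of_nonneg hε.le]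
        exact not_lt.1 (hX x (le_of_lt hx))))
  rw [integrableOn_const_iff] at h1
  simp [hε.ne'] at h1

theorem norm_dotProduct_le (v w : Fin 2 → ℂ) : ‖v ⬝ᵥ w‖ ≤ 2 * (‖v‖ * ‖w‖) := by
  simp only [dotProduct, Fin.sum_univ_two]
  refine (norm_add_le _ _).trans ?_
  rw [norm_mul, norm_mul, two_mul]
  gcongr <;> exact norm_le_pi_norm _ _

theorem memLp_two_of_integrableOn_Ioi {h : ℝ → Fin 2 → ℂ} (hm : AEStronglyMeasurable h volume)
    (h₁ : IntegrableOn (fun x => ‖h x‖ ^ 2) (Set.Ioi 0))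
    (h₂ : IntegrableOn (fun x => ‖h (-x)‖ ^ 2) (Set.Ioi 0)) : MemLp h 2 := by
  have h3 : IntegrableOn (fun x => ‖h x‖ ^ 2) (Set.Iio 0) := by
    have := (Measure.measurePreserving_neg (volume : Measure ℝ)).integrableOn_comp_preimage
      (MeasurableEquiv.neg ℝ).measurableEmbedding (f := fun x => ‖h x‖ ^ 2) (s := Set.Iio 0)
    rw [← this]
    simpa [Function.comp_def] using h₂
  have h4 : Integrable fun x => ‖h x‖ ^ 2 := by
    rw [← integrableOn_univ, ← Set.Iic_union_Ioi (a := (0 : ℝ))]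
    exact IntegrableOn.union (by rwa [integrableOn_Iic_iff_integrableOn_Iio]) h₁
  refine memLp_pi_iff.2 fun i => ?_
  have hmi : AEStronglyMeasurable (fun x => h x i) volume :=
    (continuous_apply i).comp_aestronglyMeasurable hm
  refine (memLp_two_iff_integrable_sq_norm hmi).2 (Integrable.mono' h4 (hmi.norm.pow 2)
    (Eventually.of_forall fun x => ?_))
  rw [Real.norm_of_nonneg (by positivity)]
  gcongr
  exact norm_le_pi_norm _ i

theorem integrable_norm_sq {h : ℝ → Fin 2 → ℂ} (hh : MemLp h 2) :
    Integrable fun x => ‖h x‖ ^ 2 := by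
  simpa using hh.integrable_norm_pow (by norm_num)

theorem integrableOn_Ioi_zero_of_bounded {h : ℝ → Fin 2 → ℂ} (hm : AEStronglyMeasurable h volume)
    {X K : ℝ} (hX : 0 ≤ X) (hK : ∀ x, 0 < x → x ≤ X → ‖h x‖ ≤ K)
    (hi : IntegrableOn (fun x => ‖h x‖ ^ 2) (Set.Ioi X)) :
    IntegrableOn (fun x => ‖h x‖ ^ 2) (Set.Ioi 0) := by
  rw [← Set.Ioc_union_Ioi_eq_Ioi hX]
  refine IntegrableOn.union ?_ hi
  refine Measure.integrableOn_of_bounded (M := K ^ 2) (by simp) (hm.norm.pow 2)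
    ((ae_restrict_iff' measurableSet_Ioc).2 (Eventually.of_forall fun x hx => ?_))
  rw [Real.norm_of_nonneg (by positivity)]
  gcongr
  exact hK x hx.1 hx.2

end SquareIntegrable

section Bounds

variable {σ p q ω lam : ℝ} {c : ℂ} {a : Fin 2 → ℂ} {f g u : ℝ → Fin 2 → ℂ}

theorem eventually_norm_le_exp {v : ℝ → Fin 2 → ℂ}
    (h : Tendsto (fun x : ℝ => Complex.exp (-(c * x)) • v x) atTop (𝓝 a)) :
    ∀ᶠ x : ℝ in atTop, ‖v x‖ ≤ (‖a‖ + 1) * Real.exp (c.re * x) := by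
  filter_upwards [h.norm.eventually (gt_mem_nhds (lt_add_one ‖a‖))] with x hx
  have e : v x = Complex.exp (c * x) • Complex.exp (-(c * x)) • v x := by
    rw [smul_smul, ← Complex.exp_add, add_neg_cancel, Complex.exp_zero, one_smul]
  have hn : ‖Complex.exp (c * x)‖ = Real.exp (c.re * x) := by
    rw [Complex.norm_exp]; simp
  rw [e, norm_smul, hn, mul_comm]
  gcongr

theorem eventually_norm_le_const {v : ℝ → Fin 2 → ℂ} (hc : c.re ≤ 0)
    (h : Tendsto (fun x : ℝ => Complex.exp (-(c * x)) • v x) atTop (𝓝 a)) :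
    ∀ᶠ x : ℝ in atTop, ‖v x‖ ≤ ‖a‖ + 1 := by
  filter_upwards [eventually_norm_le_exp h, eventually_ge_atTop 0] with x hx h0
  refine hx.trans (mul_le_of_le_one_right (by positivity) (Real.exp_le_one_iff.2 ?_))
  exact mul_nonpos_of_nonpos_of_nonneg hc h0

theorem IsAsymptoticTo.exists_norm_le (h : IsAsymptoticTo c a u) (hc : c.re ≤ 0)
    (hu : Continuous u) : ∃ B, ∀ x, 0 ≤ x → ‖u x‖ ≤ B := by
  obtain ⟨X, hX⟩ := eventually_atTop.1 (eventually_norm_le_const hc h.tendsto)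
  obtain ⟨K, hK⟩ := isCompact_Icc.exists_bound_of_continuousOn (hu.continuousOn (s := Set.Icc 0 X))
  refine ⟨max K (‖a‖ + 1), fun x hx => ?_⟩
  rcases le_total x X with h | h
  · exact (hK x ⟨hx, h⟩).trans (le_max_left _ _)
  · exact (hX x h).trans (le_max_right _ _)

/-- The jump condition provides a one-sided limit of `u'` at `0`, so after redefinition there `u'`
is continuous up to the boundary and bounded on compact sets. -/
theorem IsSolution.continuousOn_update_deriv (hu : IsSolution σ p q ω lam u) {r : Fin 2 → ℂ}
    (hr : Tendsto (deriv u) (𝓝[>] 0) (𝓝 r)) :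
    ContinuousOn (Function.update (deriv u) 0 r) (Set.Ici 0) := by
  intro x hx
  rcases eq_or_lt_of_le (show 0 ≤ x from hx) with rfl | hx
  · rw [continuousWithinAt_update_same]
    refine hr.mono_left (nhdsWithin_mono _ ?_)
    rintro y ⟨hy, hy0⟩
    exact lt_of_le_of_ne hy (Ne.symm hy0)
  · exact ((continuousAt_update_of_ne hx.ne').2
      (hu.differentiableAt_deriv x hx.ne').continuousAt).continuousWithinAt

theorem IsSolution.exists_norm_deriv_le (hu : IsSolution σ p q ω lam u) (X : ℝ) :
    ∃ K, ∀ x, 0 < x → x ≤ X → ‖deriv u x‖ ≤ K := by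
  obtain ⟨r, _, hr, -, -⟩ := hu.jump
  obtain ⟨K, hK⟩ := isCompact_Icc.exists_bound_of_continuousOn
    ((hu.continuousOn_update_deriv hr).mono (fun y hy => hy.1 : Set.Icc 0 X ⊆ Set.Ici 0))
  refine ⟨K, fun x h0 h1 => ?_⟩
  simpa [Function.update_of_ne h0.ne'] using hK x ⟨h0.le, h1⟩

theorem deriv_reflect (u : ℝ → Fin 2 → ℂ) :
    deriv (fun x => u (-x)) = fun x => -deriv u (-x) := by
  funext x
  exact deriv_comp_neg u x

theorem aestronglyMeasurable_deriv_pi (u : ℝ → Fin 2 → ℂ) :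
    AEStronglyMeasurable (deriv u) volume :=
  aestronglyMeasurable_deriv u volume

theorem integrableOn_exp_mul_sq {b : ℝ} (hb : b < 0) (K X : ℝ) :
    IntegrableOn (fun x => (K * Real.exp (b * x)) ^ 2) (Set.Ioi X) := by
  have := (exp_neg_integrableOn_Ioi X (by linarith : 0 < -(2 * b))).const_mul (K ^ 2)
  refine this.congr (Eventually.of_forall fun x => ?_)
  simp only [mul_pow, ← Real.exp_nat_mul]
  congr 2
  push_cast
  ring

theorem IsSolution.integrableOn_of_decay (hu : IsSolution σ p q ω lam u)
    (h : IsAsymptoticTo c a u) (hc : c.re < 0) :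
    IntegrableOn (fun x => ‖u x‖ ^ 2) (Set.Ioi 0) ∧
      IntegrableOn (fun x => ‖deriv u x‖ ^ 2) (Set.Ioi 0) := by
  have key : ∀ {v : ℝ → Fin 2 → ℂ} {b : Fin 2 → ℂ}, AEStronglyMeasurable v volume →
      (∀ X, ∃ K, ∀ x, 0 < x → x ≤ X → ‖v x‖ ≤ K) →
      Tendsto (fun x : ℝ => Complex.exp (-(c * x)) • v x) atTop (𝓝 b) →
      IntegrableOn (fun x => ‖v x‖ ^ 2) (Set.Ioi 0) := by
    intro v b hm hb hv
    obtain ⟨X, hX⟩ := eventually_atTop.1 ((eventually_norm_le_exp hv).and (eventually_ge_atTop 0))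
    obtain ⟨K, hK⟩ := hb X
    refine integrableOn_Ioi_zero_of_bounded hm (hX X le_rfl).2 hK ?_
    refine Integrable.mono' (integrableOn_exp_mul_sq hc (‖b‖ + 1) X) (hm.norm.pow 2).restrict
      ((ae_restrict_iff' measurableSet_Ioi).2 (Eventually.of_forall fun x hx => ?_))
    rw [Real.norm_of_nonneg (by positivity)]
    gcongr
    exact (hX x (le_of_lt hx)).1
  refine ⟨key hu.continuous.aestronglyMeasurable (fun X => ?_) h.tendsto,
    key (aestronglyMeasurable_deriv_pi u) hu.exists_norm_deriv_le h.tendsto_deriv⟩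
  obtain ⟨B, hB⟩ := h.exists_norm_le hc.le hu.continuous
  exact ⟨B, fun x h0 _ => hB x h0.le⟩

theorem IsSolution.wronskian_eq_zero_of_frequently (hf : IsSolution σ p q ω lam f)
    (hg : IsSolution σ p q ω lam g) {K : ℝ}
    (h : ∀ ε > 0, ∃ᶠ x in atTop, ‖wronskianAt f g x‖ ≤ K * ε) : wronskian f g = 0 := by
  by_contra hne
  have hpos : 0 < ‖wronskian f g‖ := norm_pos_iff.2 hne
  have hle : ∀ ε > 0, ‖wronskian f g‖ ≤ K * ε := fun ε hε => by
    obtain ⟨x, hx, h0⟩ := ((h ε hε).and_eventually (eventually_gt_atTop 0)).exists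
    rwa [hf.wronskianAt_eq hg h0.ne'] at hx
  have hK : 0 < K := by
    have := hle 1 one_pos
    linarith
  have h1 := hle (‖wronskian f g‖ / (2 * K)) (by positivity)
  have h2 : K * (‖wronskian f g‖ / (2 * K)) = ‖wronskian f g‖ / 2 := by field_simp
  linarith

/-- Integrability of `‖u‖² + ‖u'‖²` makes `u` and `u'` small at the same points, arbitrarily far
out, while `g` and `g'` stay bounded. -/
theorem IsSolution.wronskian_eq_zero_of_memLp (hu : IsSolution σ p q ω lam u)
    (hg : IsSolution σ p q ω lam g) (hg' : IsAsymptoticTo c a g) (hc : c.re ≤ 0)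
    (h₀ : MemLp u 2) (h₁ : MemLp (deriv u) 2) : wronskian u g = 0 := by
  refine hu.wronskian_eq_zero_of_frequently hg (K := 2 * (‖a‖ + 1) + 2 * (‖c • a‖ + 1))
    fun ε hε => ?_
  have hfr := frequently_lt_of_integrable ((integrable_norm_sq h₀).add (integrable_norm_sq h₁))
    (by positivity : 0 < ε ^ 2)
  refine (hfr.and_eventually ((eventually_norm_le_const hc hg'.tendsto).and
    (eventually_norm_le_const hc hg'.tendsto_deriv))).mono ?_
  rintro x ⟨hx, k₀, k₁⟩
  simp only [Pi.add_apply] at hx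
  have e0 : ‖u x‖ ≤ ε := abs_le_of_sq_le_sq' (by nlinarith [sq_nonneg ‖deriv u x‖]) hε.le |>.2
  have e1 : ‖deriv u x‖ ≤ ε := abs_le_of_sq_le_sq' (by nlinarith [sq_nonneg ‖u x‖]) hε.le |>.2
  calc _ ≤ ‖deriv u x ⬝ᵥ g x‖ + ‖u x ⬝ᵥ deriv g x‖ := norm_sub_le _ _
    _ ≤ 2 * (ε * (‖a‖ + 1)) + 2 * (ε * (‖c • a‖ + 1)) := by
        refine add_le_add ((norm_dotProduct_le _ _).trans ?_) ((norm_dotProduct_le _ _).trans ?_)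
        all_goals gcongr
    _ = _ := by ring

/-- Threshold variant: `u` is only bounded, and the smallness of the term `u · g'` comes from `g' →
0`. -/
theorem IsSolution.wronskian_eq_zero_of_bounded (hu : IsSolution σ p q ω lam u)
    (hg : IsSolution σ p q ω lam g) (hg' : IsAsymptoticTo c a g) (hc : c.re ≤ 0)
    (hd : Tendsto (deriv g) atTop (𝓝 0)) {B : ℝ}
    (h₀ : ∀ x, ‖u x‖ ≤ B) (h₁ : MemLp (deriv u) 2) : wronskian u g = 0 := by
  have hB : 0 ≤ B := (norm_nonneg _).trans (h₀ 0)
  refine hu.wronskian_eq_zero_of_frequently hg (K := 2 * (‖a‖ + 1) + 2 * B) fun ε hε => ?_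
  have hfr := frequently_lt_of_integrable (integrable_norm_sq h₁) (by positivity : 0 < ε ^ 2)
  have hd' : ∀ᶠ x in atTop, ‖deriv g x‖ < ε := by
    have := hd.norm
    rw [norm_zero] at this
    exact this.eventually (gt_mem_nhds hε)
  refine (hfr.and_eventually ((eventually_norm_le_const hc hg'.tendsto).and hd')).mono ?_
  rintro x ⟨hx, k₀, k₁⟩
  have e1 : ‖deriv u x‖ ≤ ε := abs_le_of_sq_le_sq' hx.le hε.le |>.2
  calc _ ≤ ‖deriv u x ⬝ᵥ g x‖ + ‖u x ⬝ᵥ deriv g x‖ := norm_sub_le _ _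
    _ ≤ 2 * (ε * (‖a‖ + 1)) + 2 * (B * ε) := by
        refine add_le_add ((norm_dotProduct_le _ _).trans ?_) ((norm_dotProduct_le _ _).trans ?_)
        · gcongr
        · gcongr
          exact h₀ x
    _ = _ := by ring

end Bounds

/-! ### Energy estimate at the threshold. -/

section Energy

variable {σ p q ω : ℝ} {a : Fin 2 → ℂ} {u : ℝ → Fin 2 → ℂ}

theorem norm_sq_le_sum (v : Fin 2 → ℂ) :
    ‖v‖ ^ 2 ≤ (v 0).re ^ 2 + (v 0).im ^ 2 + ((v 1).re ^ 2 + (v 1).im ^ 2) := by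
  have h : ‖v‖ ≤ √((v 0).re ^ 2 + (v 0).im ^ 2 + ((v 1).re ^ 2 + (v 1).im ^ 2)) := by
    refine (pi_norm_le_iff_of_nonneg (Real.sqrt_nonneg _)).2 fun i => ?_
    rw [Complex.norm_eq_sqrt_sq_add_sq]
    apply Real.sqrt_le_sqrt
    fin_cases i
    · simp; positivity
    · simp; positivity
  calc _ ≤ _ := pow_le_pow_left₀ (norm_nonneg _) h 2
    _ = _ := Real.sq_sqrt (by positivity)

theorem sum_le_norm_sq (v : Fin 2 → ℂ) :
    (v 0).re ^ 2 + (v 0).im ^ 2 + ((v 1).re ^ 2 + (v 1).im ^ 2) ≤ 2 * ‖v‖ ^ 2 := by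
  have h : ∀ i, (v i).re ^ 2 + (v i).im ^ 2 ≤ ‖v‖ ^ 2 := fun i => by
    have : (v i).re ^ 2 + (v i).im ^ 2 = ‖v i‖ ^ 2 := by
      rw [Complex.sq_norm, Complex.normSq_apply]; ring
    rw [this]
    gcongr
    exact norm_le_pi_norm v i
  linarith [h 0, h 1]

/-- A solution at the threshold `lam = ω` that is bounded, together with its derivative, has a
square integrable derivative. -/
theorem IsSolution.integrableOn_deriv_of_threshold (hq : q < 0) (hp : 4 < p)
    (hω : AdmissibleFrequency σ q ω) (hu : IsSolution σ p q ω ω u) (h : IsAsymptoticTo 0 a u) :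
    IntegrableOn (fun x => ‖deriv u x‖ ^ 2) (Set.Ioi 0) := by
  have hω0 := (exists_soliton_eq_rpow hq hp hω).1
  obtain ⟨C, k, hk, hC⟩ := exists_scalarPotential_le hq hp hω
  obtain ⟨B, hB⟩ := h.exists_norm_le (by simp) hu.continuous
  obtain ⟨K, hK⟩ := hu.exists_norm_deriv_le 1
  refine integrableOn_Ioi_zero_of_bounded (aestronglyMeasurable_deriv_pi u) zero_le_one hK ?_
  -- The coupling `[p+2, p; p, p+2]` has eigenvalues `2` and `2p + 2`, and the Euclidean norm
  -- squared of `u` is at most `2 B²`. So the potential term is at most `M e^{-kx}` in absolute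
  -- value.
  set M : ℝ := 4 * (p + 1) * B ^ 2 * C with hM
  let e : ℝ → Fin 2 → ℝ := fun x i =>
    (u x i).re * (deriv u x i).re + (u x i).im * (deriv u x i).im
  let e' : ℝ → Fin 2 → ℝ := fun x i =>
    ((deriv u x i).re ^ 2 + (deriv u x i).im ^ 2) +
      ((u x i).re * (deriv (deriv u) x i).re + (u x i).im * (deriv (deriv u) x i).im)
  have he : ∀ x, 0 < x → ∀ i, HasDerivAt (fun x => e x i) (e' x i) x := by
    intro x hx i
    have u0 := hasDerivAt_pi.1 (hu.differentiableAt x hx.ne').hasDerivAt i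
    have u1 := hasDerivAt_pi.1 (hu.differentiableAt_deriv x hx.ne').hasDerivAt i
    have r0 := Complex.reCLM.hasFDerivAt.comp_hasDerivAt x u0
    have i0 := Complex.imCLM.hasFDerivAt.comp_hasDerivAt x u0
    have r1 := Complex.reCLM.hasFDerivAt.comp_hasDerivAt x u1
    have i1 := Complex.imCLM.hasFDerivAt.comp_hasDerivAt x u1
    refine ((r0.mul r1).add (i0.mul i1)).congr_deriv ?_
    simp only [e', Complex.reCLM_apply, Complex.imCLM_apply, Function.comp_apply]
    ring
  -- At `lam = ω`, `(Re ū · u')' = |u'|² + 4ω|u₁|² + (potential term)`, where `u₁` is the second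
  -- component. The exponential correction absorbs the last term, so `G' ≥ ‖u'‖²`; since `G` has a
  -- limit, `G'` is integrable.
  let G : ℝ → ℝ := fun x => e x 0 + e x 1 - M / k * Real.exp (-(k * x))
  let G' : ℝ → ℝ := fun x => e' x 0 + e' x 1 + M * Real.exp (-(k * x))
  have hG : ∀ x, 0 < x → HasDerivAt G (G' x) x := by
    intro x hx
    have h1 : HasDerivAt (fun x => M / k * Real.exp (-(k * x))) (-(M * Real.exp (-(k * x)))) x := by
      have := (((hasDerivAt_id x).const_mul k).neg.exp).const_mul (M / k)
      convert! this using 1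
      simp; field_simp
    refine (((he x hx 0).add (he x hx 1)).sub h1).congr_deriv ?_
    simp only [G']
    ring
  have hbound : ∀ x, 0 < x → ‖deriv u x‖ ^ 2 ≤ G' x := by
    intro x hx
    refine (norm_sq_le_sum _).trans ?_
    have hV := hC x
    rw [abs_of_pos hx] at hV
    have d0 := hu.deriv_deriv_eq hx.ne' 0
    have d1 := hu.deriv_deriv_eq hx.ne' 1
    have hS := sum_le_norm_sq (u x)
    have hBx : ‖u x‖ ^ 2 ≤ B ^ 2 := pow_le_pow_left₀ (norm_nonneg _) (hB x hx.le) 2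
    change |σ * soliton σ p q ω x ^ p| ≤ _ at hV
    set V : ℝ := σ * soliton σ p q ω x ^ p with hVdef
    set E := Real.exp (-(k * x)) with hE
    simp only [G', e', d0, d1]
    simp only [pauli3, Fin.isValue, sub_zero, sub_self, Matrix.of_apply, Matrix.cons_val_zero,
      Matrix.cons_val_one, Matrix.cons_val', Complex.mul_re, Complex.mul_im, Complex.add_re,
      Complex.add_im, Complex.sub_re, Complex.sub_im, Complex.ofReal_re, Complex.ofReal_im,
      Complex.div_ofNat_re, Complex.div_ofNat_im, Complex.re_ofNat, Complex.im_ofNat,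
      Complex.neg_re, Complex.neg_im, zero_mul, add_zero, sub_zero, mul_one, zero_div, mul_neg,
      neg_zero]
    set r0 := (u x 0).re
    set s0 := (u x 0).im
    set r1 := (u x 1).re
    set s1 := (u x 1).im
    set T := (p + 2) * (r0 ^ 2 + s0 ^ 2 + (r1 ^ 2 + s1 ^ 2)) + 2 * p * (r0 * r1 + s0 * s1) with hT
    have hS' : r0 ^ 2 + s0 ^ 2 + (r1 ^ 2 + s1 ^ 2) ≤ 2 * B ^ 2 := by linarith
    have hT0 : 0 ≤ T := by
      nlinarith [sq_nonneg (r0 + r1), sq_nonneg (s0 + s1), sq_nonneg r0, sq_nonneg s0,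
        sq_nonneg r1, sq_nonneg s1]
    have hT1 : T ≤ 4 * (p + 1) * B ^ 2 := by
      nlinarith [sq_nonneg (r0 - r1), sq_nonneg (s0 - s1)]
    have hVT : -(M * E) ≤ V * T := by
      have h1 : |V| * T ≤ C * E * (4 * (p + 1) * B ^ 2) :=
        mul_le_mul hV hT1 hT0 ((abs_nonneg _).trans hV)
      have h2 : -|V| * T ≤ V * T := mul_le_mul_of_nonneg_right (neg_abs_le V) hT0
      have h3 : M * E = C * E * (4 * (p + 1) * B ^ 2) := by rw [hM]; ring
      linarith
    have hpos : 0 ≤ 4 * ω * (r1 ^ 2 + s1 ^ 2) := by positivity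
    nlinarith
  have hlim : Tendsto G atTop (𝓝 (0 + 0 - M / k * 0)) := by
    have t0 := h.tendsto
    have t1 := h.tendsto_deriv
    simp only [zero_mul, neg_zero, Complex.exp_zero, one_smul, zero_smul] at t0 t1
    have ht : ∀ i, Tendsto (fun x => e x i) atTop (𝓝 0) := fun i => by
      have a0 := tendsto_pi_nhds.1 t0 i
      have a1 := tendsto_pi_nhds.1 t1 i
      have := (((Complex.continuous_re.tendsto _).comp a0).mul
        ((Complex.continuous_re.tendsto _).comp a1)).add
        (((Complex.continuous_im.tendsto _).comp a0).mul
        ((Complex.continuous_im.tendsto _).comp a1))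
      simpa using this
    exact ((ht 0).add (ht 1)).sub ((tendsto_exp_neg_mul_atTop hk).const_mul (M / k))
  have hGi : IntegrableOn G' (Set.Ioi 1) := integrableOn_Ioi_deriv_of_nonneg'
    (fun x hx => hG x (lt_of_lt_of_le one_pos hx))
    (fun x hx => (sq_nonneg _).trans (hbound x (one_pos.trans hx))) hlim
  refine Integrable.mono' hGi ((aestronglyMeasurable_deriv_pi u).norm.pow 2).restrict
    ((ae_restrict_iff' measurableSet_Ioi).2 (Eventually.of_forall fun x hx => ?_))
  rw [Real.norm_of_nonneg (by positivity)]
  exact hbound x (one_pos.trans hx)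

end Energy

/-! ### Eigenfunctions as solutions in the operator domain. -/

section Domain

variable {σ p q ω lam : ℝ} {u : ℝ → Fin 2 → ℂ}

theorem continuous_secondDeriv (hq : q < 0) (hp : 4 < p) (hω : AdmissibleFrequency σ q ω)
    (hu : Continuous u) (i : Fin 2) :
    Continuous fun x => secondDeriv σ p q ω lam x (u x) i := by
  have hV := continuous_scalarPotential hq hp hω
  unfold secondDeriv
  fun_prop

theorem exists_norm_secondDeriv_le (hq : q < 0) (hp : 4 < p) (hω : AdmissibleFrequency σ q ω)
    (lam : ℝ) : ∃ K, ∀ x v i, ‖secondDeriv σ p q ω lam x v i‖ ≤ K * ‖v‖ := by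
  obtain ⟨K, hK⟩ := exists_norm_generator_le hq hp hω lam
  refine ⟨K, fun x v i => ?_⟩
  have h2 := (generator σ p q ω lam x).le_of_opNorm_le (hK x) (Phase.mk v 0)
  rw [Phase.norm_mk_zero, generator_apply, Phase.mk_fst] at h2
  refine le_trans ?_ h2
  refine le_trans (norm_le_pi_norm (secondDeriv σ p q ω lam x v) i) ?_
  exact Phase.norm_snd_le (Phase.mk _ (secondDeriv σ p q ω lam x v))

theorem intervalIntegrable_of_memLp_two {v : ℝ → ℂ} (hv : MemLp v 2) (a b : ℝ) :
    IntervalIntegrable v volume a b :=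
  ⟨(hv.restrict _).integrable (by norm_num), (hv.restrict _).integrable (by norm_num)⟩

theorem IsSolution.deriv_eq_add_integral (hq : q < 0) (hp : 4 < p)
    (hω : AdmissibleFrequency σ q ω) (hu : IsSolution σ p q ω lam u) {r : Fin 2 → ℂ}
    (hr : Tendsto (deriv u) (𝓝[>] 0) (𝓝 r)) (i : Fin 2) {x : ℝ} (hx : 0 < x) :
    deriv u x i = r i + ∫ t in (0 : ℝ)..x, secondDeriv σ p q ω lam t (u t) i := by
  have hc := hu.continuousOn_update_deriv hr
  have := intervalIntegral.integral_eq_sub_of_hasDerivAt_of_le hx.le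
    (f := fun t => Function.update (deriv u) 0 r t i)
    (f' := fun t => secondDeriv σ p q ω lam t (u t) i)
    ((continuous_apply i).comp_continuousOn (hc.mono fun y hy => hy.1))
    (fun t ht => ?_) ((continuous_secondDeriv hq hp hω hu.continuous i).intervalIntegrable _ _)
  · rw [this]
    simp [Function.update_of_ne hx.ne']
  · have h1 := hasDerivAt_pi.1 (hu.differentiableAt_deriv t ht.1.ne').hasDerivAt i
    rw [hu.deriv_deriv ht.1.ne'] at h1
    refine h1.congr_of_eventuallyEq ?_
    filter_upwards [lt_mem_nhds ht.1] with s hs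
    rw [Function.update_of_ne (ne_of_gt hs)]

theorem IsSolution.isEigenvalue (hq : q < 0) (hp : 4 < p) (hω : AdmissibleFrequency σ q ω)
    (hu : IsSolution σ p q ω lam u) (hne : u ≠ 0) (h₀ : MemLp u 2) (h₁ : MemLp (deriv u) 2) :
    IsEigenvalue σ p q ω lam := by
  refine ⟨u, deriv u, fun x => secondDeriv σ p q ω lam x (u x), fun i => ?_, fun hae => hne ?_,
    Eventually.of_forall fun x => hamiltonian_eq_smul_iff.2 rfl⟩
  · obtain ⟨r, s, hr, hs, hrs⟩ := hu.jump
    obtain ⟨K, hK⟩ := exists_norm_secondDeriv_le hq hp hω lam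
    refine ⟨memLp_pi_iff.1 h₀ i, memLp_pi_iff.1 h₁ i, ?_, fun x => ?_, r i, s i,
      fun x hx => hu.deriv_eq_add_integral hq hp hω hr i hx, fun x hx => ?_, ?_⟩
    · exact MemLp.of_le_mul h₀
        (continuous_secondDeriv hq hp hω hu.continuous i).aestronglyMeasurable
        (Eventually.of_forall fun x => hK x (u x) i)
    · rw [integral_eq_of_hasDerivAt_off_countable (fun x => u x i) (fun x => deriv u x i)
        (Set.countable_singleton (0 : ℝ))
        ((continuous_apply i).comp hu.continuous).continuousOn
        (fun t ht => hasDerivAt_pi.1 (hu.differentiableAt t ht.2).hasDerivAt i)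
        (intervalIntegrable_of_memLp_two (memLp_pi_iff.1 h₁ i) _ _)]
      ring
    -- The left half-line follows from the right one applied to the reflected solution, as the
    -- potential is even.
    · have hs' : Tendsto (deriv fun x => u (-x)) (𝓝[>] 0) (𝓝 (-s)) := by
        rw [deriv_reflect]
        refine (hs.comp ?_).neg
        have := tendsto_neg_nhdsGT (a := (0 : ℝ))
        rwa [neg_zero] at this
      have h1 := hu.reflect.deriv_eq_add_integral hq hp hω hs' i (neg_pos.2 hx)
      have h2 := intervalIntegral.integral_comp_neg (a := 0) (b := -x)
        (fun t => secondDeriv σ p q ω lam t (u t) i)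
      have h3 : ∀ t v, secondDeriv σ p q ω lam (-t) v i = secondDeriv σ p q ω lam t v i :=
        fun t v => by simp only [secondDeriv, scalarPotential, soliton_neg]
      simp only [h3, neg_neg, neg_zero] at h2
      rw [deriv_reflect, h2, intervalIntegral.integral_symm] at h1
      simp only [neg_neg, Pi.neg_apply] at h1
      linear_combination -h1
    · have := congrFun hrs i
      simpa using this
  · exact (Continuous.ae_eq_iff_eq volume hu.continuous continuous_const).1 hae

/-- Regularity: the equation identifies `u₂` almost everywhere with a continuous function of `x`, so
the integral formulas for `u₁` and `u` upgrade to classical derivatives away from `0`. Only the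
value of `u₁` at `0` remains arbitrary. -/
theorem IsEigenvalue.exists_isSolution (hq : q < 0) (hp : 4 < p) (hω : AdmissibleFrequency σ q ω)
    (h : IsEigenvalue σ p q ω lam) :
    ∃ u, IsSolution σ p q ω lam u ∧ u ≠ 0 ∧ MemLp u 2 ∧ MemLp (deriv u) 2 := by
  obtain ⟨u, u₁, u₂, hdom, hne, hae⟩ := h
  have h_int : ∀ i a b, IntervalIntegrable (fun x => u₁ x i) volume a b := fun i a b =>
    intervalIntegrable_of_memLp_two (hdom i).memLp_fst a b
  have hcont : Continuous u := continuous_pi fun i => by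
    have h1 : (fun x => u x i) = fun x => u 0 i + ∫ t in (0 : ℝ)..x, u₁ t i :=
      funext (hdom i).eq_integral
    rw [h1]
    exact continuous_const.add (intervalIntegral.continuous_primitive (h_int i) 0)
  have hw : ∀ i, Continuous fun x => secondDeriv σ p q ω lam x (u x) i := fun i =>
    continuous_secondDeriv hq hp hω hcont i
  have hu₂ : ∀ i x, ∫ t in (0 : ℝ)..x, u₂ t i =
      ∫ t in (0 : ℝ)..x, secondDeriv σ p q ω lam t (u t) i := fun i x => by
    refine intervalIntegral.integral_congr_ae ?_
    filter_upwards [hae] with t ht _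
    rw [hamiltonian_eq_smul_iff.1 ht]
  choose a b ha hb hab using fun i => (hdom i).jump
  simp only [hu₂] at ha hb
  have hprim : ∀ i x, HasDerivAt (fun x => ∫ t in (0 : ℝ)..x, secondDeriv σ p q ω lam t (u t) i)
      (secondDeriv σ p q ω lam x (u x) i) x := fun i x =>
    intervalIntegral.integral_hasDerivAt_right ((hw i).intervalIntegrable _ _)
      ((hw i).stronglyMeasurableAtFilter _ _) (hw i).continuousAt
  have d1 : ∀ x ≠ 0, HasDerivAt u₁ (secondDeriv σ p q ω lam x (u x)) x := by
    refine fun x hx => hasDerivAt_pi.2 fun i => ?_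
    rcases lt_or_gt_of_ne hx with h | h
    · refine ((hprim i x).const_add (b i)).congr_of_eventuallyEq ?_
      filter_upwards [gt_mem_nhds h] with t ht using hb i t ht
    · refine ((hprim i x).const_add (a i)).congr_of_eventuallyEq ?_
      filter_upwards [lt_mem_nhds h] with t ht using ha i t ht
  have d0 : ∀ x ≠ 0, HasDerivAt u (u₁ x) x := by
    refine fun x hx => hasDerivAt_pi.2 fun i => ?_
    have h1 := (intervalIntegral.integral_hasDerivAt_right (h_int i 0 x)
      ((hdom i).memLp_fst.aestronglyMeasurable.stronglyMeasurableAtFilter)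
      (hasDerivAt_pi.1 (d1 x hx) i).continuousAt).const_add (u 0 i)
    exact h1.congr_of_eventuallyEq (Eventually.of_forall (hdom i).eq_integral)
  have hev : ∀ x ≠ 0, deriv u =ᶠ[𝓝 x] u₁ := fun x hx => by
    filter_upwards [isOpen_ne.mem_nhds hx] with t ht using (d0 t ht).deriv
  have d1' : ∀ x ≠ 0, HasDerivAt (deriv u) (secondDeriv σ p q ω lam x (u x)) x := fun x hx =>
    (d1 x hx).congr_of_eventuallyEq (hev x hx)
  have hzero : ∀ i, Tendsto (fun x => ∫ t in (0 : ℝ)..x, secondDeriv σ p q ω lam t (u t) i) (𝓝 0)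
      (𝓝 0) := fun i => by
    have := (hprim i 0).continuousAt
    simpa [ContinuousAt] using this
  have hsol : IsSolution σ p q ω lam u := by
    refine ⟨hcont, fun x hx => (d0 x hx).differentiableAt, fun x hx => (d1' x hx).differentiableAt,
      fun x hx => hamiltonian_eq_smul_iff.2 (d1' x hx).deriv, a, b, ?_, ?_, ?_⟩
    · refine tendsto_pi_nhds.2 fun i => ?_
      have := ((hzero i).mono_left (nhdsWithin_le_nhds (s := Set.Ioi 0))).const_add (a i)
      rw [add_zero] at this
      refine this.congr' ?_
      filter_upwards [self_mem_nhdsWithin] with x hx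
      rw [(d0 x (ne_of_gt hx)).deriv, ha i x hx]
    · refine tendsto_pi_nhds.2 fun i => ?_
      have := ((hzero i).mono_left (nhdsWithin_le_nhds (s := Set.Iio 0))).const_add (b i)
      rw [add_zero] at this
      refine this.congr' ?_
      filter_upwards [self_mem_nhdsWithin] with x hx
      rw [(d0 x (ne_of_lt hx)).deriv, hb i x hx]
    · funext i
      simpa using hab i
  refine ⟨u, hsol, fun h0 => hne (by rw [h0]), memLp_pi_iff.2 fun i => (hdom i).memLp, ?_⟩
  refine (memLp_pi_iff.2 fun i => (hdom i).memLp_fst : MemLp u₁ 2).ae_eq ?_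
  filter_upwards [Measure.ae_ne volume (0 : ℝ)] with x hx
  exact (d0 x hx).deriv.symm

end Domain

theorem memLp_two_reflect {u : ℝ → Fin 2 → ℂ} (h : MemLp u 2) : MemLp (fun x => u (-x)) 2 :=
  h.comp_measurePreserving (Measure.measurePreserving_neg volume)

theorem memLp_two_deriv_reflect {u : ℝ → Fin 2 → ℂ} (h : MemLp (deriv u) 2) :
    MemLp (deriv fun x => u (-x)) 2 := by
  rw [deriv_reflect]
  exact (memLp_two_reflect h).neg

/-! ### Singularity of `D` as intersection of two Lagrangian planes. -/

namespace JostSolutions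

variable {σ p q ω ξ : ℝ} (J : JostSolutions σ p q ω ξ)

theorem isAsymptoticTo₁ : IsAsymptoticTo (Complex.I * ξ) ![1, 0] J.f₁ :=
  J.sol₁.isAsymptoticTo J.lim₁ J.lim_deriv₁

theorem isAsymptoticTo₂ : IsAsymptoticTo (-(Complex.I * ξ)) ![1, 0] J.f₂ :=
  J.sol₂.isAsymptoticTo (by simpa using J.lim₂) (by simpa using J.lim_deriv₂)

theorem isAsymptoticTo₃ : IsAsymptoticTo (-(decayRate ω ξ : ℂ)) ![0, 1] J.f₃ :=
  J.sol₃.isAsymptoticTo (by simpa using J.lim₃) (by simpa using J.lim_deriv₃)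

theorem isAsymptoticToTilde₄ : IsAsymptoticTo (decayRate ω ξ : ℂ) ![0, 1] J.fTilde₄ :=
  J.solTilde₄.isAsymptoticTo J.limTilde₄ J.lim_derivTilde₄

theorem isAsymptoticTo₃_zero (hω : 0 < ω) {c : ℂ} (hc : c.re = 0) : IsAsymptoticTo c 0 J.f₃ :=
  J.isAsymptoticTo₃.of_re_lt (by simpa [hc] using decayRate_pos hω ξ)

theorem isAsymptoticTo_add_smul (hω : 0 < ω) (a b : ℂ) :
    IsAsymptoticTo (Complex.I * ξ) ![a, 0] fun x => a • J.f₁ x + b • J.f₃ x := by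
  have := J.isAsymptoticTo₁.add_smul (J.isAsymptoticTo₃_zero hω (c := Complex.I * ξ) (by simp))
    J.sol₁ J.sol₃ a b
  simpa using this

theorem eq_zero_of_add_smul_eq_zero (hω : 0 < ω) (a b : ℂ)
    (h : ∀ x, a • J.f₁ x + b • J.f₃ x = 0) : a = 0 ∧ b = 0 := by
  have ha : a = 0 := by
    have := congrFun ((J.isAsymptoticTo_add_smul hω a b).eq_zero h) 0
    simpa using this
  refine ⟨ha, ?_⟩
  have h2 := J.isAsymptoticTo₃.add_smul J.isAsymptoticTo₃ J.sol₃ J.sol₃ b 0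
  have := congrFun (h2.eq_zero fun x => by have := h x; simpa [ha] using this) 1
  simpa using this

theorem wronskian₁₃ (hω : 0 < ω) : wronskian J.f₁ J.f₃ = 0 := by
  rw [J.isAsymptoticTo₁.wronskian_eq
    (J.isAsymptoticTo₃_zero hω (c := -(Complex.I * ξ)) (by simp)) J.sol₁ J.sol₃]
  simp

/-- The solutions orthogonal to `f₁` and `f₃` are their linear combinations. -/
theorem exists_eq_add_smul (hq : q < 0) (hp : 4 < p) (hω : AdmissibleFrequency σ q ω)
    {u : ℝ → Fin 2 → ℂ} (hu : IsSolution σ p q ω (ξ ^ 2 / 2 + ω) u)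
    (h₁ : wronskian J.f₁ u = 0) (h₃ : wronskian J.f₃ u = 0) :
    ∃ a b : ℂ, ∀ x, u x = a • J.f₁ x + b • J.f₃ x := by
  have hω0 := (exists_soliton_eq_rpow hq hp hω).1
  exact J.sol₁.exists_eq_add_smul hq hp hω J.sol₃ hu (J.eq_zero_of_add_smul_eq_zero hω0)
    (J.wronskian₁₃ hω0) h₁ h₃

theorem D_eq : J.D = !![wronskian J.f₁ J.g₁, wronskian J.f₁ J.g₃;
    wronskian J.f₃ J.g₁, wronskian J.f₃ J.g₃] :=
  matrixWronskianAt_columns (J.sol₁.differentiableAt 1 one_ne_zero)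
    (J.sol₃.differentiableAt 1 one_ne_zero) (J.sol₁.reflect.differentiableAt 1 one_ne_zero)
    (J.sol₃.reflect.differentiableAt 1 one_ne_zero)

theorem D_mulVec (a b : ℂ) : J.D *ᵥ ![a, b] =
    ![wronskian J.f₁ (fun x => a • J.g₁ x + b • J.g₃ x),
      wronskian J.f₃ (fun x => a • J.g₁ x + b • J.g₃ x)] := by
  have k1 : IsSolution σ p q ω (ξ ^ 2 / 2 + ω) J.g₁ := J.sol₁.reflect
  have k3 : IsSolution σ p q ω (ξ ^ 2 / 2 + ω) J.g₃ := J.sol₃.reflect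
  rw [wronskian_add_smul_right k1 k3, wronskian_add_smul_right k1 k3, D_eq]
  ext i
  fin_cases i <;> simp

/-- `D` is singular if some nonzero solution is orthogonal to the solutions `f₁, f₃, g₁, g₃`. -/
theorem det_D_eq_zero (hq : q < 0) (hp : 4 < p) (hω : AdmissibleFrequency σ q ω)
    {u : ℝ → Fin 2 → ℂ} (hu : IsSolution σ p q ω (ξ ^ 2 / 2 + ω) u) (hne : u ≠ 0)
    (h₁ : wronskian u J.f₁ = 0) (h₃ : wronskian u J.f₃ = 0)
    (k₁ : wronskian (fun x => u (-x)) J.f₁ = 0) (k₃ : wronskian (fun x => u (-x)) J.f₃ = 0) :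
    J.D.det = 0 := by
  rw [wronskian_comm, neg_eq_zero] at h₁ h₃ k₁ k₃
  obtain ⟨a, b, hab⟩ := J.exists_eq_add_smul hq hp hω hu.reflect k₁ k₃
  have hu' : u = fun x => a • J.g₁ x + b • J.g₃ x := by
    funext x
    have := hab (-x)
    rwa [neg_neg] at this
  rw [← Matrix.exists_mulVec_eq_zero_iff]
  refine ⟨![a, b], fun h0 => hne ?_, ?_⟩
  · have e0 : a = 0 := by simpa using congrFun h0 0
    have e1 : b = 0 := by simpa using congrFun h0 1
    rw [hu', e0, e1]
    funext x
    simp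
  · rw [D_mulVec, ← hu', h₁, h₃]
    ext i
    fin_cases i <;> rfl

/-- If `D` is singular, some nonzero solution is a combination of `f₁, f₃` and one of `g₁, g₃`. -/
theorem exists_solution_of_det_D_eq_zero (hq : q < 0) (hp : 4 < p)
    (hω : AdmissibleFrequency σ q ω) (h : J.D.det = 0) :
    ∃ (u : ℝ → Fin 2 → ℂ) (a b c d : ℂ), IsSolution σ p q ω (ξ ^ 2 / 2 + ω) u ∧ u ≠ 0 ∧
      (∀ x, u x = a • J.f₁ x + b • J.f₃ x) ∧ ∀ x, u (-x) = c • J.f₁ x + d • J.f₃ x := by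
  have hω0 := (exists_soliton_eq_rpow hq hp hω).1
  obtain ⟨v, hv, hDv⟩ := Matrix.exists_mulVec_eq_zero_iff.2 h
  have hv' : v = ![v 0, v 1] := by
    ext i
    fin_cases i <;> rfl
  rw [hv', D_mulVec] at hDv
  have hsol : IsSolution σ p q ω (ξ ^ 2 / 2 + ω) fun x => v 0 • J.g₁ x + v 1 • J.g₃ x :=
    J.sol₁.reflect.add_smul J.sol₃.reflect (v 0) (v 1)
  obtain ⟨a, b, hab⟩ := J.exists_eq_add_smul hq hp hω hsol (congrFun hDv 0) (congrFun hDv 1)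
  have hrefl : ∀ x, v 0 • J.g₁ (-x) + v 1 • J.g₃ (-x) = v 0 • J.f₁ x + v 1 • J.f₃ x := fun x => by
    simp only [g₁, g₃, neg_neg]
  refine ⟨_, a, b, v 0, v 1, hsol, fun h0 => hv ?_, hab, hrefl⟩
  have := J.eq_zero_of_add_smul_eq_zero hω0 (v 0) (v 1) fun x => by
    rw [← hrefl]
    exact congrFun h0 (-x)
  rw [hv', this.1, this.2]
  ext i
  fin_cases i <;> rfl

/-- An eigenfunction is orthogonal to `f₁, f₃`, and so is its reflection; hence it lies in both
planes. This includes `ξ = 0`. -/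
theorem det_D_eq_zero_of_isEigenvalue (hq : q < 0) (hp : 4 < p) (hω : AdmissibleFrequency σ q ω)
    (h : IsEigenvalue σ p q ω (ξ ^ 2 / 2 + ω)) : J.D.det = 0 := by
  have hω0 := (exists_soliton_eq_rpow hq hp hω).1
  obtain ⟨u, hu, hne, h0, h1⟩ := h.exists_isSolution hq hp hω
  have hc1 : (Complex.I * ξ : ℂ).re ≤ 0 := by simp
  have hc3 : (-(decayRate ω ξ : ℂ)).re ≤ 0 := by simpa using (decayRate_pos hω0 ξ).le
  have r0 := memLp_two_reflect h0
  have r1 := memLp_two_deriv_reflect h1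
  exact J.det_D_eq_zero hq hp hω hu hne
    (hu.wronskian_eq_zero_of_memLp J.sol₁ J.isAsymptoticTo₁ hc1 h0 h1)
    (hu.wronskian_eq_zero_of_memLp J.sol₃ J.isAsymptoticTo₃ hc3 h0 h1)
    (hu.reflect.wronskian_eq_zero_of_memLp J.sol₁ J.isAsymptoticTo₁ hc1 r0 r1)
    (hu.reflect.wronskian_eq_zero_of_memLp J.sol₃ J.isAsymptoticTo₃ hc3 r0 r1)

end JostSolutions

/-- By continuity the essential bound holds at every point: `max ‖u‖ B` and `B` are continuous and
agree almost everywhere. -/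
theorem exists_norm_le_of_memLp_top {u : ℝ → Fin 2 → ℂ} (hu : Continuous u) (h : MemLp u ⊤) :
    ∃ B, ∀ x, ‖u x‖ ≤ B := by
  obtain ⟨B, hB⟩ : ∃ B, ∀ᵐ x : ℝ, ‖u x‖ ≤ B := by
    have := h.2
    rw [eLpNorm_exponent_top] at this
    refine ⟨(eLpNormEssSup u volume).toReal, ?_⟩
    filter_upwards [ae_le_eLpNormEssSup (f := u) (μ := volume)] with x hx
    have := ENNReal.toReal_mono this.ne hx
    simpa using this
  refine ⟨B, fun x => ?_⟩
  have h1 : (fun x => max ‖u x‖ B) =ᵐ[volume] fun _ => B := by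
    filter_upwards [hB] with x hx using max_eq_right hx
  have h2 := (Continuous.ae_eq_iff_eq volume (hu.norm.max continuous_const) continuous_const).1 h1
  exact max_eq_right_iff.1 (congrFun h2 x)

/-! ### Complex conjugation and conservation of flux. -/

section Conjugation

variable {σ p q ω lam : ℝ} {c : ℂ} {a : Fin 2 → ℂ} {u : ℝ → Fin 2 → ℂ}

theorem secondDeriv_star (σ p q ω lam x : ℝ) (v : Fin 2 → ℂ) :
    secondDeriv σ p q ω lam x (star v) = star (secondDeriv σ p q ω lam x v) := by
  funext i
  fin_cases i <;> simp [secondDeriv, pauli3]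

theorem deriv_star (u : ℝ → Fin 2 → ℂ) : deriv (fun x => star (u x)) = fun x => star (deriv u x) :=
  funext fun _ => deriv.star

theorem IsSolution.star (hu : IsSolution σ p q ω lam u) :
    IsSolution σ p q ω lam fun x => star (u x) := by
  refine ⟨hu.continuous.star, fun x hx => (hu.differentiableAt x hx).star, fun x hx => ?_,
    fun x hx => ?_, ?_⟩
  · rw [deriv_star]
    exact (hu.differentiableAt_deriv x hx).star
  · rw [hamiltonian_eq_smul_iff, deriv_star, deriv_star, secondDeriv_star]
    exact congrArg Star.star (hu.deriv_deriv hx)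
  · obtain ⟨r, s, hr, hs, hrs⟩ := hu.jump
    refine ⟨Star.star r, Star.star s, ?_, ?_, ?_⟩
    · rw [deriv_star]
      exact hr.star
    · rw [deriv_star]
      exact hs.star
    · rw [← star_sub, hrs, star_smul]
      simp

theorem IsAsymptoticTo.star (hu : IsAsymptoticTo c a u) :
    IsAsymptoticTo (star c) (star a) fun x => star (u x) := by
  have e : ∀ x : ℝ, Complex.exp (-(Star.star c * x)) = Star.star (Complex.exp (-(c * x))) :=
    fun x => by
      simp only [Complex.star_def, ← Complex.exp_conj, map_neg, map_mul, Complex.conj_ofReal]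
  refine ⟨?_, ?_⟩
  · simp only [e, ← star_smul]
    exact hu.tendsto.star
  · simp only [e, deriv_star, ← star_smul]
    exact hu.tendsto_deriv.star

/-- The flux of a solution that behaves like `e^{iξx} a` at infinity. -/
theorem IsAsymptoticTo.wronskian_star {ξ : ℝ} (hu : IsAsymptoticTo (Complex.I * ξ) a u)
    (su : IsSolution σ p q ω lam u) :
    wronskian u (fun x => Star.star (u x)) = 2 * (Complex.I * ξ) * (a ⬝ᵥ Star.star a) := by
  have h := hu.star
  rw [show Star.star (Complex.I * ξ : ℂ) = -(Complex.I * ξ) by simp] at h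
  exact hu.wronskian_eq h su su.star

end Conjugation

namespace JostSolutions

variable {σ p q ω ξ : ℝ} (J : JostSolutions σ p q ω ξ)

theorem isEigenvalue_of_det_D_eq_zero (hq : q < 0) (hp : 4 < p) (hω : AdmissibleFrequency σ q ω)
    (hξ : ξ ≠ 0) (h : J.D.det = 0) : IsEigenvalue σ p q ω (ξ ^ 2 / 2 + ω) := by
  have hω0 := (exists_soliton_eq_rpow hq hp hω).1
  obtain ⟨u, a, b, c, d, hu, hne, hr, hl⟩ := J.exists_solution_of_det_D_eq_zero hq hp hω h
  have ar := J.isAsymptoticTo_add_smul hω0 a b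
  have al := J.isAsymptoticTo_add_smul hω0 c d
  simp only [← hr] at ar
  simp only [← hl] at al
  -- Flux at `+∞`, and below the flux at `-∞` computed on the reflected solution. Reflection
  -- reverses the sign of `W`, so the two nonnegative quantities `|a|²` and `|c|²` sum to zero.
  have w1 := ar.wronskian_star hu
  have w2 := al.wronskian_star hu.reflect
  rw [wronskian_reflect hu hu.star, w1] at w2
  have hac : Complex.normSq a + Complex.normSq c = 0 := by
    have hI : (2 * (Complex.I * ξ) : ℂ) ≠ 0 := by simp [hξ]
    have key : 2 * (Complex.I * ξ) * ((Complex.normSq a + Complex.normSq c : ℝ) : ℂ) = 0 := by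
      simp [dotProduct, Fin.sum_univ_two, Complex.mul_conj] at w2
      push_cast
      linear_combination -w2
    exact_mod_cast (mul_eq_zero.1 key).resolve_left hI
  have ha : a = 0 := Complex.normSq_eq_zero.1
    (by linarith [Complex.normSq_nonneg a, Complex.normSq_nonneg c])
  have hc : c = 0 := Complex.normSq_eq_zero.1
    (by linarith [Complex.normSq_nonneg a, Complex.normSq_nonneg c])
  have hre : (-(decayRate ω ξ : ℂ)).re < 0 := by simpa using decayRate_pos hω0 ξ
  -- With `a = c = 0` only multiples of `f₃` are left at each end, so the exponential rate `μ` is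
  -- available on both half-lines.
  have br := J.isAsymptoticTo₃.add_smul J.isAsymptoticTo₃ J.sol₃ J.sol₃ 0 b
  have bl := J.isAsymptoticTo₃.add_smul J.isAsymptoticTo₃ J.sol₃ J.sol₃ 0 d
  rw [show (fun x => (0 : ℂ) • J.f₃ x + b • J.f₃ x) = u from
    funext fun x => by rw [hr, ha]; simp] at br
  rw [show (fun x => (0 : ℂ) • J.f₃ x + d • J.f₃ x) = fun x => u (-x) from
    funext fun x => by rw [hl, hc]; simp] at bl
  obtain ⟨r0, r1⟩ := hu.integrableOn_of_decay br hre
  obtain ⟨l0, l1⟩ := hu.reflect.integrableOn_of_decay bl hre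
  refine hu.isEigenvalue hq hp hω hne
    (memLp_two_of_integrableOn_Ioi hu.continuous.aestronglyMeasurable r0 l0)
    (memLp_two_of_integrableOn_Ioi (aestronglyMeasurable_deriv_pi u) r1 ?_)
  simpa only [deriv_reflect, norm_neg] using l1

/-! ### The matrix `A` and its determinant. -/

section Scattering

theorem sol₄ : IsSolution σ p q ω (ξ ^ 2 / 2 + ω) J.f₄ := by
  have := (J.solTilde₄.add_smul J.sol₁ 1 (-J.c₁)).add_smul J.sol₂ 1 (-J.c₂)
  convert this using 1
  funext x
  simp only [f₄]
  module

theorem wronskian_f₄ (h : ℝ → Fin 2 → ℂ) : wronskian h J.f₄ =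
    wronskian h J.fTilde₄ - J.c₁ * wronskian h J.f₁ - J.c₂ * wronskian h J.f₂ := by
  have e : J.f₄ = fun x => (1 : ℂ) • ((1 : ℂ) • J.fTilde₄ x + (-J.c₁) • J.f₁ x) +
      (-J.c₂) • J.f₂ x := by
    funext x
    simp only [f₄]
    module
  rw [e, wronskian_add_smul_right (J.solTilde₄.add_smul J.sol₁ 1 (-J.c₁)) J.sol₂,
    wronskian_add_smul_right J.solTilde₄ J.sol₁]
  ring

theorem wronskian₁₂ : wronskian J.f₁ J.f₂ = 2 * Complex.I * ξ := by
  rw [J.isAsymptoticTo₁.wronskian_eq J.isAsymptoticTo₂ J.sol₁ J.sol₂]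
  simp [dotProduct, Fin.sum_univ_two, mul_assoc]

theorem wronskian₃₁ (hω : 0 < ω) : wronskian J.f₃ J.f₁ = 0 := by
  rw [wronskian_comm, J.wronskian₁₃ hω, neg_zero]

theorem wronskian₃₂ (hω : 0 < ω) : wronskian J.f₃ J.f₂ = 0 := by
  rw [(J.isAsymptoticTo₃_zero hω (c := Complex.I * ξ) (by simp)).wronskian_eq J.isAsymptoticTo₂
    J.sol₃ J.sol₂]
  simp

/-- The multiple `c₂` of `f₂` is chosen for this; the multiple of `f₁` does not contribute because
`W[f₁, f₁] = 0`. -/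
theorem wronskian₁₄ (hξ : ξ ≠ 0) : wronskian J.f₁ J.f₄ = 0 := by
  have hξ' : (ξ : ℂ) ≠ 0 := by exact_mod_cast hξ
  have hI := Complex.I_ne_zero
  rw [wronskian_f₄, wronskian_self, wronskian₁₂, c₂]
  field_simp
  ring

theorem wronskian₃₄ (hω : 0 < ω) : wronskian J.f₃ J.f₄ = -2 * decayRate ω ξ := by
  rw [wronskian_f₄, J.wronskian₃₁ hω, J.wronskian₃₂ hω]
  have h := J.isAsymptoticToTilde₄
  rw [← neg_neg (decayRate ω ξ : ℂ)] at h
  rw [J.isAsymptoticTo₃.wronskian_eq h J.sol₃ J.solTilde₄]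
  simp [dotProduct, Fin.sum_univ_two]

/-- Pairing with `f₁` sees only `f₂`, and pairing with `f₃` sees only `f₄`; this dictates their
coefficients. The remainder is orthogonal to the Lagrangian plane of `f₁, f₃`, hence lies in it. -/
theorem exists_expansion (hq : q < 0) (hp : 4 < p) (hω : AdmissibleFrequency σ q ω) (hξ : ξ ≠ 0)
    {u : ℝ → Fin 2 → ℂ} (hu : IsSolution σ p q ω (ξ ^ 2 / 2 + ω) u) :
    ∃ a b c d : ℂ, ∀ x, u x = a • J.f₂ x + b • J.f₄ x + (c • J.f₁ x + d • J.f₃ x) := by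
  have hω0 := (exists_soliton_eq_rpow hq hp hω).1
  have hξ' : (ξ : ℂ) ≠ 0 := by exact_mod_cast hξ
  have hμ : (decayRate ω ξ : ℂ) ≠ 0 := by exact_mod_cast (decayRate_pos hω0 ξ).ne'
  have hI := Complex.I_ne_zero
  set a := wronskian J.f₁ u / (2 * Complex.I * ξ) with ha
  set b := wronskian J.f₃ u / (-2 * decayRate ω ξ) with hb
  have s24 := J.sol₂.add_smul J.sol₄ a b
  have hw := hu.add_smul s24 1 (-1)
  obtain ⟨c, d, hcd⟩ := J.exists_eq_add_smul hq hp hω hw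
    (by
      rw [wronskian_add_smul_right hu s24, wronskian_add_smul_right J.sol₂ J.sol₄, J.wronskian₁₂,
        J.wronskian₁₄ hξ, ha]
      field_simp
      ring)
    (by
      rw [wronskian_add_smul_right hu s24, wronskian_add_smul_right J.sol₂ J.sol₄,
        J.wronskian₃₂ hω0, J.wronskian₃₄ hω0, hb]
      field_simp
      ring)
  refine ⟨a, b, c, d, fun x => ?_⟩
  rw [← hcd]
  module

theorem isScatteringPair_iff (A B : Matrix (Fin 2) (Fin 2) ℂ) : J.IsScatteringPair A B ↔
    (∀ x, J.f₁ x = A 0 0 • J.g₂ x + A 1 0 • J.g₄ x + (B 0 0 • J.g₁ x + B 1 0 • J.g₃ x)) ∧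
    ∀ x, J.f₃ x = A 0 1 • J.g₂ x + A 1 1 • J.g₄ x + (B 0 1 • J.g₁ x + B 1 1 • J.g₃ x) := by
  have h1 : ∀ x i j, (J.G₁ x * A + J.G₂ x * B) i j =
      (A 0 j • J.g₂ x + A 1 j • J.g₄ x + (B 0 j • J.g₁ x + B 1 j • J.g₃ x)) i := by
    intro x i j
    simp [G₁, G₂, Matrix.mul_apply, Fin.sum_univ_two]
    ring
  constructor
  · intro h
    refine ⟨fun x => funext fun i => ?_, fun x => funext fun i => ?_⟩
    · rw [← h1, ← h x]
      rfl
    · rw [← h1, ← h x]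
      rfl
  · rintro ⟨h0, h3⟩ x
    ext i j
    rw [h1]
    fin_cases j
    · exact congrFun (h0 x) i
    · exact congrFun (h3 x) i

/-- Expanding the reflections of `f₁` and `f₃` in the basis at `+∞` and reflecting back gives the
columns of `A` and `B`. -/
theorem exists_isScatteringPair (hq : q < 0) (hp : 4 < p) (hω : AdmissibleFrequency σ q ω)
    (hξ : ξ ≠ 0) : ∃ A B : Matrix (Fin 2) (Fin 2) ℂ, J.IsScatteringPair A B := by
  obtain ⟨a, b, c, d, h⟩ := J.exists_expansion hq hp hω hξ J.sol₁.reflect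
  obtain ⟨a', b', c', d', h'⟩ := J.exists_expansion hq hp hω hξ J.sol₃.reflect
  refine ⟨!![a, a'; b, b'], !![c, c'; d, d'], (J.isScatteringPair_iff _ _).2
    ⟨fun x => ?_, fun x => ?_⟩⟩
  · have := h (-x)
    rw [neg_neg] at this
    exact this
  · have := h' (-x)
    rw [neg_neg] at this
    exact this

theorem wronskian_reflect_expansion (hω : 0 < ω) (hξ : ξ ≠ 0) {u : ℝ → Fin 2 → ℂ} {a b c d : ℂ}
    (h : ∀ x, u x = a • J.g₂ x + b • J.g₄ x + (c • J.g₁ x + d • J.g₃ x)) :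
    wronskian u J.g₁ = 2 * Complex.I * ξ * a ∧ wronskian u J.g₃ = -2 * decayRate ω ξ * b := by
  have s1 : IsSolution σ p q ω (ξ ^ 2 / 2 + ω) J.g₁ := J.sol₁.reflect
  have s2 : IsSolution σ p q ω (ξ ^ 2 / 2 + ω) J.g₂ := J.sol₂.reflect
  have s3 : IsSolution σ p q ω (ξ ^ 2 / 2 + ω) J.g₃ := J.sol₃.reflect
  have s4 : IsSolution σ p q ω (ξ ^ 2 / 2 + ω) J.g₄ := J.sol₄.reflect
  have w12 : wronskian J.g₁ J.g₂ = -(2 * Complex.I * ξ) :=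
    (wronskian_reflect J.sol₁ J.sol₂).trans (by rw [wronskian₁₂])
  have w13 : wronskian J.g₁ J.g₃ = 0 :=
    (wronskian_reflect J.sol₁ J.sol₃).trans (by rw [J.wronskian₁₃ hω, neg_zero])
  have w14 : wronskian J.g₁ J.g₄ = 0 :=
    (wronskian_reflect J.sol₁ J.sol₄).trans (by rw [J.wronskian₁₄ hξ, neg_zero])
  have w31 : wronskian J.g₃ J.g₁ = 0 :=
    (wronskian_reflect J.sol₃ J.sol₁).trans (by rw [J.wronskian₃₁ hω, neg_zero])
  have w32 : wronskian J.g₃ J.g₂ = 0 :=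
    (wronskian_reflect J.sol₃ J.sol₂).trans (by rw [J.wronskian₃₂ hω, neg_zero])
  have w34 : wronskian J.g₃ J.g₄ = 2 * decayRate ω ξ :=
    (wronskian_reflect J.sol₃ J.sol₄).trans (by rw [J.wronskian₃₄ hω]; ring)
  have e : u = fun x => (1 : ℂ) • (a • J.g₂ x + b • J.g₄ x) +
      (1 : ℂ) • (c • J.g₁ x + d • J.g₃ x) := funext fun x => by rw [h]; module
  have key : ∀ g, wronskian u g = -(a * wronskian g J.g₂ + b * wronskian g J.g₄ +
      (c * wronskian g J.g₁ + d * wronskian g J.g₃)) := fun g => by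
    rw [wronskian_comm, e, wronskian_add_smul_right (s2.add_smul s4 a b) (s1.add_smul s3 c d),
      wronskian_add_smul_right s2 s4, wronskian_add_smul_right s1 s3]
    ring
  refine ⟨?_, ?_⟩
  · rw [key, w12, w13, w14, wronskian_self]
    ring
  · rw [key, w31, w32, w34, wronskian_self]
    ring

/-- Pairing with `g₁` and `g₃` multiplies the rows of `A` by `2iξ` and `-2μ` and annihilates `B`, so
`D` is the transpose of the rescaled `A`. -/
theorem det_D_eq (hω : 0 < ω) (hξ : ξ ≠ 0) {A B : Matrix (Fin 2) (Fin 2) ℂ}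
    (h : J.IsScatteringPair A B) :
    J.D.det = -4 * Complex.I * ξ * decayRate ω ξ * A.det := by
  obtain ⟨h1, h3⟩ := (J.isScatteringPair_iff A B).1 h
  obtain ⟨e11, e13⟩ := J.wronskian_reflect_expansion hω hξ h1
  obtain ⟨e31, e33⟩ := J.wronskian_reflect_expansion hω hξ h3
  rw [D_eq, Matrix.det_fin_two_of, Matrix.det_fin_two, e11, e13, e31, e33]
  ring

end Scattering

end JostSolutions

/-! ### Resonances and eigenvalues at `ξ = 0`. -/

section Threshold

variable {σ p q ω : ℝ}

theorem JostSolutions.det_D_eq_zero_of_isResonance (J : JostSolutions σ p q ω 0) (hq : q < 0)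
    (hp : 4 < p) (hω : AdmissibleFrequency σ q ω) (h : IsResonance σ p q ω ω) : J.D.det = 0 := by
  have hω0 := (exists_soliton_eq_rpow hq hp hω).1
  obtain ⟨u, hu, htop, h1, h2⟩ := h
  obtain ⟨B, hB⟩ := exists_norm_le_of_memLp_top hu.continuous htop
  replace hu : IsSolution σ p q ω ((0 : ℝ) ^ 2 / 2 + ω) u := by
    rwa [show (0 : ℝ) ^ 2 / 2 + ω = ω by ring]
  have hne : u ≠ 0 := by
    rintro rfl
    exact h2 MemLp.zero
  have hc1 : (Complex.I * (0 : ℝ) : ℂ).re ≤ 0 := by simp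
  have hc3 : (-(decayRate ω 0 : ℂ)).re ≤ 0 := by simpa using (decayRate_pos hω0 0).le
  have d1 : Tendsto (deriv J.f₁) atTop (𝓝 0) := by
    simpa using J.isAsymptoticTo₁.tendsto_deriv
  have d3 : Tendsto (deriv J.f₃) atTop (𝓝 0) := by
    simpa using (J.isAsymptoticTo₃_zero hω0 (c := 0) (by simp)).tendsto_deriv
  have r1 := memLp_two_deriv_reflect h1
  exact J.det_D_eq_zero hq hp hω hu hne
    (hu.wronskian_eq_zero_of_bounded J.sol₁ J.isAsymptoticTo₁ hc1 d1 hB h1)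
    (hu.wronskian_eq_zero_of_bounded J.sol₃ J.isAsymptoticTo₃ hc3 d3 hB h1)
    (hu.reflect.wronskian_eq_zero_of_bounded J.sol₁ J.isAsymptoticTo₁ hc1 d1 (fun x => hB _) r1)
    (hu.reflect.wronskian_eq_zero_of_bounded J.sol₃ J.isAsymptoticTo₃ hc3 d3 (fun x => hB _) r1)

/-- A solution in both planes is bounded at both ends, and the energy estimate, applied to it and to
its reflection, puts its derivative in `L²`. Membership of the solution itself in `L²` then decides
between the two alternatives. -/
theorem JostSolutions.isResonance_or_isEigenvalue (J : JostSolutions σ p q ω 0) (hq : q < 0)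
    (hp : 4 < p) (hω : AdmissibleFrequency σ q ω) (h : J.D.det = 0) :
    IsResonance σ p q ω ω ∨ IsEigenvalue σ p q ω ω := by
  have hω0 := (exists_soliton_eq_rpow hq hp hω).1
  obtain ⟨u, a, b, c, d, hu, hne, hr, hl⟩ := J.exists_solution_of_det_D_eq_zero hq hp hω h
  rw [show (0 : ℝ) ^ 2 / 2 + ω = ω by ring] at hu
  have ar := J.isAsymptoticTo_add_smul hω0 a b
  have al := J.isAsymptoticTo_add_smul hω0 c d
  simp only [← hr, Complex.ofReal_zero, mul_zero] at ar
  simp only [← hl, Complex.ofReal_zero, mul_zero] at al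
  have hd : MemLp (deriv u) 2 := by
    refine memLp_two_of_integrableOn_Ioi (aestronglyMeasurable_deriv_pi u)
      (hu.integrableOn_deriv_of_threshold hq hp hω ar) ?_
    have := hu.reflect.integrableOn_deriv_of_threshold hq hp hω al
    simpa only [deriv_reflect, norm_neg] using this
  by_cases h2 : MemLp u 2
  · exact Or.inr (hu.isEigenvalue hq hp hω hne h2 hd)
  · refine Or.inl ⟨u, hu, ?_, hd, h2⟩
    obtain ⟨B, hB⟩ := ar.exists_norm_le (by simp) hu.continuous
    obtain ⟨B', hB'⟩ := al.exists_norm_le (by simp) hu.reflect.continuous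
    refine memLp_top_of_bound hu.continuous.aestronglyMeasurable (max B B')
      (Eventually.of_forall fun x => ?_)
    rcases le_total 0 x with hx | hx
    · exact (hB x hx).trans (le_max_left _ _)
    · have := hB' (-x) (by linarith)
      rw [neg_neg] at this
      exact this.trans (le_max_right _ _)

end Threshold

end

end DeltaNLS

theorem proposition4p5 (σ p q ω : ℝ) (hq : q < 0) (hp : 4 < p)
    (hω : DeltaNLS.AdmissibleFrequency σ q ω) :
    (∀ ξ : ℝ, Nonempty (DeltaNLS.JostSolutions σ p q ω ξ)) ∧
    (∀ ξ : ℝ, ξ ≠ 0 → ∀ J : DeltaNLS.JostSolutions σ p q ω ξ,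
      (∃ A B : Matrix (Fin 2) (Fin 2) ℂ, J.IsScatteringPair A B) ∧
      ∀ A B : Matrix (Fin 2) (Fin 2) ℂ, J.IsScatteringPair A B →
        [J.D.det = 0,
          DeltaNLS.IsEigenvalue σ p q ω (ξ ^ 2 / 2 + ω),
          A.det = 0].TFAE) ∧
    (∀ J : DeltaNLS.JostSolutions σ p q ω 0,
      J.D.det = 0 ↔
        (DeltaNLS.IsResonance σ p q ω ω ∨ DeltaNLS.IsEigenvalue σ p q ω ω)) := by
  have hω0 := (DeltaNLS.exists_soliton_eq_rpow hq hp hω).1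
  refine ⟨fun ξ => DeltaNLS.nonempty_jostSolutions hq hp hω ξ, fun ξ hξ J =>
    ⟨J.exists_isScatteringPair hq hp hω hξ, fun A B hAB => ?_⟩, fun J =>
    ⟨J.isResonance_or_isEigenvalue hq hp hω, ?_⟩⟩
  · tfae_have 1 → 2 := J.isEigenvalue_of_det_D_eq_zero hq hp hω hξ
    tfae_have 2 → 1 := J.det_D_eq_zero_of_isEigenvalue hq hp hω
    tfae_have 1 ↔ 3 := by
      have hμ := (DeltaNLS.decayRate_pos hω0 ξ).ne'
      rw [J.det_D_eq hω0 hξ hAB]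
      simp [hξ, hμ]
    tfae_finish
  · rintro (h | h)
    · exact J.det_D_eq_zero_of_isResonance hq hp hω h
    · refine J.det_D_eq_zero_of_isEigenvalue hq hp hω ?_
      rwa [show (0 : ℝ) ^ 2 / 2 + ω = ω by ring]
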